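/- Let $k\ge 1$ and let $\alpha_1,\dots,\alpha_k,\beta_1,\dots,\beta_k>0$ satisfy $\alpha_1\cdots\alpha_k=\beta_1\cdots\beta_k$. Put $$\Phi(z)=\frac1{(1-z^{-1})^k}\prod_{m=1}^k\begin{pmatrix}1&\alpha_m z^{-1}\\ \alpha_m^{-1}&1\end{pmatrix}\begin{pmatrix}1&\beta_m z^{-1}\\ \beta_m^{-1}&1\end{pmatrix},\qquad p(z)=\big((z-1)^k\operatorname{Tr}\Phi(z)\big)^2-4(z-1)^{2k}.$$ Then $p$ is a real polynomial of the form $p=q^2p_0$, where $q$ (monic, of degree $k-k'$) and $p_0$ (of degree $2k'-1$) have only simple zeros, $1\le k'\le k$, and the zeros of $p_0$ are real, $0=x_0>x_1>\dots>x_{2(k'-1)}$. Let $\mathcal R$ be the compact Riemann surface $w^2=p_0(z)$ (with one point at infinity), let $$\rho(z,w)=\tfrac12\operatorname{Tr}\Phi(z)+\frac{q(z)w}{2(z-1)^k},\qquad F(z,w;\chi,\eta)=\tfrac k4(\eta+1)\log z-\tfrac k2\log(z-1)-\tfrac\chi2\log\rho(z,w)$$ on $\mathcal R$; a critical point of $F$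 of order $n\geq 1$ is a zero of order $n$ of the derivative of $F$ in a local coordinate of $\mathcal R$. Let $C_0^+\subset\mathcal R$ be the set of points over $z\in[0,\infty]$ and, for $\ell=1,\dots,k'-1$, let $I_\ell=(x_{2\ell},x_{2\ell-1})$ and let $C_\ell^+$ be the set of points over $z\in\overline{I_\ell}$. Let $\mathcal E_{RS}^{(\ell)}$ be the set of $(\chi,\eta)\in(-1,1)^2$ for which $F$ has a critical point of order at least two in $C_\ell^+$. Let $\mathcal E_{FR}$ be the set of $(\chi,\eta)\in(-1,1)^2$ for which $F$ has a critical point of order two in $C_0^+$, together with the four points $(0,\pm1)$ and $\big(\pm1,\frac1k\frac{p'(1)}{p(1)}-1\big)$. Then: 1. For $\ell=1,\dots,k'-1$ the set $\mathcal E_{RS}^{(\ell)}$ is a simple closed curve containing $\big(0,\frac{x_{2\ell}+1}{x_{2\ell}-1}\big)$ and $\big(0,\frac{x_{2\ell-1}+1}{x_{2\ell-1}-1}\big)$. 2. $\mathcal E_{FR}$ is a simple closed curve. 3. The curves $\mathcal E_{FR},\mathcal E_{RS}^{(1)},\dots,\mathcal E_{RS}^{(k'-1)}$ are pairwise disjoint,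 and each of them is symmetric with respect to the line $\chi=0$. 4. Let $\rho_1(z)=\tfrac12\operatorname{Tr}\Phi(z)+\frac{q(z)p_0(z)^{1/2}}{2(z-1)^k}$, an eigenvalue of $\Phi(z)$, where $p_0^{1/2}$ is the analytic continuation of the positive root on $(0,\infty)$ to $\mathbb C\setminus\big((-\infty,x_{2(k'-1)}]\cup\bigcup_{\ell=0}^{k'-2}[x_{2\ell+1},x_{2\ell}]\big)$. Put $g(z)=z\rho_1'(z)/\rho_1(z)$ and $$\chi(z)=\frac{k}{(z-1)^2g'(z)},\qquad \eta(z)=\frac1{z-1}\Big(\frac{2g(z)}{(z-1)g'(z)}+z+1\Big).$$ On $I=\overline{I_\ell}$, and on $I=[0,\infty]$, the functions $\chi,\eta$ (defined by these formulas for $z\in I_\ell$, respectively $z\in(0,\infty)\setminus\{1\}$) are real and extend continuously to $I$; the map $I\ni z\mapsto(\chi(z),\eta(z))$ is injective, with $\chi\ne0$ except at the endpoints of $I$, and together with $I\ni z\mapsto(-\chi(z),\eta(z))$ it parametrizes $\mathcal E_{RS}^{(\ell)}$, respectively $\mathcal E_{FR}$. The extensions take the value $\big(0,\frac{x_j+1}{x_j-1}\big)$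 at $z=x_j$, $j\in\{2\ell,2\ell-1\}$, and the values $(0,-1)$, $\big(1,\frac1k\frac{p'(1)}{p(1)}-1\big)$, $(0,1)$ at $z=0,1,\infty$. -/

import Mathlib

open Polynomial Filter Topology Set

noncomputable section

namespace PeriodicAztec

variable {k : ℕ}

/-- The matrix symbol of one period,
`Φ(z) = (1 - z⁻¹)⁻ᵏ ∏ₘ (1, αₘ z⁻¹; αₘ⁻¹, 1) (1, βₘ z⁻¹; βₘ⁻¹, 1)`, an ordered product. -/
def Phi (α β : Fin k → ℝ) (z : ℂ) : Matrix (Fin 2) (Fin 2) ℂ :=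
  ((1 - z⁻¹) ^ k)⁻¹ •
    (List.ofFn fun m : Fin k =>
      (!![1, (α m : ℂ) * z⁻¹; (α m : ℂ)⁻¹, 1] : Matrix (Fin 2) (Fin 2) ℂ) *
        !![1, (β m : ℂ) * z⁻¹; (β m : ℂ)⁻¹, 1]).prod

/-- The polynomial matrix `(z - 1)ᵏ Φ(z)` (see `map_phiPoly`). -/
def phiPoly (α β : Fin k → ℝ) : Matrix (Fin 2) (Fin 2) ℝ[X] :=
  (List.ofFn fun m : Fin k =>
    (!![X + C (α m * (β m)⁻¹), C (α m + β m);
        C ((α m)⁻¹ + (β m)⁻¹) * X, X + C (β m * (α m)⁻¹)] : Matrix (Fin 2) (Fin 2) ℝ[X])).prod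

/-- `p(z) = ((z - 1)ᵏ Tr Φ(z))² - 4 (z - 1)²ᵏ` as a real polynomial. -/
def discPoly (α β : Fin k → ℝ) : ℝ[X] :=
  (phiPoly α β).trace ^ 2 - 4 * (X - 1) ^ (2 * k)

/-- The monic polynomial `q` that collects the double zeros of `p`. -/
def qPoly (α β : Fin k → ℝ) : ℝ[X] :=
  ∏ s ∈ (discPoly α β).roots.toFinset, (X - C s) ^ ((discPoly α β).rootMultiplicity s / 2)

/-- The polynomial `p₀` in `p = q² p₀`. -/
def p0Poly (α β : Fin k → ℝ) : ℝ[X] :=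
  discPoly α β /ₘ (qPoly α β ^ 2)

/-- The number `k'`, determined by `deg p₀ = 2 k' - 1`. -/
def kPrime (α β : Fin k → ℝ) : ℕ := ((p0Poly α β).natDegree + 1) / 2

/-- The zeros `x₀ > x₁ > ⋯ > x_{2(k'-1)}` of `p₀` in decreasing order. -/
def branchPt (α β : Fin k → ℝ) (j : ℕ) : ℝ :=
  ((p0Poly α β).roots.sort (· ≥ ·)).getD j 0

/-- The compact Riemann surface `w² = p₀(z)`: the affine curve with one point at infinity. -/
abbrev Surface (α β : Fin k → ℝ) : Type :=
  OnePoint {P : ℂ × ℂ // P.2 ^ 2 = aeval P.1 (p0Poly α β)}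

/-- `t ↦ (Z t, W t)`, `t` near `0`, is a local holomorphic parametrization (the inverse of a
chart) of the surface which maps `0` to the given point.  At the point at infinity `Z` has a pole
of order two, since `1/√z` is a local coordinate there. -/
def IsLocalParam (α β : Fin k → ℝ) (Z W : ℂ → ℂ) : Surface α β → Prop
  | none => MeromorphicAt Z 0 ∧ MeromorphicAt W 0 ∧ meromorphicOrderAt Z 0 = -2 ∧
      ∀ᶠ t in 𝓝[≠] (0 : ℂ), W t ^ 2 = aeval (Z t) (p0Poly α β)
  | some P => AnalyticAt ℂ Z 0 ∧ AnalyticAt ℂ W 0 ∧ Z 0 = P.1.1 ∧ W 0 = P.1.2 ∧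
      (deriv Z 0 ≠ 0 ∨ deriv W 0 ≠ 0) ∧
      ∀ᶠ t in 𝓝 (0 : ℂ), W t ^ 2 = aeval (Z t) (p0Poly α β)

/-- The meromorphic function `ρ(z,w) = Tr Φ(z) / 2 + q(z) w / (2 (z - 1)ᵏ)`. -/
def rho (α β : Fin k → ℝ) (z w : ℂ) : ℂ :=
  (Phi α β z).trace / 2 + aeval z (qPoly α β) * w / (2 * (z - 1) ^ k)

/-- The derivative in the local coordinate `t` of (any local branch of)
`F(z,w;χ,η) = k/4 (η+1) log z - k/2 log (z-1) - χ/2 log ρ(z,w)` at `(z,w) = (Z t, W t)`. -/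
def derivF (α β : Fin k → ℝ) (χ η : ℝ) (Z W : ℂ → ℂ) (t : ℂ) : ℂ :=
  (k : ℂ) / 4 * (η + 1) * logDeriv Z t - (k : ℂ) / 2 * logDeriv (fun s => Z s - 1) t
    - (χ : ℂ) / 2 * logDeriv (fun s => rho α β (Z s) (W s)) t

/-- `F(·;χ,η)` has a critical point of order `n ≥ 1` at the point `P` of the surface:
in a local coordinate at `P`, the derivative of `F` has a zero of order `n`. -/
def IsCriticalOfOrder (α β : Fin k → ℝ) (χ η : ℝ) (P : Surface α β) (n : ℕ) : Prop :=
  1 ≤ n ∧ ∃ Z W : ℂ → ℂ, IsLocalParam α β Z W P ∧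
    meromorphicOrderAt (derivF α β χ η Z W) 0 = ((n : ℤ) : WithTop ℤ)

/-- The loop `C₀⁺`: the points over `[0, ∞]`. -/
def loopZero (α β : Fin k → ℝ) : Set (Surface α β) :=
  insert OnePoint.infty {Q | ∃ P : {P : ℂ × ℂ // P.2 ^ 2 = aeval P.1 (p0Poly α β)},
    Q = OnePoint.some P ∧ ∃ x : ℝ, 0 ≤ x ∧ P.1.1 = x}

/-- The loop `C_ℓ⁺`: the points over `[x_{2ℓ}, x_{2ℓ-1}]`, for `1 ≤ ℓ ≤ k' - 1`. -/
def loop (α β : Fin k → ℝ) (l : ℕ) : Set (Surface α β) :=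
  {Q | ∃ P : {P : ℂ × ℂ // P.2 ^ 2 = aeval P.1 (p0Poly α β)}, Q = OnePoint.some P ∧
    ∃ x ∈ Icc (branchPt α β (2 * l)) (branchPt α β (2 * l - 1)), P.1.1 = ((x : ℝ) : ℂ)}

/-- The frozen-rough boundary inside the open square. -/
def frozenRough (α β : Fin k → ℝ) : Set (ℝ × ℝ) :=
  {c | c.1 ∈ Ioo (-1 : ℝ) 1 ∧ c.2 ∈ Ioo (-1 : ℝ) 1 ∧
    ∃ P ∈ loopZero α β, IsCriticalOfOrder α β c.1 c.2 P 2}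

/-- The height `p'(1) / (k p(1)) - 1` at which the frozen-rough boundary touches `χ = ±1`. -/
def touchHeight (α β : Fin k → ℝ) : ℝ :=
  (discPoly α β).derivative.eval 1 / (k * (discPoly α β).eval 1) - 1

/-- The frozen-rough boundary with the four points on the boundary of the square added. -/
def frozenRoughExt (α β : Fin k → ℝ) : Set (ℝ × ℝ) :=
  frozenRough α β ∪ {(0, 1), (0, -1), (1, touchHeight α β), (-1, touchHeight α β)}

/-- The rough-smooth boundaries, for `1 ≤ ℓ ≤ k' - 1`. -/
def roughSmooth (α β : Fin k → ℝ) (l : ℕ) : Set (ℝ × ℝ) :=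
  {c | c.1 ∈ Ioo (-1 : ℝ) 1 ∧ c.2 ∈ Ioo (-1 : ℝ) 1 ∧
    ∃ P ∈ loop α β l, ∃ n : ℕ, 2 ≤ n ∧ IsCriticalOfOrder α β c.1 c.2 P n}

/-- A simple closed (Jordan) curve in the plane. -/
def IsSimpleClosedCurve (S : Set (ℝ × ℝ)) : Prop :=
  ∃ γ : Circle → ℝ × ℝ, Continuous γ ∧ Function.Injective γ ∧ range γ = S

/-- Reflection in the line `χ = 0`. -/
def flipChi (c : ℝ × ℝ) : ℝ × ℝ := (-c.1, c.2)

/-- The branch of `p₀^{1/2}` that is positive on `(0, ∞)`, cut along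
`(-∞, x_{2(k'-1)}] ∪ ⋃ [x_{2ℓ+1}, x_{2ℓ}]`, with values from the upper half plane on the cuts
(a product of principal square roots; the jumps cancel on the intervals `(x_{2ℓ}, x_{2ℓ-1})`). -/
def sqrtP0 (α β : Fin k → ℝ) (z : ℂ) : ℂ :=
  (Real.sqrt (p0Poly α β).leadingCoeff : ℂ) *
    ((p0Poly α β).roots.map fun x : ℝ => (z - (x : ℂ)) ^ (1 / 2 : ℂ)).prod

/-- The eigenvalue `ρ₁(z) = Tr Φ(z) / 2 + q(z) p₀(z)^{1/2} / (2 (z - 1)ᵏ)` of `Φ(z)`. -/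
def rho1 (α β : Fin k → ℝ) (z : ℂ) : ℂ := rho α β z (sqrtP0 α β z)

/-- `z ρ₁'(z) / ρ₁(z)`. -/
def zLogDeriv (α β : Fin k → ℝ) (z : ℂ) : ℂ := z * deriv (rho1 α β) z / rho1 α β z

/-- The function `χ(z)` of the parametrization. -/
def chiFun (α β : Fin k → ℝ) (z : ℂ) : ℂ :=
  k / ((z - 1) ^ 2 * deriv (zLogDeriv α β) z)

/-- The function `η(z)` of the parametrization. -/
def etaFun (α β : Fin k → ℝ) (z : ℂ) : ℂ :=
  1 / (z - 1) * (2 * zLogDeriv α β z / ((z - 1) * deriv (zLogDeriv α β) z) + z + 1)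

/-- `phiPoly` is `(z - 1)ᵏ Φ(z)`. -/
theorem map_phiPoly (α β : Fin k → ℝ) {z : ℂ} (h0 : z ≠ 0) (h1 : z ≠ 1)
    (hα : ∀ m, α m ≠ 0) (hβ : ∀ m, β m ≠ 0) :
    (phiPoly α β).map (aeval z : ℝ[X] →ₐ[ℝ] ℂ) = (z - 1) ^ k • Phi α β z := by
  have key : ∀ {n : ℕ} (a b : Fin n → ℝ), (∀ m, a m ≠ 0) → (∀ m, b m ≠ 0) →
      (phiPoly a b).map (aeval z : ℝ[X] →ₐ[ℝ] ℂ) = z ^ n •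
        (List.ofFn fun m : Fin n =>
          (!![1, (a m : ℂ) * z⁻¹; (a m : ℂ)⁻¹, 1] : Matrix (Fin 2) (Fin 2) ℂ) *
            !![1, (b m : ℂ) * z⁻¹; (b m : ℂ)⁻¹, 1]).prod := by
    intro n
    induction n with
    | zero =>
      intro a b _ _
      simp [phiPoly]
    | succ n ih =>
      intro a b ha hb
      have h := ih (fun m => a m.succ) (fun m => b m.succ) (fun m => ha _) (fun m => hb _)
      unfold phiPoly at h ⊢
      rw [List.ofFn_succ, List.prod_cons, List.ofFn_succ, List.prod_cons, Matrix.map_mul, h,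
        pow_succ', mul_smul, Matrix.mul_smul, ← mul_smul, mul_comm z, mul_smul]
      congr 1
      rw [← Matrix.smul_mul]
      congr 1
      have hz : z * z⁻¹ = 1 := mul_inv_cancel₀ h0
      have hac : ((a 0 : ℝ) : ℂ) ≠ 0 := by exact_mod_cast ha 0
      have hbc : ((b 0 : ℝ) : ℂ) ≠ 0 := by exact_mod_cast hb 0
      ext i j
      fin_cases i <;> fin_cases j <;>
        simp <;> field_simp <;> ring
  rw [key α β hα hβ, Phi, smul_smul]
  congr 1
  have hz1 : z - 1 ≠ 0 := sub_ne_zero.mpr h1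
  have : 1 - z⁻¹ = (z - 1) / z := by field_simp
  rw [this, div_pow, inv_div]
  field_simp

end PeriodicAztec

end

noncomputable section

namespace PeriodicAztec

variable {k : ℕ}

/-! Notation used throughout: `T` is `trPoly`, `E_s` is `edgePoly` for `s = ±1` (so `p = E_1
E_{-1}`), `D` is `derPoly`, `S = D / q` is `critPoly`, `A` is `lowerPoly`, `B` is `upperPoly`, `V`
is `curveDen`, `U` is `curveNum`.

Everything rests on `root_mem_nonpos`: the zeros of `E_1` and `E_{-1}` are real and nonpositive. For
`z = y²` with `Re y > 0` and `y ≠ 1`, each factor of the symbol increases an indefinite Hermitian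
form by strictly more than the modulus of its determinant. Hence `(z-1)^k Φ(z)` cannot have the
eigenvalue `±(z-1)^k`.

The operator `Q ↦ (z-1) Q' - k Q` kills `(z-1)^k`, so it sends both `E_s` to `D`, and `D / E_s =
(z-1) ∑ 1/(z-a) - k` over the zeros `a ≤ 0` of `E_s`. The signs of `(D/E_s)'` and `(z D/E_s)'` can
then be read off (`wronskian_eq`, `wronskian_X_eq`, `wronskian_diff_ge`). They show that zeros of
`p` have multiplicity at most two, with `p'' < 0` at the double ones (`double_root`), and they fix
the signs of the derivatives of `D/√p`, which is `S/√p₀` up to sign (`upperPoly_sign`,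
`lowerPoly_sign`).

Since `d log ρ = S dz / ((z-1) w)`, the critical points of `F` away from the special points are the
zeros of `K = k((η-1)z - (η+1)) w - 2χ z S`, which is `critFun`. At a point with `p₀ > 0`, dividing
by `w` or by `z w` and differentiating turns a zero of order at least two into `k(η-1) = 2χ (zS/w)'`
and `k(η+1) = 2χ z² (S/w)'`. This system is solved by `curve`, the two signs of `w` giving a point
and its mirror image (`double_zero_iff`). The sign facts give `|η| < 1`, and `|χ| < 1` for `z ≠ 1`.

Injectivity and disjointness come from a count of zeros. The product of `K` over the two sheets is,
up to sign, the polynomial `N`, which is `countPoly`, of degree at most `2k' + 1` and with a zero at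
`0`. For `0 < |χ| < 1` it is negative at the ends of each of the `k' - 1` gaps and nonnegative at
some zero of `S` inside, so each gap holds an even number, at least two, of its zeros
(`numRoots_gap`). At most two zeros are left over. A point of `curve` over `(0, ∞)` takes up two
positive zeros. A point of `curve` over a gap forces four zeros in it, and two such points force
more than four, by the parity argument in `two_mul_card_lt_numRoots`. Any coincidence would exceed
the budget.

At branch points, at `0`, `1` and `∞` the orders are computed by hand. The closed curves arise by
gluing an arc with its mirror image along its ends on `χ = 0` (`isSimpleClosedCurve_of_pos`). -/

/-! ### Coefficients and determinant of the polynomial symbol -/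

theorem phiPoly_succ {n : ℕ} (a b : Fin (n + 1) → ℝ) :
    phiPoly a b = !![X + C (a 0 * (b 0)⁻¹), C (a 0 + b 0);
        C ((a 0)⁻¹ + (b 0)⁻¹) * X, X + C (b 0 * (a 0)⁻¹)] *
      phiPoly (fun m => a m.succ) (fun m => b m.succ) := by
  simp only [phiPoly, List.ofFn_succ, List.prod_cons]

/-- All clauses go through one induction because the recursion mixes the rows. At `z = 0` every
factor is upper triangular, so the diagonal constant terms multiply. The bound on the upper right
entry is one better than the others, which keeps the leading coefficient of the lower right entry
equal to one. -/
theorem phiPoly_coeff {n : ℕ} (a b : Fin n → ℝ) (ha : ∀ m, 0 < a m) (hb : ∀ m, 0 < b m) :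
    (∀ i j m, 0 ≤ (phiPoly a b i j).coeff m) ∧
    (∀ m > n, (phiPoly a b 0 0).coeff m = 0) ∧ (∀ m ≥ n, (phiPoly a b 0 1).coeff m = 0) ∧
    (∀ m > n, (phiPoly a b 1 0).coeff m = 0) ∧ (∀ m > n, (phiPoly a b 1 1).coeff m = 0) ∧
    (phiPoly a b 0 0).coeff n = 1 ∧ (phiPoly a b 1 1).coeff n = 1 ∧
    (phiPoly a b 0 0).coeff 0 = ∏ m, (a m * (b m)⁻¹) ∧ (phiPoly a b 1 0).coeff 0 = 0 ∧
    (phiPoly a b 1 1).coeff 0 = ∏ m, (b m * (a m)⁻¹) := by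
  induction n with
  | zero =>
    simp only [phiPoly, List.ofFn_zero, List.prod_nil]
    refine ⟨?_, ?_, ?_, ?_, ?_, ?_, ?_, ?_, ?_, ?_⟩
    · intro i j m
      fin_cases i <;> fin_cases j <;> simp [coeff_one] <;> split_ifs <;> norm_num
    all_goals simp [coeff_one]
    all_goals intros; omega
  | succ n ih =>
    obtain ⟨h0, hA, hB, hC, hD, hA1, hD1, hA0, hC0, hD0⟩ :=
      ih (fun m => a m.succ) (fun m => b m.succ) (fun m => ha _) (fun m => hb _)
    have pa := ha 0
    have pb := hb 0
    have e0 : ∀ j, phiPoly a b 0 j = X * phiPoly (fun m => a m.succ) (fun m => b m.succ) 0 j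
        + C (a 0 * (b 0)⁻¹) * phiPoly (fun m => a m.succ) (fun m => b m.succ) 0 j
        + C (a 0 + b 0) * phiPoly (fun m => a m.succ) (fun m => b m.succ) 1 j := by
      intro j
      rw [phiPoly_succ, Matrix.mul_apply, Fin.sum_univ_two]
      simp only [Matrix.of_apply, Matrix.cons_val', Matrix.cons_val_zero, Matrix.cons_val_one,
        Matrix.cons_val_fin_one]
      ring
    have e1 : ∀ j, phiPoly a b 1 j =
        X * (C ((a 0)⁻¹ + (b 0)⁻¹) * phiPoly (fun m => a m.succ) (fun m => b m.succ) 0 j)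
        + X * phiPoly (fun m => a m.succ) (fun m => b m.succ) 1 j
        + C (b 0 * (a 0)⁻¹) * phiPoly (fun m => a m.succ) (fun m => b m.succ) 1 j := by
      intro j
      rw [phiPoly_succ, Matrix.mul_apply, Fin.sum_univ_two]
      simp only [Matrix.of_apply, Matrix.cons_val', Matrix.cons_val_zero, Matrix.cons_val_one,
        Matrix.cons_val_fin_one]
      ring
    generalize phiPoly (fun m => a m.succ) (fun m => b m.succ) = M at *
    refine ⟨?_, ?_, ?_, ?_, ?_, ?_, ?_, ?_, ?_, ?_⟩
    · intro i j m
      have c1 : 0 ≤ a 0 * (b 0)⁻¹ := by positivity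
      have c2 : 0 ≤ a 0 + b 0 := by positivity
      have c3 : 0 ≤ (a 0)⁻¹ + (b 0)⁻¹ := by positivity
      have c4 : 0 ≤ b 0 * (a 0)⁻¹ := by positivity
      have q1 := mul_nonneg c1 (h0 0 j m)
      have q2 := mul_nonneg c2 (h0 1 j m)
      have q4 := mul_nonneg c4 (h0 1 j m)
      match i with
      | 0 =>
        rw [e0, coeff_add, coeff_add, coeff_C_mul, coeff_C_mul]
        cases m with
        | zero => rw [coeff_X_mul_zero]; linarith
        | succ m => rw [coeff_X_mul]; have := h0 0 j m; linarith
      | 1 =>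
        rw [e1, coeff_add, coeff_add, coeff_C_mul]
        cases m with
        | zero => rw [coeff_X_mul_zero, coeff_X_mul_zero]; linarith
        | succ m =>
          rw [coeff_X_mul, coeff_X_mul, coeff_C_mul]
          have := mul_nonneg c3 (h0 0 j m)
          have := h0 1 j m; linarith
    · intro m hm
      obtain ⟨m, rfl⟩ : ∃ m', m = m' + 1 := ⟨m - 1, by omega⟩
      rw [e0, coeff_add, coeff_add, coeff_C_mul, coeff_C_mul, coeff_X_mul, hA m (by omega),
        hA _ (by omega), hC _ (by omega)]
      simp
    · intro m hm
      obtain ⟨m, rfl⟩ : ∃ m', m = m' + 1 := ⟨m - 1, by omega⟩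
      rw [e0, coeff_add, coeff_add, coeff_C_mul, coeff_C_mul, coeff_X_mul, hB m (by omega),
        hB _ (by omega), hD _ (by omega)]
      simp
    · intro m hm
      obtain ⟨m, rfl⟩ : ∃ m', m = m' + 1 := ⟨m - 1, by omega⟩
      rw [e1, coeff_add, coeff_add, coeff_C_mul, coeff_X_mul, coeff_X_mul, coeff_C_mul,
        hA m (by omega), hC _ (by omega), hC _ (by omega)]
      simp
    · intro m hm
      obtain ⟨m, rfl⟩ : ∃ m', m = m' + 1 := ⟨m - 1, by omega⟩
      rw [e1, coeff_add, coeff_add, coeff_C_mul, coeff_X_mul, coeff_X_mul, coeff_C_mul,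
        hB m (by omega), hD _ (by omega), hD _ (by omega)]
      simp
    · rw [e0, coeff_add, coeff_add, coeff_C_mul, coeff_C_mul, coeff_X_mul, hA1,
        hA _ (by omega), hC _ (by omega)]
      simp
    · rw [e1, coeff_add, coeff_add, coeff_C_mul, coeff_X_mul, coeff_X_mul, coeff_C_mul,
        hB n (by omega), hD1, hD _ (by omega)]
      simp
    · rw [e0, coeff_add, coeff_add, coeff_C_mul, coeff_C_mul, coeff_X_mul_zero, hA0, hC0,
        Fin.prod_univ_succ]
      simp
    · rw [e1, coeff_add, coeff_add, coeff_C_mul, coeff_X_mul_zero, coeff_X_mul_zero, hC0]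
      simp
    · rw [e1, coeff_add, coeff_add, coeff_C_mul, coeff_X_mul_zero, coeff_X_mul_zero, hD0,
        Fin.prod_univ_succ]
      simp

theorem phiPoly_det {n : ℕ} (a b : Fin n → ℝ) (ha : ∀ m, a m ≠ 0) (hb : ∀ m, b m ≠ 0) :
    (phiPoly a b).det = (X - 1) ^ (2 * n) := by
  induction n with
  | zero => simp [phiPoly]
  | succ n ih =>
    rw [phiPoly_succ, Matrix.det_mul,
      ih (fun m => a m.succ) (fun m => b m.succ) (fun m => ha _) (fun m => hb _), mul_add,
      pow_add, mul_comm]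
    congr 1
    have h1 : C (a 0) * C (a 0)⁻¹ = (1 : ℝ[X]) := by rw [← C_mul, mul_inv_cancel₀ (ha 0), C_1]
    have h2 : C (b 0) * C (b 0)⁻¹ = (1 : ℝ[X]) := by rw [← C_mul, mul_inv_cancel₀ (hb 0), C_1]
    rw [Matrix.det_fin_two]
    simp only [Matrix.of_apply, Matrix.cons_val', Matrix.cons_val_zero, Matrix.cons_val_one,
        Matrix.cons_val_fin_one, C_add, C_mul]
    linear_combination (C (b 0) * C (b 0)⁻¹ - X) * h1 + (1 - X) * h2

section Trace

variable {α β : Fin k → ℝ} (hk : 1 ≤ k) (hα : ∀ m, 0 < α m) (hβ : ∀ m, 0 < β m)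
  (hαβ : ∏ m, α m = ∏ m, β m)

include hα hβ in
theorem trace_coeff_nonneg (m : ℕ) : 0 ≤ (phiPoly α β).trace.coeff m := by
  rw [Matrix.trace_fin_two, coeff_add]
  have := (phiPoly_coeff α β hα hβ).1
  exact add_nonneg (this _ _ _) (this _ _ _)

include hα hβ in
theorem trace_coeff_top : (phiPoly α β).trace.coeff k = 2 := by
  obtain ⟨-, -, -, -, -, h1, h2, -⟩ := phiPoly_coeff α β hα hβ
  rw [Matrix.trace_fin_two, coeff_add, h1, h2]; norm_num

include hα hβ in
theorem trace_natDegree_le : (phiPoly α β).trace.natDegree ≤ k := by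
  obtain ⟨-, h1, -, -, h2, -⟩ := phiPoly_coeff α β hα hβ
  rw [natDegree_le_iff_coeff_eq_zero]
  intro m hm
  rw [Matrix.trace_fin_two, coeff_add, h1 m hm, h2 m hm, add_zero]

include hα hβ hαβ in
-- The equality of the two products enters here: it makes both diagonal constant terms one, and this
-- is why `p` vanishes at `0`.
theorem trace_coeff_zero : (phiPoly α β).trace.coeff 0 = 2 := by
  obtain ⟨-, -, -, -, -, -, -, h1, -, h2⟩ := phiPoly_coeff α β hα hβ
  have hb : ∏ m, β m ≠ 0 := (Finset.prod_pos fun m _ => hβ m).ne'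
  rw [Matrix.trace_fin_two, coeff_add, h1, h2, Finset.prod_mul_distrib, Finset.prod_mul_distrib,
    Finset.prod_inv_distrib, Finset.prod_inv_distrib, hαβ, mul_inv_cancel₀ hb]
  norm_num

include hα hβ hαβ in
theorem trace_eval_pos {x : ℝ} (hx : 0 ≤ x) : 0 < (phiPoly α β).trace.eval x := by
  rw [eval_eq_sum_range, Finset.sum_range_succ']
  have h0 := trace_coeff_zero hα hβ hαβ
  have : 0 ≤ ∑ i ∈ Finset.range (phiPoly α β).trace.natDegree,
      (phiPoly α β).trace.coeff (i + 1) * x ^ (i + 1) :=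
    Finset.sum_nonneg fun i _ => mul_nonneg (trace_coeff_nonneg hα hβ _) (by positivity)
  rw [h0]; simp only [pow_zero]; linarith

end Trace

/-! ### The cone argument: reality of the band edges -/

/-- The indefinite Hermitian form `Re (y x₀ x̄₁)`, strictly increased by the factors of the symbol
at `z = y²`, `Re y > 0`. -/
def coneForm (y : ℂ) (x : Fin 2 → ℂ) : ℝ := (y * x 0 * (starRingEnd ℂ) (x 1)).re

/-- The matrix `M` strictly increases the cone form by more than the factor `d`. -/
def ExpandsCone (y : ℂ) (d : ℝ) (M : Matrix (Fin 2) (Fin 2) ℂ) : Prop :=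
  ∀ x : Fin 2 → ℂ, x ≠ 0 → M.mulVec x ≠ 0 ∧ d * coneForm y x < coneForm y (M.mulVec x)

theorem ExpandsCone.mul {y : ℂ} {d e : ℝ} {M N : Matrix (Fin 2) (Fin 2) ℂ}
    (hM : ExpandsCone y d M) (hN : ExpandsCone y e N) (hd : 0 < d) :
    ExpandsCone y (d * e) (M * N) := by
  intro x hx
  obtain ⟨h1, h2⟩ := hN x hx
  obtain ⟨h3, h4⟩ := hM _ h1
  rw [← Matrix.mulVec_mulVec]
  refine ⟨h3, lt_of_le_of_lt ?_ h4⟩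
  rw [mul_assoc]
  exact mul_le_mul_of_nonneg_left h2.le hd.le

theorem coneForm_smul (y c : ℂ) (x : Fin 2 → ℂ) :
    coneForm y (c • x) = ‖c‖ ^ 2 * coneForm y x := by
  simp only [coneForm, Pi.smul_apply, smul_eq_mul, map_mul]
  rw [show y * (c * x 0) * ((starRingEnd ℂ) c * (starRingEnd ℂ) (x 1)) =
    (c * (starRingEnd ℂ) c) * (y * x 0 * (starRingEnd ℂ) (x 1)) by ring, Complex.mul_conj,
    Complex.re_ofReal_mul, Complex.normSq_eq_norm_sq]

/-- The weight `y`, a square root of `z`, is chosen so that the two cross terms are proportional: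
`Re (y⁻¹ x₁ x̄₀) = Re (y x₀ x̄₁) / |y|²`. The remaining terms are a positive definite form in `(x₀,
x₁)` because `Re y > 0`. -/
theorem coneForm_factor {y : ℂ} (hy : 0 < y.re) {a : ℝ} (ha : 0 < a) (x : Fin 2 → ℂ) :
    coneForm y ((!![1, (a : ℂ) * (y ^ 2)⁻¹; (a : ℂ)⁻¹, 1] :
      Matrix (Fin 2) (Fin 2) ℂ).mulVec x) =
      y.re * (‖x 0‖ ^ 2 / a + a * ‖x 1‖ ^ 2 / ‖y‖ ^ 2) + (1 + 1 / ‖y‖ ^ 2) * coneForm y x := by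
  have hy0 : y ≠ 0 := fun h => by simp [h] at hy
  have ha' : (a : ℂ) ≠ 0 := by exact_mod_cast ha.ne'
  have h0 : ∀ w : ℂ, ‖w‖ ^ 2 = w.re * w.re + w.im * w.im := fun w => by
    rw [← Complex.normSq_eq_norm_sq, Complex.normSq_apply]
  have hn : y.re * y.re + y.im * y.im ≠ 0 := by nlinarith [mul_self_nonneg y.im]
  have e : y * (x 0 + (a : ℂ) * (y ^ 2)⁻¹ * x 1) = y * x 0 + (a : ℂ) * y⁻¹ * x 1 := by
    field_simp
  simp only [coneForm, Matrix.mulVec, dotProduct, Fin.sum_univ_two, Matrix.of_apply,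
    Matrix.cons_val', Matrix.cons_val_zero, Matrix.cons_val_one, Matrix.cons_val_fin_one, one_mul]
  rw [e, h0, h0, h0]
  generalize x 0 = p
  generalize x 1 = q
  simp only [Complex.mul_re, Complex.add_re, Complex.add_im, Complex.mul_im, Complex.inv_re,
    Complex.inv_im, Complex.conj_re, Complex.conj_im, Complex.ofReal_re, Complex.ofReal_im,
    Complex.normSq_apply, ← Complex.ofReal_inv]
  field_simp
  ring

/-- With `δ = |1 - y⁻²|`, the excess over `δ` times the form is the positive definite part plus `c =
1 + |y|⁻² - δ` times the form. The form is at least `-|y| |x₀| |x₁|`, the definite part is at least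
`2 Re y / |y|²` times `|y| |x₀| |x₁|` by the inequality of means, and `0 ≤ c < 2 Re y / |y|²`. -/
theorem expandsCone_factor {y : ℂ} (hy : 0 < y.re) (hy1 : y ≠ 1) {a : ℝ} (ha : 0 < a) :
    ExpandsCone y ‖1 - (y ^ 2)⁻¹‖ !![1, (a : ℂ) * (y ^ 2)⁻¹; (a : ℂ)⁻¹, 1] := by
  have hy0 : y ≠ 0 := fun h => by simp [h] at hy
  have ha' : (a : ℂ) ≠ 0 := by exact_mod_cast ha.ne'
  have hρ : 0 < ‖y‖ := norm_pos_iff.mpr hy0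
  have hwre : (y⁻¹).re = y.re / ‖y‖ ^ 2 := by
    rw [Complex.inv_re, Complex.normSq_eq_norm_sq]
  have hnsub : ‖1 - y⁻¹‖ ^ 2 = 1 + 1 / ‖y‖ ^ 2 - 2 * y.re / ‖y‖ ^ 2 := by
    rw [mul_div_assoc, ← hwre, ← Complex.normSq_eq_norm_sq, Complex.normSq_sub, ← one_div_pow]
    simp [Complex.normSq_eq_norm_sq]
  have hnadd : ‖1 + y⁻¹‖ ^ 2 = 1 + 1 / ‖y‖ ^ 2 + 2 * y.re / ‖y‖ ^ 2 := by
    rw [mul_div_assoc, ← hwre, ← Complex.normSq_eq_norm_sq, Complex.normSq_add, ← one_div_pow]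
    simp [Complex.normSq_eq_norm_sq]
  have hre : 0 < 2 * y.re / ‖y‖ ^ 2 := by positivity
  have hfac : ‖1 - (y ^ 2)⁻¹‖ = ‖1 - y⁻¹‖ * ‖1 + y⁻¹‖ := by
    rw [← norm_mul]; congr 1; rw [← inv_pow]; ring
  have hpos : 0 < ‖1 - y⁻¹‖ := by
    rw [norm_pos_iff, sub_ne_zero]
    intro h; exact hy1 (inv_eq_one.mp h.symm)
  have hlt : ‖1 - y⁻¹‖ < ‖1 + y⁻¹‖ := by
    refine lt_of_pow_lt_pow_left₀ 2 (norm_nonneg _) ?_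
    rw [hnsub, hnadd]; linarith
  set δ := ‖1 - (y ^ 2)⁻¹‖ with hδ
  -- Equivalent to `|1 - y⁻¹|² < δ = |1 - y⁻¹| |1 + y⁻¹|`, which holds because `1 + y⁻¹` has the
  -- larger modulus when `Re y > 0`.
  have hc1 : 1 + 1 / ‖y‖ ^ 2 - δ < 2 * y.re / ‖y‖ ^ 2 := by
    have : ‖1 - y⁻¹‖ ^ 2 < δ := by
      rw [hfac, sq]; exact mul_lt_mul_of_pos_left hlt hpos
    linarith
  have hc0 : 0 ≤ 1 + 1 / ‖y‖ ^ 2 - δ := by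
    have := norm_sub_le (1 : ℂ) ((y ^ 2)⁻¹)
    rw [norm_one, norm_inv, norm_pow] at this
    rw [one_div]; linarith
  have hδpos : 0 < δ := by rw [hfac]; exact mul_pos hpos (hpos.trans hlt)
  intro x hx
  constructor
  · intro h
    have hdet : (!![1, (a : ℂ) * (y ^ 2)⁻¹; (a : ℂ)⁻¹, 1] : Matrix (Fin 2) (Fin 2) ℂ).det ≠ 0 := by
      rw [Matrix.det_fin_two_of]
      have : (1 : ℂ) * 1 - (a : ℂ) * (y ^ 2)⁻¹ * (a : ℂ)⁻¹ = 1 - (y ^ 2)⁻¹ := by field_simp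
      rw [this, ← norm_pos_iff]; exact hδpos
    exact hx (Matrix.eq_zero_of_mulVec_eq_zero hdet h)
  · rw [coneForm_factor hy ha]
    have hH : |coneForm y x| ≤ ‖y‖ * (‖x 0‖ * ‖x 1‖) := by
      refine (Complex.abs_re_le_norm _).trans ?_
      rw [norm_mul, norm_mul, RCLike.norm_conj, mul_assoc]
    set c := 1 + 1 / ‖y‖ ^ 2 - δ with hc
    have hH' := (abs_le.mp hH).1
    have hx' : 0 < ‖x 0‖ ∨ 0 < ‖x 1‖ := by
      by_contra! h
      apply hx
      ext i
      have h0 : x 0 = 0 := norm_le_zero_iff.mp h.1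
      have h1 : x 1 = 0 := norm_le_zero_iff.mp h.2
      fin_cases i <;> simp [h0, h1]
    have key : c * (‖y‖ * (‖x 0‖ * ‖x 1‖)) <
        y.re * (‖x 0‖ ^ 2 / a + a * ‖x 1‖ ^ 2 / ‖y‖ ^ 2) := by
      have hamgm : 2 * y.re / ‖y‖ ^ 2 * (‖y‖ * (‖x 0‖ * ‖x 1‖)) ≤
          y.re * (‖x 0‖ ^ 2 / a + a * ‖x 1‖ ^ 2 / ‖y‖ ^ 2) := by
        have : y.re * (‖x 0‖ ^ 2 / a + a * ‖x 1‖ ^ 2 / ‖y‖ ^ 2) -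
          2 * y.re / ‖y‖ ^ 2 * (‖y‖ * (‖x 0‖ * ‖x 1‖)) =
            y.re / a * (‖x 0‖ - a * ‖x 1‖ / ‖y‖) ^ 2 := by field_simp; ring
        have h2 : 0 ≤ y.re / a * (‖x 0‖ - a * ‖x 1‖ / ‖y‖) ^ 2 := by positivity
        linarith
      -- If one component vanishes, the strict bound on `c` gives nothing, and strictness comes from
      -- the definite part instead.
      rcases (mul_nonneg (norm_nonneg (x 0)) (norm_nonneg (x 1))).eq_or_lt with h | h
      · rw [← h, mul_zero, mul_zero]
        rcases hx' with h1 | h1 <;> positivity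
      · exact lt_of_lt_of_le (mul_lt_mul_of_pos_right hc1 (mul_pos hρ h)) hamgm
    have h3 : -(c * (‖y‖ * (‖x 0‖ * ‖x 1‖))) ≤ c * coneForm y x := by
      rw [← mul_neg]; exact mul_le_mul_of_nonneg_left hH' hc0
    have h4 : (1 + 1 / ‖y‖ ^ 2) * coneForm y x = c * coneForm y x + δ * coneForm y x := by
      rw [hc]; ring
    rw [h4]; linarith

/-- Each polynomial factor is `z` times a product of two factors of the symbol: the scalar
contributes `|z|²`, the factors `|1 - z⁻¹|` each, together `|z - 1|²`. At least one factor is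
needed, since the empty product does not expand strictly. -/
theorem expandsCone_phiPoly {y : ℂ} (hy : 0 < y.re) (hy1 : y ≠ 1) {n : ℕ} (a b : Fin (n + 1) → ℝ)
    (ha : ∀ m, 0 < a m) (hb : ∀ m, 0 < b m) :
    ExpandsCone y ((‖y ^ 2 - 1‖ ^ 2) ^ (n + 1))
      ((phiPoly a b).map (aeval (y ^ 2) : ℝ[X] →ₐ[ℝ] ℂ)) := by
  have hy0 : y ≠ 0 := fun h => by simp [h] at hy
  have hz0 : y ^ 2 ≠ 0 := pow_ne_zero 2 hy0
  have hz1 : y ^ 2 ≠ 1 := by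
    intro h
    rcases mul_self_eq_one_iff.mp ((sq y).symm.trans h) with h | h
    · exact hy1 h
    · rw [h] at hy; norm_num at hy
  have hpos : 0 < ‖y ^ 2 - 1‖ ^ 2 := by
    have := norm_pos_iff.mpr (sub_ne_zero.mpr hz1); positivity
  have hstep : ∀ {c d : ℝ}, 0 < c → 0 < d → ExpandsCone y (‖y ^ 2 - 1‖ ^ 2)
      ((!![X + C (c * d⁻¹), C (c + d); C (c⁻¹ + d⁻¹) * X, X + C (d * c⁻¹)] :
        Matrix (Fin 2) (Fin 2) ℝ[X]).map (aeval (y ^ 2) : ℝ[X] →ₐ[ℝ] ℂ)) := by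
    intro c d hc hd
    have hc' : (c : ℂ) ≠ 0 := by exact_mod_cast hc.ne'
    have hd' : (d : ℂ) ≠ 0 := by exact_mod_cast hd.ne'
    have hδ : 0 < ‖1 - (y ^ 2)⁻¹‖ := by
      rw [norm_pos_iff, sub_ne_zero]; intro h; exact hz1 (inv_eq_one.mp h.symm)
    have hmul := (expandsCone_factor hy hy1 hc).mul (expandsCone_factor hy hy1 hd) hδ
    have heq : (!![X + C (c * d⁻¹), C (c + d); C (c⁻¹ + d⁻¹) * X, X + C (d * c⁻¹)] :
        Matrix (Fin 2) (Fin 2) ℝ[X]).map (aeval (y ^ 2) : ℝ[X] →ₐ[ℝ] ℂ) =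
        y ^ 2 • (!![1, (c : ℂ) * (y ^ 2)⁻¹; (c : ℂ)⁻¹, 1] *
          !![1, (d : ℂ) * (y ^ 2)⁻¹; (d : ℂ)⁻¹, 1]) := by
      ext i j
      fin_cases i <;> fin_cases j <;> simp <;> field_simp <;> ring
    rw [heq]
    intro x hx
    obtain ⟨h1, h2⟩ := hmul x hx
    rw [Matrix.smul_mulVec]
    refine ⟨smul_ne_zero hz0 h1, ?_⟩
    rw [coneForm_smul]
    have e : ‖y ^ 2 - 1‖ ^ 2 = ‖y ^ 2‖ ^ 2 * (‖1 - (y ^ 2)⁻¹‖ * ‖1 - (y ^ 2)⁻¹‖) := by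
      rw [← sq, ← mul_pow, ← norm_mul]
      congr 2; field_simp
    rw [e, mul_assoc]
    have := norm_pos_iff.mpr hz0
    exact mul_lt_mul_of_pos_left h2 (by positivity)
  induction n with
  | zero =>
    have : phiPoly (fun m : Fin 0 => a m.succ) (fun m => b m.succ) = 1 := by simp [phiPoly]
    rw [phiPoly_succ, Matrix.map_mul, this, Matrix.map_one _ (map_zero _) (map_one _), mul_one]
    convert hstep (ha 0) (hb 0) using 1
    simp
  | succ n ih =>
    rw [phiPoly_succ, Matrix.map_mul, pow_succ']
    exact (hstep (ha 0) (hb 0)).mul (ih _ _ (fun m => ha _) (fun m => hb _)) hpos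

/-- A complex solution of `Tr phiPoly = ±2 (z - 1)ᵏ` lies on the closed negative half line. -/
theorem root_mem_nonpos {α β : Fin k → ℝ} (hk : 1 ≤ k) (hα : ∀ m, 0 < α m) (hβ : ∀ m, 0 < β m)
    (hαβ : ∏ m, α m = ∏ m, β m) {s : ℝ} (hs : s ^ 2 = 1) {z : ℂ}
    (hz : aeval z ((phiPoly α β).trace - C (2 * s) * (X - 1) ^ k) = 0) :
    ∃ x : ℝ, x ≤ 0 ∧ z = x := by
  by_contra hcon
  have hslit : z ∈ Complex.slitPlane := by
    by_contra h
    rw [Complex.mem_slitPlane_iff_not_le_zero, not_not, Complex.le_def] at h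
    exact hcon ⟨z.re, by simpa using h.1, Complex.ext (by simp) (by simpa using h.2)⟩
  -- At `z = 1` the cone gives no expansion (there `y = 1`), but the trace is positive and the other
  -- term vanishes.
  have hz1 : z ≠ 1 := by
    rintro rfl
    rw [map_sub, map_mul, map_pow, map_sub, aeval_X, map_one, sub_self,
      zero_pow (by omega), mul_zero, sub_zero] at hz
    have h1 := trace_eval_pos hα hβ hαβ (zero_le_one)
    have h2 := aeval_algebraMap_apply_eq_algebraMap_eval (A := ℂ) (1 : ℝ) (phiPoly α β).trace
    rw [map_one, hz] at h2
    have : (phiPoly α β).trace.eval 1 = 0 := by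
      have := h2.symm; simpa using this
    linarith
  obtain ⟨y, hy, hyz⟩ : ∃ y : ℂ, 0 < y.re ∧ y ^ 2 = z := by
    refine ⟨z ^ (1 / 2 : ℂ), ?_, ?_⟩
    · have h0 : z ≠ 0 := Complex.slitPlane_ne_zero hslit
      have hlog := Complex.exp_log h0
      rw [Complex.cpow_def_of_ne_zero h0, Complex.exp_re]
      refine mul_pos (Real.exp_pos _) (Real.cos_pos_of_mem_Ioo ?_)
      have h1 := Complex.neg_pi_lt_log_im z
      have h2 := Complex.log_im_le_pi z
      have h3 : (Complex.log z).im ≠ Real.pi := by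
        rw [Complex.log_im]; exact (Complex.mem_slitPlane_iff_arg.mp hslit).1
      have h4 : (Complex.log z * (1 / 2)).im = (Complex.log z).im / 2 := by
        rw [show (1 / 2 : ℂ) = ((1 / 2 : ℝ) : ℂ) by norm_num, Complex.im_mul_ofReal]; ring
      rw [h4]
      have := lt_of_le_of_ne h2 h3
      constructor <;> linarith
    · rw [← Complex.cpow_nat_mul]; norm_num
  have hy1 : y ≠ 1 := by rintro rfl; exact hz1 (by rw [← hyz]; norm_num)
  obtain ⟨n, rfl⟩ : ∃ n, k = n + 1 := ⟨k - 1, by omega⟩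
  have hexp := expandsCone_phiPoly hy hy1 α β hα hβ
  rw [hyz] at hexp
  set M := (phiPoly α β).map (aeval z : ℝ[X] →ₐ[ℝ] ℂ) with hM
  set μ : ℂ := (s : ℂ) * (z - 1) ^ (n + 1) with hμ
  have hs2 : (s : ℂ) ^ 2 = 1 := by exact_mod_cast hs
  have htr : M.trace = 2 * μ := by
    have : M.trace = aeval z (phiPoly α β).trace := by
      rw [hM, Matrix.trace_fin_two, Matrix.trace_fin_two, map_add]; rfl
    rw [this, hμ]
    rw [map_sub, map_mul, map_pow, map_sub, aeval_X, map_one, aeval_C] at hz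
    simp only [Complex.coe_algebraMap, Complex.ofReal_mul, Complex.ofReal_ofNat] at hz
    linear_combination hz
  have hdet : M.det = μ ^ 2 := by
    have : M.det = aeval z (phiPoly α β).det := by
      rw [hM, Matrix.det_fin_two, Matrix.det_fin_two]; simp
    rw [this, phiPoly_det α β (fun m => (hα m).ne') (fun m => (hβ m).ne')]
    simp only [map_pow, map_sub, aeval_X, map_one]
    rw [hμ, mul_pow, hs2, one_mul, ← pow_mul, mul_comm]
  -- Trace `2μ` and determinant `μ²` make `μ` an eigenvalue.
  have hsing : (M - μ • (1 : Matrix (Fin 2) (Fin 2) ℂ)).det = 0 := by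
    rw [Matrix.det_fin_two] at hdet ⊢
    rw [Matrix.trace_fin_two] at htr
    simp
    linear_combination hdet - μ * htr
  obtain ⟨x, hx, hxM⟩ := Matrix.exists_mulVec_eq_zero_iff.mpr hsing
  rw [Matrix.sub_mulVec, Matrix.smul_mulVec, Matrix.one_mulVec, sub_eq_zero] at hxM
  -- An eigenvector scales the form by exactly `|μ|² = |z - 1|^{2k}`, the very bound that must be
  -- exceeded strictly.
  have h := (hexp x hx).2
  rw [hxM, coneForm_smul] at h
  have hμn : ‖μ‖ ^ 2 = (‖z - 1‖ ^ 2) ^ (n + 1) := by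
    have : ‖(s : ℂ)‖ ^ 2 = 1 := by rw [← norm_pow, hs2, norm_one]
    rw [hμ, norm_mul, mul_pow, this, one_mul, norm_pow, ← pow_mul, ← pow_mul, mul_comm]
  rw [hμn] at h
  exact lt_irrefl _ h

/-! ### Wronskian inequalities for real-rooted polynomials -/

/-- This is `(P'/P)' = -∑ 1/(z-a)²` multiplied by `P²`. -/
theorem eval_derivative_derivative_prod (m : Multiset ℝ) {z : ℝ} (hz : z ∉ m) :
    let P : ℝ[X] := (m.map fun a => X - C a).prod
    P.derivative.derivative.eval z * P.eval z - P.derivative.eval z ^ 2 =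
      -(P.eval z ^ 2 * (m.map fun a => 1 / (z - a) ^ 2).sum) := by
  induction m using Multiset.induction with
  | empty => simp
  | cons a m ih =>
    simp only [Multiset.mem_cons, not_or] at hz
    have hne : z - a ≠ 0 := sub_ne_zero.mpr hz.1
    have := ih hz.2
    simp only [Multiset.map_cons, Multiset.prod_cons, Multiset.sum_cons, derivative_mul,
      derivative_sub, derivative_X, derivative_C, sub_zero, one_mul, eval_add, eval_mul, eval_sub,
      eval_X, eval_C, derivative_add] at this ⊢
    set P : ℝ[X] := (m.map fun a => X - C a).prod
    have e : ((z - a) * P.eval z) ^ 2 * (1 / (z - a) ^ 2 + (m.map fun a => 1 / (z - a) ^ 2).sum) =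
      P.eval z ^ 2 + (z - a) ^ 2 * (P.eval z ^ 2 * (m.map fun a => 1 / (z - a) ^ 2).sum) := by
      field_simp
    rw [e]
    linear_combination (z - a) ^ 2 * this

theorem Splits.laguerre_eq {Q : ℝ[X]} (hQ : Q.Splits) {z : ℝ} (hz : Q.eval z ≠ 0) :
    Q.derivative.derivative.eval z * Q.eval z - Q.derivative.eval z ^ 2 =
      -(Q.eval z ^ 2 * (Q.roots.map fun a => 1 / (z - a) ^ 2).sum) := by
  have hz' : z ∉ Q.roots := fun h => hz (isRoot_of_mem_roots h)
  have h := eval_derivative_derivative_prod Q.roots hz'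
  have hQe := hQ.eq_prod_roots
  simp only at h
  set P : ℝ[X] := (Q.roots.map fun a => X - C a).prod
  set S := (Q.roots.map fun a => 1 / (z - a) ^ 2).sum
  have h0 : Q.eval z = Q.leadingCoeff * P.eval z := by
    conv_lhs => rw [hQe]
    simp
  have h1 : Q.derivative.eval z = Q.leadingCoeff * P.derivative.eval z := by
    conv_lhs => rw [hQe]
    simp
  have h2 : Q.derivative.derivative.eval z = Q.leadingCoeff * P.derivative.derivative.eval z := by
    conv_lhs => rw [hQe]
    simp
  rw [h0, h1, h2]
  linear_combination Q.leadingCoeff ^ 2 * h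

section Laguerre

variable {Q D : ℝ[X]} (hQ : Q.Splits) (hneg : ∀ a ∈ Q.roots, a ≤ 0)
  (hD : D = (X - 1) * Q.derivative - C (k : ℝ) * Q) {z : ℝ} (hz : Q.eval z ≠ 0)

include hQ hD hz in
-- Both sides are `Q² (D/Q)'`, with `D/Q = (z-1) ∑ 1/(z-a) - k`; each summand `(z-1)/(z-a)` has
-- derivative `(1-a)/(z-a)²`.
theorem wronskian_eq : D.derivative.eval z * Q.eval z - D.eval z * Q.derivative.eval z =
    Q.eval z ^ 2 * (Q.roots.map fun a => (1 - a) / (z - a) ^ 2).sum := by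
  have hz' : ∀ a ∈ Q.roots, z - a ≠ 0 := fun a ha h =>
    hz (by rw [sub_eq_zero.mp h]; exact isRoot_of_mem_roots ha)
  have h1 := hQ.eval_derivative_eq_eval_mul_sum hz
  have h2 := Splits.laguerre_eq hQ hz
  have h3 : (Q.roots.map fun a => (1 - a) / (z - a) ^ 2) =
      Q.roots.map fun a => 1 / (z - a) - (z - 1) * (1 / (z - a) ^ 2) := by
    refine Multiset.map_congr rfl fun a ha => ?_
    have := hz' a ha
    field_simp; ring
  rw [h3, Multiset.sum_map_sub, Multiset.sum_map_mul_left, hD]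
  simp only [derivative_sub, derivative_mul, derivative_X, derivative_one, sub_zero, one_mul,
    derivative_C, zero_mul, zero_add, eval_add, eval_sub, eval_mul, eval_X, eval_one, eval_C]
  linear_combination (z - 1) * h2 + Q.eval z * h1

include hQ hD hz in
-- Both sides are `Q² (z D/Q)'`. Each `z(z-1)/(z-a)` has derivative `1 + a(1-a)/(z-a)²`, and the
-- ones add up to the degree, against `-k` from the constant term of `D/Q`.
theorem wronskian_X_eq : (X * D).derivative.eval z * Q.eval z - z * D.eval z * Q.derivative.eval z =
    Q.eval z ^ 2 * ((Q.roots.map fun a => a * (1 - a) / (z - a) ^ 2).sum -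
      (k - Q.natDegree)) := by
  have hz' : ∀ a ∈ Q.roots, z - a ≠ 0 := fun a ha h =>
    hz (by rw [sub_eq_zero.mp h]; exact isRoot_of_mem_roots ha)
  have h1 := hQ.eval_derivative_eq_eval_mul_sum hz
  have h4 := wronskian_eq hQ hD hz
  have h3 : (Q.roots.map fun a => a * (1 - a) / (z - a) ^ 2) =
      Q.roots.map fun a => (z - 1) * (1 / (z - a)) + z * ((1 - a) / (z - a) ^ 2) - 1 := by
    refine Multiset.map_congr rfl fun a ha => ?_
    have := hz' a ha
    field_simp; ring
  rw [h3, Multiset.sum_map_sub, Multiset.sum_map_add, Multiset.sum_map_mul_left,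
    Multiset.sum_map_mul_left, Multiset.map_const', Multiset.sum_replicate,
    ← hQ.natDegree_eq_card_roots]
  have hDe : D.eval z = (z - 1) * Q.derivative.eval z - k * Q.eval z := by
    rw [hD]; simp
  simp only [derivative_mul, derivative_X, one_mul, eval_add, eval_mul, eval_X]
  rw [nsmul_eq_mul, mul_one]
  linear_combination z * h4 + (z - 1) * Q.eval z * h1 + Q.eval z * hDe

include hQ hneg hD hz in
theorem wronskian_nonneg :
    0 ≤ D.derivative.eval z * Q.eval z - D.eval z * Q.derivative.eval z := by
  rw [wronskian_eq hQ hD hz]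
  refine mul_nonneg (sq_nonneg _) (Multiset.sum_nonneg fun x hx => ?_)
  obtain ⟨a, ha, rfl⟩ := Multiset.mem_map.mp hx
  have := hneg a ha
  exact div_nonneg (by linarith) (sq_nonneg _)

include hQ hneg hD hz in
-- The zero at the origin contributes `1/z² > 0`, while the other summands are nonnegative.
theorem wronskian_pos (h0 : Q.eval 0 = 0) :
    0 < D.derivative.eval z * Q.eval z - D.eval z * Q.derivative.eval z := by
  have hQ0 : Q ≠ 0 := by rintro rfl; simp at hz
  have hmem : (0 : ℝ) ∈ Q.roots := (mem_roots hQ0).mpr h0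
  have hz0 : z ≠ 0 := by rintro rfl; exact hz h0
  rw [wronskian_eq hQ hD hz]
  refine mul_pos (by positivity) ?_
  obtain ⟨t, ht⟩ := Multiset.exists_cons_of_mem hmem
  rw [ht, Multiset.map_cons, Multiset.sum_cons]
  refine add_pos_of_pos_of_nonneg (by simp; positivity) (Multiset.sum_nonneg fun x hx => ?_)
  obtain ⟨a, ha, rfl⟩ := Multiset.mem_map.mp hx
  have := hneg a (by rw [ht]; exact Multiset.mem_cons_of_mem ha)
  exact div_nonneg (by linarith) (sq_nonneg _)

include hQ hneg hD hz in
theorem wronskian_X_nonpos :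
    (X * D).derivative.eval z * Q.eval z - z * D.eval z * Q.derivative.eval z ≤
      -(Q.eval z ^ 2 * (k - Q.natDegree)) := by
  rw [wronskian_X_eq hQ hD hz]
  have : (Q.roots.map fun a => a * (1 - a) / (z - a) ^ 2).sum ≤ 0 := by
    refine (Multiset.sum_map_le_sum_map _ (fun _ => (0 : ℝ)) fun a ha => ?_).trans (by simp)
    have := hneg a ha
    exact div_nonpos_of_nonpos_of_nonneg
      (mul_nonpos_of_nonpos_of_nonneg this (by linarith)) (sq_nonneg _)
  nlinarith [sq_nonneg (Q.eval z)]

include hQ hneg hD hz in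
-- In `z² (D/Q)' - (z D/Q)'` a zero `a ≤ 0` contributes `1 - a(z-1)²/(z-a)² ≥ 1`; these ones and the
-- deficiency `k - deg Q` add up to `k`. This is the source of `|χ| < 1`.
theorem wronskian_diff_ge :
    k * Q.eval z ^ 2 ≤ z ^ 2 * (D.derivative.eval z * Q.eval z - D.eval z * Q.derivative.eval z) -
      ((X * D).derivative.eval z * Q.eval z - z * D.eval z * Q.derivative.eval z) := by
  have hz' : ∀ a ∈ Q.roots, z - a ≠ 0 := fun a ha h =>
    hz (by rw [sub_eq_zero.mp h]; exact isRoot_of_mem_roots ha)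
  rw [wronskian_eq hQ hD hz, wronskian_X_eq hQ hD hz]
  have h1 : (Q.roots.map fun _ => (1 : ℝ)).sum ≤
      (Q.roots.map fun a => z ^ 2 * ((1 - a) / (z - a) ^ 2) - a * (1 - a) / (z - a) ^ 2).sum := by
    refine Multiset.sum_map_le_sum_map _ _ fun a ha => ?_
    have h1 := hneg a ha
    have h2 := hz' a ha
    have : z ^ 2 * ((1 - a) / (z - a) ^ 2) - a * (1 - a) / (z - a) ^ 2 =
        1 + -a * (z - 1) ^ 2 / (z - a) ^ 2 := by field_simp; ring
    rw [this]
    have : 0 ≤ -a * (z - 1) ^ 2 / (z - a) ^ 2 :=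
      div_nonneg (mul_nonneg (by linarith) (sq_nonneg _)) (sq_nonneg _)
    linarith
  rw [Multiset.map_const', Multiset.sum_replicate, ← hQ.natDegree_eq_card_roots, nsmul_eq_mul,
    mul_one, Multiset.sum_map_sub, Multiset.sum_map_mul_left] at h1
  nlinarith [sq_nonneg (Q.eval z)]

end Laguerre

/-! ### The discriminant and its two edge factors -/

/-- The standing assumptions on the weights. -/
structure Admissible (α β : Fin k → ℝ) : Prop where
  one_le : 1 ≤ k
  pos_left : ∀ m, 0 < α m
  pos_right : ∀ m, 0 < β m
  prod_eq : ∏ m, α m = ∏ m, β m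

/-- The polynomial `(z - 1)ᵏ Tr Φ(z)`. -/
def trPoly (α β : Fin k → ℝ) : ℝ[X] := (phiPoly α β).trace

/-- The factor `(z - 1)ᵏ (Tr Φ(z) - 2 s)`, `s = ±1`, of the discriminant. -/
def edgePoly (α β : Fin k → ℝ) (s : ℝ) : ℝ[X] := trPoly α β - C (2 * s) * (X - 1) ^ k

/-- The polynomial `(z - 1)ᵏ⁺¹ (Tr Φ)'(z)`. -/
def derPoly (α β : Fin k → ℝ) : ℝ[X] := (X - 1) * (trPoly α β).derivative - C (k : ℝ) * trPoly α β

namespace Admissible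

variable {α β : Fin k → ℝ} (h : Admissible α β)
include h

theorem edgePoly_root {s : ℝ} (hs : s ^ 2 = 1) {z : ℂ} (hz : aeval z (edgePoly α β s) = 0) :
    ∃ x : ℝ, x ≤ 0 ∧ z = x :=
  root_mem_nonpos h.one_le h.pos_left h.pos_right h.prod_eq hs hz

theorem edgePoly_splits {s : ℝ} (hs : s ^ 2 = 1) : (edgePoly α β s).Splits := by
  refine Splits.of_splits_map_of_injective (i := algebraMap ℝ ℂ) (algebraMap ℝ ℂ).injective
    (IsAlgClosed.splits _) fun a ha => ?_
  have : aeval a (edgePoly α β s) = 0 := by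
    have := isRoot_of_mem_roots ha
    rwa [IsRoot.def, eval_map_algebraMap] at this
  obtain ⟨x, -, rfl⟩ := h.edgePoly_root hs this
  exact ⟨x, rfl⟩

theorem nonpos_of_edgePoly_eval {s : ℝ} (hs : s ^ 2 = 1) {x : ℝ}
    (hx : (edgePoly α β s).eval x = 0) : x ≤ 0 := by
  have : aeval (x : ℂ) (edgePoly α β s) = 0 := by
    have h2 := aeval_algebraMap_apply_eq_algebraMap_eval (A := ℂ) x (edgePoly α β s)
    rw [hx, map_zero] at h2
    exact h2
  obtain ⟨y, hy, hxy⟩ := h.edgePoly_root hs this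
  rwa [Complex.ofReal_inj.mp hxy]

theorem edgePoly_roots_nonpos {s : ℝ} (hs : s ^ 2 = 1) : ∀ a ∈ (edgePoly α β s).roots, a ≤ 0 :=
  fun _ ha => h.nonpos_of_edgePoly_eval hs (isRoot_of_mem_roots ha)

/-- The operator `Q ↦ (X - 1) Q' - k Q` annihilates `(X - 1)^k`, so both edge factors share the same
`D`. -/
theorem derPoly_eq (s : ℝ) : derPoly α β =
    (X - 1) * (edgePoly α β s).derivative - C (k : ℝ) * edgePoly α β s := by
  have hk := h.one_le
  obtain ⟨n, rfl⟩ : ∃ n, k = n + 1 := ⟨k - 1, by omega⟩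
  simp only [derPoly, edgePoly, derivative_sub, derivative_mul, derivative_C, zero_mul, zero_add,
    derivative_pow, derivative_X, derivative_one, sub_zero, mul_one, Nat.add_sub_cancel]
  ring

theorem trPoly_coeff_top : (trPoly α β).coeff k = 2 := trace_coeff_top h.pos_left h.pos_right

theorem trPoly_coeff_nonneg (m : ℕ) : 0 ≤ (trPoly α β).coeff m :=
  trace_coeff_nonneg h.pos_left h.pos_right m

theorem trPoly_natDegree_le : (trPoly α β).natDegree ≤ k :=
  trace_natDegree_le h.pos_left h.pos_right

theorem trPoly_eval_pos {x : ℝ} (hx : 0 ≤ x) : 0 < (trPoly α β).eval x :=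
  trace_eval_pos h.pos_left h.pos_right h.prod_eq hx

theorem trPoly_eval_zero : (trPoly α β).eval 0 = 2 := by
  rw [← coeff_zero_eq_eval_zero]; exact trace_coeff_zero h.pos_left h.pos_right h.prod_eq

omit h in
theorem discPoly_eq : discPoly α β = edgePoly α β 1 * edgePoly α β (-1) := by
  simp only [discPoly, edgePoly, trPoly, C_mul, C_neg, C_1]
  rw [show (C 2 : ℝ[X]) = 2 from rfl, pow_mul']
  ring

omit h in
theorem discPoly_eval (x : ℝ) :
    (discPoly α β).eval x = (trPoly α β).eval x ^ 2 - 4 * (x - 1) ^ (2 * k) := by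
  simp [discPoly, trPoly]

omit h in
theorem edgePoly_eval (s x : ℝ) :
    (edgePoly α β s).eval x = (trPoly α β).eval x - 2 * s * (x - 1) ^ k := by
  simp [edgePoly]

theorem discPoly_derivative :
    (X - 1) * (discPoly α β).derivative - C (2 * k : ℝ) * discPoly α β =
      C 2 * trPoly α β * derPoly α β := by
  have h1 := h.derPoly_eq 1
  have h2 := h.derPoly_eq (-1)
  have h3 : edgePoly α β 1 + edgePoly α β (-1) = C 2 * trPoly α β := by
    simp only [edgePoly, C_mul, C_neg, C_1]
    rw [show (C 2 : ℝ[X]) = 2 from rfl]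
    ring
  rw [discPoly_eq, ← h3, derivative_mul, C_mul, show (C 2 : ℝ[X]) = 2 from rfl]
  linear_combination -edgePoly α β (-1) * h1 - edgePoly α β 1 * h2

/-- The top terms `2 z^k` cancel; the next coefficient is that of `T` plus `2k`, which is positive.
The drop in degree makes `deg p` odd and later makes the sign of `A` strict. -/
theorem natDegree_edgePoly_one : (edgePoly α β 1).natDegree = k - 1 ∧
    0 < (edgePoly α β 1).leadingCoeff := by
  have hk := h.one_le
  obtain ⟨n, rfl⟩ : ∃ n, k = n + 1 := ⟨k - 1, by omega⟩
  have hc : ∀ m, (edgePoly α β 1).coeff m =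
      (trPoly α β).coeff m - 2 * ((-1) ^ (n + 1 - m) * ((n + 1).choose m : ℝ)) := by
    intro m
    have : (X - 1 : ℝ[X]) ^ (n + 1) = (X + C (-1)) ^ (n + 1) := by
      rw [C_neg, C_1, sub_eq_add_neg]
    rw [edgePoly, coeff_sub, coeff_C_mul, this, coeff_X_add_C_pow]
    ring
  have h1 : (edgePoly α β 1).coeff n = (trPoly α β).coeff n + 2 * (n + 1) := by
    rw [hc]
    simp [Nat.choose_succ_self_right]; ring
  have h2 : 0 < (edgePoly α β 1).coeff n := by
    have := h.trPoly_coeff_nonneg n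
    rw [h1]; positivity
  have h3 : (edgePoly α β 1).natDegree = n := by
    refine natDegree_eq_of_le_of_coeff_ne_zero ?_ h2.ne'
    rw [natDegree_le_iff_coeff_eq_zero]
    intro m hm
    rcases Nat.lt_or_ge (n + 1) m with h4 | h4
    · rw [hc, coeff_eq_zero_of_natDegree_lt (h.trPoly_natDegree_le.trans_lt h4),
        Nat.choose_eq_zero_of_lt h4]
      simp
    · have : m = n + 1 := by omega
      rw [this, hc, h.trPoly_coeff_top]; simp
  refine ⟨by simpa using h3, ?_⟩
  rw [leadingCoeff, h3]; exact h2

theorem natDegree_edgePoly_neg_one : (edgePoly α β (-1)).natDegree = k ∧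
    0 < (edgePoly α β (-1)).leadingCoeff := by
  have hX : (X - 1 : ℝ[X]) ^ k = (X + C (-1)) ^ k := by
    rw [C_neg, C_1, sub_eq_add_neg]
  have h1 : (edgePoly α β (-1)).coeff k = 4 := by
    rw [edgePoly, coeff_sub, coeff_C_mul, hX, coeff_X_add_C_pow, h.trPoly_coeff_top]
    norm_num
  have h3 : (edgePoly α β (-1)).natDegree = k := by
    refine natDegree_eq_of_le_of_coeff_ne_zero ?_ (by rw [h1]; norm_num)
    refine (natDegree_sub_le _ _).trans (max_le h.trPoly_natDegree_le ?_)
    refine (natDegree_C_mul_le _ _).trans ?_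
    rw [hX, natDegree_pow, natDegree_X_add_C, mul_one]
  refine ⟨h3, ?_⟩
  rw [leadingCoeff, h3, h1]; norm_num

theorem edgePoly_ne_zero {s : ℝ} (hs : s ^ 2 = 1) : edgePoly α β s ≠ 0 := by
  rcases sq_eq_one_iff.mp hs with rfl | rfl
  · exact leadingCoeff_ne_zero.mp h.natDegree_edgePoly_one.2.ne'
  · exact leadingCoeff_ne_zero.mp h.natDegree_edgePoly_neg_one.2.ne'

theorem natDegree_discPoly : (discPoly α β).natDegree = 2 * k - 1 := by
  have hk := h.one_le
  rw [discPoly_eq, natDegree_mul (h.edgePoly_ne_zero (by norm_num))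
    (h.edgePoly_ne_zero (by norm_num)), h.natDegree_edgePoly_one.1,
    h.natDegree_edgePoly_neg_one.1]
  omega

theorem leadingCoeff_discPoly : 0 < (discPoly α β).leadingCoeff := by
  rw [discPoly_eq, leadingCoeff_mul]
  exact mul_pos h.natDegree_edgePoly_one.2 h.natDegree_edgePoly_neg_one.2

theorem discPoly_ne_zero : discPoly α β ≠ 0 :=
  leadingCoeff_ne_zero.mp h.leadingCoeff_discPoly.ne'

theorem discPoly_splits : (discPoly α β).Splits := by
  rw [discPoly_eq]
  exact (h.edgePoly_splits (by norm_num)).mul (h.edgePoly_splits (by norm_num))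

theorem nonpos_of_discPoly_eval {x : ℝ} (hx : (discPoly α β).eval x = 0) : x ≤ 0 := by
  rw [discPoly_eq, eval_mul, mul_eq_zero] at hx
  rcases hx with hx | hx
  · exact h.nonpos_of_edgePoly_eval (by norm_num) hx
  · exact h.nonpos_of_edgePoly_eval (by norm_num) hx

theorem trPoly_ne_zero_of_disc {x : ℝ} (hx : (discPoly α β).eval x = 0) :
    (trPoly α β).eval x ≠ 0 := by
  intro h0
  have h1 := h.nonpos_of_discPoly_eval hx
  rw [discPoly_eval, h0] at hx
  have : (x - 1) ^ (2 * k) ≠ 0 := pow_ne_zero _ (by linarith)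
  apply this; linarith

theorem discPoly_derivative_eval (x : ℝ) :
    (x - 1) * (discPoly α β).derivative.eval x - 2 * k * (discPoly α β).eval x =
      2 * (trPoly α β).eval x * (derPoly α β).eval x := by
  have := congrArg (eval x) h.discPoly_derivative
  simpa using this

theorem discPoly_derivative_eq_zero_iff {x : ℝ} (hx : (discPoly α β).eval x = 0) :
    (discPoly α β).derivative.eval x = 0 ↔ (derPoly α β).eval x = 0 := by
  have h1 := h.nonpos_of_discPoly_eval hx
  have h2 := h.discPoly_derivative_eval x
  have h3 := h.trPoly_ne_zero_of_disc hx
  rw [hx, mul_zero, sub_zero] at h2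
  constructor
  · intro h4
    rw [h4, mul_zero] at h2
    have := h2.symm
    simpa [h3] using this
  · intro h4
    rw [h4, mul_zero] at h2
    rcases mul_eq_zero.mp h2 with h5 | h5
    · linarith
    · exact h5

/-- At a double zero `D` vanishes. Applied to the edge factor `Q` that does not vanish there,
`wronskian_diff_ge` reduces to `x(x-1) D'(x) Q(x) ≥ k Q(x)² > 0`, which excludes `x = 0` and gives
`D' T > 0`. Differentiating `(x-1) p' - 2k p = 2 T D` then yields `(x-1) p'' = 2 T D'`, so `p'' <
0`. -/
theorem double_root {x : ℝ} (hx : (discPoly α β).eval x = 0)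
    (hx' : (discPoly α β).derivative.eval x = 0) :
    x < 0 ∧ (derPoly α β).eval x = 0 ∧ (discPoly α β).derivative.derivative.eval x < 0 := by
  have hk : (0 : ℝ) < k := by exact_mod_cast h.one_le
  have hx0 := h.nonpos_of_discPoly_eval hx
  have hD := (h.discPoly_derivative_eq_zero_iff hx).mp hx'
  have hT := h.trPoly_ne_zero_of_disc hx
  -- The sign is that of the other edge factor: as `E_1 + E_{-1} = 2 T` and one summand vanishes,
  -- the other equals `2 T(x)`.
  obtain ⟨s, hs, hsx⟩ : ∃ s : ℝ, s ^ 2 = 1 ∧ (edgePoly α β s).eval x = 2 * (trPoly α β).eval x := by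
    have h2 := hx
    rw [discPoly_eq, eval_mul, mul_eq_zero] at h2
    rcases h2 with h2 | h2
    · refine ⟨-1, by norm_num, ?_⟩
      rw [edgePoly_eval] at h2 ⊢; linarith
    · refine ⟨1, by norm_num, ?_⟩
      rw [edgePoly_eval] at h2 ⊢; linarith
  have hne : (edgePoly α β s).eval x ≠ 0 := by rw [hsx]; exact mul_ne_zero two_ne_zero hT
  have h3 := wronskian_diff_ge (h.edgePoly_splits hs) (h.edgePoly_roots_nonpos hs)
    (h.derPoly_eq s) hne
  simp only [derivative_mul, derivative_X, one_mul, eval_add, eval_mul, eval_X] at h3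
  rw [hD, hsx] at h3
  have h4 : 0 < k * (2 * (trPoly α β).eval x) ^ 2 := by positivity
  have hxn : x ≠ 0 := by
    rintro rfl
    nlinarith
  have hxneg : x < 0 := lt_of_le_of_ne hx0 hxn
  refine ⟨hxneg, hD, ?_⟩
  have h5 : 0 < (derPoly α β).derivative.eval x * (trPoly α β).eval x := by
    by_contra! hcon
    nlinarith [mul_nonneg_of_nonpos_of_nonpos hx0 (by linarith : x - 1 ≤ 0)]
  have h6 := congrArg (fun P => eval x (derivative P)) h.discPoly_derivative
  simp only [derivative_sub, derivative_mul, derivative_X, derivative_one, sub_zero, one_mul,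
    derivative_C, zero_mul, zero_add, eval_add, eval_sub, eval_mul, eval_X, eval_one, eval_C,
    hD, hx', mul_zero] at h6
  by_contra! hcon
  nlinarith

end Admissible

/-! ### Multiplicities and the factorization of the discriminant -/

/-- The zeros of `p` of multiplicity `m`. -/
def rootsOfMult (α β : Fin k → ℝ) (m : ℕ) : Finset ℝ :=
  (discPoly α β).roots.toFinset.filter fun s => (discPoly α β).rootMultiplicity s = m

/-- The quotient of `(z - 1)ᵏ⁺¹ (Tr Φ)'(z)` by `q`. -/
def critPoly (α β : Fin k → ℝ) : ℝ[X] := derPoly α β /ₘ qPoly α β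

namespace Admissible

variable {α β : Fin k → ℝ} (h : Admissible α β)
include h

theorem rootMultiplicity_discPoly_le (x : ℝ) : (discPoly α β).rootMultiplicity x ≤ 2 := by
  by_contra! hcon
  have h1 := (lt_rootMultiplicity_iff_isRoot_iterate_derivative h.discPoly_ne_zero).mp hcon
  have h2 := h1 0 (by norm_num)
  have h3 := h1 1 (by norm_num)
  have h4 := h1 2 (by norm_num)
  simp only [Function.iterate_zero, id, Function.iterate_succ, Function.comp, IsRoot.def]
    at h2 h3 h4
  have := (h.double_root h2 h3).2.2
  linarith

theorem mem_rootsOfMult {m : ℕ} (hm : 1 ≤ m) {x : ℝ} :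
    x ∈ rootsOfMult α β m ↔ (discPoly α β).rootMultiplicity x = m := by
  rw [rootsOfMult, Finset.mem_filter, Multiset.mem_toFinset, mem_roots h.discPoly_ne_zero]
  refine ⟨fun hx => hx.2, fun hx => ⟨?_, hx⟩⟩
  rw [← rootMultiplicity_pos h.discPoly_ne_zero]; omega

theorem mem_double_iff {x : ℝ} : x ∈ rootsOfMult α β 2 ↔
    (discPoly α β).eval x = 0 ∧ (discPoly α β).derivative.eval x = 0 := by
  rw [h.mem_rootsOfMult (by norm_num)]
  have := one_lt_rootMultiplicity_iff_isRoot (t := x) h.discPoly_ne_zero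
  have h2 := h.rootMultiplicity_discPoly_le x
  rw [IsRoot.def, IsRoot.def] at this
  rw [← this]; omega

theorem mem_simple_iff {x : ℝ} : x ∈ rootsOfMult α β 1 ↔
    (discPoly α β).eval x = 0 ∧ (discPoly α β).derivative.eval x ≠ 0 := by
  rw [h.mem_rootsOfMult (by norm_num)]
  have h1 := one_lt_rootMultiplicity_iff_isRoot (t := x) h.discPoly_ne_zero
  have h2 := rootMultiplicity_pos h.discPoly_ne_zero (x := x)
  rw [IsRoot.def] at h1 h2
  rw [IsRoot.def] at h1
  rw [← h2]
  constructor
  · intro h3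
    exact ⟨by omega, fun h4 => by have := h1.mpr ⟨h2.mp (by omega), h4⟩; omega⟩
  · rintro ⟨h3, h4⟩
    by_contra h5
    exact h4 (h1.mp (by omega)).2

theorem mult_cases {x : ℝ} (hx : x ∈ (discPoly α β).roots.toFinset) :
    (discPoly α β).rootMultiplicity x = 1 ∨ (discPoly α β).rootMultiplicity x = 2 := by
  rw [Multiset.mem_toFinset, mem_roots h.discPoly_ne_zero,
    ← rootMultiplicity_pos h.discPoly_ne_zero] at hx
  have := h.rootMultiplicity_discPoly_le x
  omega

theorem qPoly_eq : qPoly α β = ∏ s ∈ rootsOfMult α β 2, (X - C s) := by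
  rw [qPoly, rootsOfMult, Finset.prod_filter]
  refine Finset.prod_congr rfl fun s hs => ?_
  rcases h.mult_cases hs with h1 | h1 <;> simp [h1]

/-- Each multiplicity `m` is split as `2 (m / 2) + m % 2`; as `m ≤ 2`, the odd parts are exactly the
simple zeros. -/
theorem discPoly_factor : discPoly α β = qPoly α β ^ 2 *
    (C (discPoly α β).leadingCoeff * ∏ s ∈ rootsOfMult α β 1, (X - C s)) := by
  have h1 : ∏ s ∈ rootsOfMult α β 1, (X - C s) = ∏ s ∈ (discPoly α β).roots.toFinset,
      (X - C s) ^ ((discPoly α β).rootMultiplicity s % 2) := by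
    rw [rootsOfMult, Finset.prod_filter]
    refine Finset.prod_congr rfl fun s hs => ?_
    rcases h.mult_cases hs with h1 | h1 <;> simp [h1]
  rw [h1, qPoly, ← Finset.prod_pow, mul_left_comm, ← Finset.prod_mul_distrib]
  conv_lhs => rw [h.discPoly_splits.eq_prod_roots, Finset.prod_multiset_map_count]
  congr 1
  refine Finset.prod_congr rfl fun s _ => ?_
  rw [count_roots, ← pow_mul, ← pow_add]
  congr 1; omega

omit h in
theorem qPoly_monic : (qPoly α β).Monic :=
  monic_prod_of_monic _ _ fun s _ => (monic_X_sub_C s).pow _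

theorem p0Poly_eq : p0Poly α β =
    C (discPoly α β).leadingCoeff * ∏ s ∈ rootsOfMult α β 1, (X - C s) := by
  rw [p0Poly]
  conv_lhs => rw [h.discPoly_factor]
  exact mul_divByMonic_cancel_left _ (qPoly_monic.pow 2)

theorem discPoly_eq_sq_mul : discPoly α β = qPoly α β ^ 2 * p0Poly α β := by
  rw [h.p0Poly_eq]; exact h.discPoly_factor

theorem qPoly_squarefree : Squarefree (qPoly α β) := by
  rw [h.qPoly_eq]
  exact (separable_prod_X_sub_C_iff'.mpr fun x _ y _ hxy => hxy).squarefree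

theorem p0Poly_roots : (p0Poly α β).roots = (rootsOfMult α β 1).val := by
  rw [h.p0Poly_eq, roots_C_mul _ h.leadingCoeff_discPoly.ne', roots_prod_X_sub_C]

theorem p0Poly_leadingCoeff : (p0Poly α β).leadingCoeff = (discPoly α β).leadingCoeff := by
  rw [h.p0Poly_eq, leadingCoeff_mul, leadingCoeff_C, (monic_prod_of_monic _ _
    fun s _ => monic_X_sub_C s).leadingCoeff, mul_one]

theorem p0Poly_leadingCoeff_pos : 0 < (p0Poly α β).leadingCoeff := by
  rw [h.p0Poly_leadingCoeff]; exact h.leadingCoeff_discPoly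

theorem p0Poly_ne_zero : p0Poly α β ≠ 0 := leadingCoeff_ne_zero.mp h.p0Poly_leadingCoeff_pos.ne'

theorem p0Poly_splits : (p0Poly α β).Splits := by
  rw [h.p0Poly_eq]
  exact (Splits.C _).mul (Splits.prod fun s _ => Splits.X_sub_C s)

theorem p0Poly_squarefree : Squarefree (p0Poly α β) := by
  refine ((nodup_roots_iff_of_splits h.p0Poly_ne_zero h.p0Poly_splits).mp ?_).squarefree
  rw [h.p0Poly_roots]; exact Finset.nodup _

theorem natDegree_p0Poly_add : 2 * (qPoly α β).natDegree + (p0Poly α β).natDegree = 2 * k - 1 := by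
  have h1 := h.natDegree_discPoly
  rw [h.discPoly_eq_sq_mul, natDegree_mul (pow_ne_zero _ qPoly_monic.ne_zero) h.p0Poly_ne_zero,
    natDegree_pow] at h1
  exact h1

theorem qPoly_eval_eq_zero_iff {x : ℝ} : (qPoly α β).eval x = 0 ↔ x ∈ rootsOfMult α β 2 := by
  rw [h.qPoly_eq, eval_prod, Finset.prod_eq_zero_iff]
  constructor
  · rintro ⟨a, ha, hax⟩
    have : x = a := by simpa [sub_eq_zero] using hax
    rwa [this]
  · intro hx; exact ⟨x, hx, by simp⟩

theorem p0Poly_eval_eq_zero_iff {x : ℝ} : (p0Poly α β).eval x = 0 ↔ x ∈ rootsOfMult α β 1 := by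
  rw [← IsRoot.def, ← mem_roots h.p0Poly_ne_zero, h.p0Poly_roots]; rfl

theorem one_le_kPrime : 1 ≤ kPrime α β ∧ (qPoly α β).natDegree + kPrime α β = k ∧
    (p0Poly α β).natDegree + 1 = 2 * kPrime α β := by
  have h1 := h.natDegree_p0Poly_add
  have h2 := h.one_le
  rw [kPrime]; omega

theorem discPoly_eval_eq (x : ℝ) :
    (discPoly α β).eval x = (qPoly α β).eval x ^ 2 * (p0Poly α β).eval x := by
  conv_lhs => rw [h.discPoly_eq_sq_mul]
  simp

/-- A double zero of `p` is a zero of `D`, and `q` is a product of distinct linear factors. -/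
theorem qPoly_dvd_derPoly : qPoly α β ∣ derPoly α β := by
  rw [h.qPoly_eq]
  refine Finset.prod_dvd_of_coprime (fun x _ y _ hxy => ?_) fun s hs => ?_
  · exact isCoprime_X_sub_C_of_isUnit_sub (sub_ne_zero_of_ne hxy).isUnit
  · rw [dvd_iff_isRoot]
    have := h.mem_double_iff.mp hs
    exact (h.double_root this.1 this.2).2.1

theorem derPoly_eq_mul : derPoly α β = qPoly α β * critPoly α β := by
  obtain ⟨S, hS⟩ := h.qPoly_dvd_derPoly
  rw [critPoly, hS, mul_divByMonic_cancel_left _ qPoly_monic]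

theorem derPoly_eval_eq (x : ℝ) :
    (derPoly α β).eval x = (qPoly α β).eval x * (critPoly α β).eval x := by
  rw [h.derPoly_eq_mul, eval_mul]

theorem zero_mem_simple : (0 : ℝ) ∈ rootsOfMult α β 1 := by
  rw [h.mem_simple_iff]
  have h0 : (discPoly α β).eval 0 = 0 := by
    rw [discPoly_eval, h.trPoly_eval_zero, pow_mul]; norm_num
  exact ⟨h0, fun h1 => lt_irrefl _ (h.double_root h0 h1).1⟩

theorem nonpos_of_mem {m : ℕ} {x : ℝ} (hx : x ∈ rootsOfMult α β m) : x ≤ 0 := by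
  rw [rootsOfMult, Finset.mem_filter, Multiset.mem_toFinset] at hx
  exact h.nonpos_of_discPoly_eval (isRoot_of_mem_roots hx.1)

theorem qPoly_eval_pos {x : ℝ} (hx : 0 ≤ x) : 0 < (qPoly α β).eval x := by
  rw [h.qPoly_eq, eval_prod]
  refine Finset.prod_pos fun s hs => ?_
  have h1 := h.mem_double_iff.mp hs
  have := (h.double_root h1.1 h1.2).1
  simp only [eval_sub, eval_X, eval_C]; linarith

theorem p0Poly_eval_pos {x : ℝ} (hx : 0 < x) : 0 < (p0Poly α β).eval x := by
  rw [h.p0Poly_eq, eval_mul, eval_C, eval_prod]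
  refine mul_pos h.leadingCoeff_discPoly (Finset.prod_pos fun s hs => ?_)
  have := h.nonpos_of_mem hs
  simp only [eval_sub, eval_X, eval_C]; linarith

/-- A double zero of `p` lies in the interior of a band. -/
theorem p0Poly_eval_neg_of_qPoly {x : ℝ} (hx : (qPoly α β).eval x = 0) :
    (p0Poly α β).eval x < 0 := by
  have h1 := h.mem_double_iff.mp (h.qPoly_eval_eq_zero_iff.mp hx)
  have h2 := (h.double_root h1.1 h1.2).2.2
  have h3 : (discPoly α β).derivative.derivative.eval x =
      2 * (qPoly α β).derivative.eval x ^ 2 * (p0Poly α β).eval x := by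
    rw [h.discPoly_eq_sq_mul, sq (qPoly α β)]
    simp only [derivative_mul, derivative_add, eval_add, eval_mul, hx]
    ring
  rw [h3] at h2
  by_contra! hcon
  have : 0 ≤ 2 * (qPoly α β).derivative.eval x ^ 2 * (p0Poly α β).eval x := by positivity
  linarith

theorem qPoly_eval_ne_zero {x : ℝ} (hx : 0 ≤ (p0Poly α β).eval x) : (qPoly α β).eval x ≠ 0 :=
  fun h0 => by have := h.p0Poly_eval_neg_of_qPoly h0; linarith

theorem critPoly_eval_ne_zero {x : ℝ} (hx : (p0Poly α β).eval x = 0) :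
    (critPoly α β).eval x ≠ 0 := by
  intro h0
  have h1 := h.mem_simple_iff.mp (h.p0Poly_eval_eq_zero_iff.mp hx)
  refine h1.2 ((h.discPoly_derivative_eq_zero_iff h1.1).mpr ?_)
  rw [h.derPoly_eval_eq, h0, mul_zero]

theorem p0Poly_derivative_eval_ne_zero {x : ℝ} (hx : (p0Poly α β).eval x = 0) :
    (p0Poly α β).derivative.eval x ≠ 0 := by
  intro h0
  have h1 := h.mem_simple_iff.mp (h.p0Poly_eval_eq_zero_iff.mp hx)
  apply h1.2
  rw [h.discPoly_eq_sq_mul]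
  simp [derivative_mul, h0, hx]

/-- The identity behind `d log ρ = S dz / ((z - 1) w)`. -/
theorem spectral_identity : (X - 1) * (2 * (qPoly α β).derivative * p0Poly α β +
      qPoly α β * (p0Poly α β).derivative) - C (2 * k : ℝ) * qPoly α β * p0Poly α β =
    2 * critPoly α β * trPoly α β := by
  have h1 := h.discPoly_derivative
  rw [h.derPoly_eq_mul, h.discPoly_eq_sq_mul] at h1
  have h2 : qPoly α β ≠ 0 := qPoly_monic.ne_zero
  apply mul_left_cancel₀ h2
  rw [derivative_mul, derivative_pow, show (C 2 : ℝ[X]) = 2 from rfl] at h1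
  simp only [Nat.cast_ofNat, Nat.add_one_sub_one, pow_one] at h1
  rw [show (C 2 : ℝ[X]) = 2 from rfl] at h1
  linear_combination h1

/-- In degree `k` the two contributions cancel. In degree `k - 1` there remains minus the
coefficient of `T`, minus `2k`. -/
theorem derPoly_coeff : (derPoly α β).natDegree ≤ k - 1 ∧ (derPoly α β).coeff (k - 1) < 0 := by
  have hk := h.one_le
  obtain ⟨n, rfl⟩ : ∃ n, k = n + 1 := ⟨k - 1, by omega⟩
  have hc : ∀ m, (derPoly α β).coeff m =
      (m : ℝ) * (trPoly α β).coeff m - (m + 1) * (trPoly α β).coeff (m + 1) -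
        (n + 1) * (trPoly α β).coeff m := by
    intro m
    rw [derPoly, sub_mul, one_mul, coeff_sub, coeff_sub, coeff_C_mul, coeff_derivative]
    cases m with
    | zero => simp
    | succ m => rw [coeff_X_mul, coeff_derivative]; push_cast; ring
  simp only [Nat.add_sub_cancel]
  constructor
  · rw [natDegree_le_iff_coeff_eq_zero]
    intro m hm
    have h1 : (trPoly α β).coeff (m + 1) = 0 :=
      coeff_eq_zero_of_natDegree_lt (h.trPoly_natDegree_le.trans_lt (by omega))
    rw [hc, h1]
    rcases Nat.lt_or_ge (n + 1) m with h4 | h4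
    · rw [coeff_eq_zero_of_natDegree_lt (h.trPoly_natDegree_le.trans_lt h4)]; ring
    · have : m = n + 1 := by omega
      subst this; push_cast; ring
  · rw [hc, h.trPoly_coeff_top]
    have := h.trPoly_coeff_nonneg n
    have : (0 : ℝ) ≤ n := by positivity
    linarith

theorem critPoly_natDegree : (critPoly α β).natDegree + 1 = kPrime α β := by
  have h1 := h.derPoly_coeff
  have h2 : (derPoly α β).natDegree = k - 1 := natDegree_eq_of_le_of_coeff_ne_zero h1.1 h1.2.ne
  have h3 : critPoly α β ≠ 0 := by
    intro h0
    rw [h.derPoly_eq_mul, h0, mul_zero] at h1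
    simp at h1
  rw [h.derPoly_eq_mul, natDegree_mul qPoly_monic.ne_zero h3] at h2
  have := h.one_le_kPrime
  omega

theorem critPoly_ne_zero : critPoly α β ≠ 0 := by
  intro h0
  have h1 := h.derPoly_coeff
  rw [h.derPoly_eq_mul, h0, mul_zero] at h1
  simp at h1

end Admissible

/-! ### Branch points and gaps -/

namespace Admissible

variable {α β : Fin k → ℝ} (h : Admissible α β)
include h

theorem length_sort_roots :
    ((p0Poly α β).roots.sort (· ≥ ·)).length = (p0Poly α β).natDegree := by
  rw [Multiset.length_sort, h.p0Poly_splits.natDegree_eq_card_roots]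

theorem branchPt_eq {j : ℕ} (hj : j < (p0Poly α β).natDegree) :
    branchPt α β j = ((p0Poly α β).roots.sort (· ≥ ·))[j]'(by rwa [h.length_sort_roots]) := by
  rw [branchPt, List.getD_eq_getElem]

theorem branchPt_lt {i j : ℕ} (hij : i < j) (hj : j < (p0Poly α β).natDegree) :
    branchPt α β j < branchPt α β i := by
  have h1 : ((p0Poly α β).roots.sort (· ≥ ·)).Pairwise (· ≥ ·) := Multiset.pairwise_sort _ _
  have h2 : ((p0Poly α β).roots.sort (· ≥ ·)).Nodup := by
    rw [← Multiset.coe_nodup, Multiset.sort_eq, h.p0Poly_roots]; exact Finset.nodup _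
  rw [h.branchPt_eq hj, h.branchPt_eq (hij.trans hj)]
  refine lt_of_le_of_ne (List.pairwise_iff_getElem.mp h1 _ _ _ _ hij) fun heq => ?_
  exact hij.ne' ((List.Nodup.getElem_inj_iff h2).mp heq)

theorem p0Poly_roots_eq :
    (p0Poly α β).roots = (Multiset.range (p0Poly α β).natDegree).map (branchPt α β) := by
  conv_lhs => rw [← Multiset.sort_eq (p0Poly α β).roots (· ≥ ·)]
  rw [← Multiset.coe_range, Multiset.map_coe, Multiset.coe_eq_coe]
  refine List.Perm.of_eq (List.ext_getElem ?_ fun j h1 h2 => ?_)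
  · rw [h.length_sort_roots, List.length_map, List.length_range]
  · rw [List.getElem_map, List.getElem_range, h.branchPt_eq]
    rwa [h.length_sort_roots] at h1

theorem p0Poly_eval_eq_zero_iff_branchPt {x : ℝ} :
    (p0Poly α β).eval x = 0 ↔ ∃ j < (p0Poly α β).natDegree, branchPt α β j = x := by
  rw [← IsRoot.def, ← mem_roots h.p0Poly_ne_zero, h.p0Poly_roots_eq]
  simp

theorem p0Poly_eval_branchPt {j : ℕ} (hj : j < (p0Poly α β).natDegree) :
    (p0Poly α β).eval (branchPt α β j) = 0 :=
  h.p0Poly_eval_eq_zero_iff_branchPt.mpr ⟨j, hj, rfl⟩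

theorem p0Poly_aeval_eq_prod (z : ℂ) : aeval z (p0Poly α β) = ((p0Poly α β).leadingCoeff : ℂ) *
    ∏ j ∈ Finset.range (p0Poly α β).natDegree, (z - branchPt α β j) := by
  conv_lhs => rw [h.p0Poly_splits.eq_prod_roots, h.p0Poly_roots_eq]
  rw [map_mul, aeval_C, Multiset.map_map, Finset.prod, map_multiset_prod, Multiset.map_map]
  simp only [Complex.coe_algebraMap, Function.comp_def, map_sub, aeval_X, aeval_C]
  rfl

theorem p0Poly_eval_eq_prod (z : ℝ) : (p0Poly α β).eval z = (p0Poly α β).leadingCoeff *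
    ∏ j ∈ Finset.range (p0Poly α β).natDegree, (z - branchPt α β j) := by
  conv_lhs => rw [h.p0Poly_splits.eq_prod_roots, h.p0Poly_roots_eq]
  rw [eval_mul, eval_C, Multiset.map_map, Finset.prod, eval_multiset_prod, Multiset.map_map]
  simp only [Function.comp_def, eval_sub, eval_X, eval_C]
  rfl

theorem p0Poly_aeval_eq_zero_iff {z : ℂ} : aeval z (p0Poly α β) = 0 ↔
    ∃ j < (p0Poly α β).natDegree, z = (branchPt α β j : ℂ) := by
  rw [h.p0Poly_aeval_eq_prod, mul_eq_zero, Finset.prod_eq_zero_iff]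
  have : ((p0Poly α β).leadingCoeff : ℂ) ≠ 0 := by exact_mod_cast h.p0Poly_leadingCoeff_pos.ne'
  simp [this, sub_eq_zero]

theorem branchPt_zero : branchPt α β 0 = 0 := by
  obtain ⟨j, hj, hj0⟩ := h.p0Poly_eval_eq_zero_iff_branchPt.mp
    (h.p0Poly_eval_eq_zero_iff.mpr h.zero_mem_simple)
  rcases Nat.eq_zero_or_pos j with rfl | hpos
  · exact hj0
  · have h1 := h.branchPt_lt hpos hj
    have h2 := h.nonpos_of_mem (h.p0Poly_eval_eq_zero_iff.mp (h.p0Poly_eval_branchPt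
      (hpos.trans hj)))
    linarith

theorem branchPt_neg {j : ℕ} (hj0 : 0 < j) (hj : j < (p0Poly α β).natDegree) :
    branchPt α β j < 0 := by
  have := h.branchPt_lt hj0 hj
  rwa [h.branchPt_zero] at this

theorem branchPt_le {i j : ℕ} (hij : i ≤ j) (hj : j < (p0Poly α β).natDegree) :
    branchPt α β j ≤ branchPt α β i := by
  rcases hij.eq_or_lt with rfl | h1
  · exact le_rfl
  · exact (h.branchPt_lt h1 hj).le

section Gap

variable {l : ℕ} (hl1 : 1 ≤ l) (hl : l < kPrime α β)
include hl1 hl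

theorem gap_index : 2 * l < (p0Poly α β).natDegree ∧ 2 * l - 1 < (p0Poly α β).natDegree := by
  have := h.one_le_kPrime
  omega

theorem gap_lt : branchPt α β (2 * l) < branchPt α β (2 * l - 1) :=
  h.branchPt_lt (by omega) (h.gap_index hl1 hl).1

theorem gap_neg : branchPt α β (2 * l - 1) < 0 :=
  h.branchPt_neg (by omega) (h.gap_index hl1 hl).2

theorem gap_sub_sign {x : ℝ} (hx : x ∈ Ioo (branchPt α β (2 * l)) (branchPt α β (2 * l - 1)))
    {j : ℕ} (hj : j < (p0Poly α β).natDegree) :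
    (j < 2 * l → x < branchPt α β j) ∧ (2 * l ≤ j → branchPt α β j < x) := by
  constructor
  · intro h1
    exact hx.2.trans_le (h.branchPt_le (by omega) (h.gap_index hl1 hl).2)
  · intro h1
    exact (h.branchPt_le h1 hj).trans_lt hx.1

/-- An even number `2l` of branch points lies to the right of the gap, so the negative linear
factors pair off. -/
theorem p0Poly_eval_pos_of_gap {x : ℝ}
    (hx : x ∈ Ioo (branchPt α β (2 * l)) (branchPt α β (2 * l - 1))) :
    0 < (p0Poly α β).eval x := by
  have hi := (h.gap_index hl1 hl).1
  rw [h.p0Poly_eval_eq_prod]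
  refine mul_pos h.p0Poly_leadingCoeff_pos ?_
  rw [← Finset.prod_range_mul_prod_Ico _ hi.le]
  refine mul_pos ?_ (Finset.prod_pos fun j hj => ?_)
  · rw [show ∏ j ∈ Finset.range (2 * l), (x - branchPt α β j) =
      ∏ j ∈ Finset.range (2 * l), (branchPt α β j - x) from ?_]
    · refine Finset.prod_pos fun j hj => ?_
      rw [Finset.mem_range] at hj
      have := (h.gap_sub_sign hl1 hl hx (hj.trans hi)).1 hj
      linarith
    · rw [← Finset.prod_congr rfl fun j _ => neg_sub x (branchPt α β j), Finset.prod_neg,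
        Finset.card_range, pow_mul]
      simp
  · rw [Finset.mem_Ico] at hj
    have := (h.gap_sub_sign hl1 hl hx hj.2).2 hj.1
    linarith

/-- Rolle's theorem for `p / (z-1)^{2k} = (Tr Φ)² - 4`, which vanishes at both ends; its derivative
is `2 T D` divided by `(z-1)^{2k+1}`, and neither `T` nor `q` vanishes inside the gap. -/
theorem exists_critPoly_zero :
    ∃ s ∈ Ioo (branchPt α β (2 * l)) (branchPt α β (2 * l - 1)), (critPoly α β).eval s = 0 := by
  have hneg := h.gap_neg hl1 hl
  have hne : ∀ x ≤ branchPt α β (2 * l - 1), x - 1 ≠ 0 := fun x hx => by linarith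
  have hend : ∀ j < (p0Poly α β).natDegree, (discPoly α β).eval (branchPt α β j) = 0 := by
    intro j hj
    rw [h.discPoly_eval_eq, h.p0Poly_eval_branchPt hj, mul_zero]
  have hc : ContinuousOn (fun x => (discPoly α β).eval x / (x - 1) ^ (2 * k))
      (Icc (branchPt α β (2 * l)) (branchPt α β (2 * l - 1))) := by
    refine ContinuousOn.div (discPoly α β).continuous.continuousOn (by fun_prop) fun x hx => ?_
    exact pow_ne_zero _ (hne x hx.2)
  have he : (fun x => (discPoly α β).eval x / (x - 1) ^ (2 * k)) (branchPt α β (2 * l)) =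
      (fun x => (discPoly α β).eval x / (x - 1) ^ (2 * k)) (branchPt α β (2 * l - 1)) := by
    simp only [hend _ (h.gap_index hl1 hl).1, hend _ (h.gap_index hl1 hl).2, zero_div]
  have hd : ∀ x ∈ Ioo (branchPt α β (2 * l)) (branchPt α β (2 * l - 1)),
      HasDerivAt (fun x => (discPoly α β).eval x / (x - 1) ^ (2 * k))
        (((discPoly α β).derivative.eval x * (x - 1) ^ (2 * k) -
      (discPoly α β).eval x * (((2 * k : ℕ) : ℝ) * (x - 1) ^ (2 * k - 1) * 1)) /
        ((x - 1) ^ (2 * k)) ^ 2) x := by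
    intro x hx
    refine ((discPoly α β).hasDerivAt x).div ?_ (pow_ne_zero _ (hne x hx.2.le))
    exact ((hasDerivAt_id x).sub_const 1).pow _
  have key := exists_hasDerivAt_eq_zero
    (f := fun x => (discPoly α β).eval x / (x - 1) ^ (2 * k))
    (f' := fun x => ((discPoly α β).derivative.eval x * (x - 1) ^ (2 * k) -
      (discPoly α β).eval x * (((2 * k : ℕ) : ℝ) * (x - 1) ^ (2 * k - 1) * 1)) /
        ((x - 1) ^ (2 * k)) ^ 2)
    (h.gap_lt hl1 hl) hc he hd
  obtain ⟨s, hs, hs0⟩ := key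
  refine ⟨s, hs, ?_⟩
  have h1 := hne s hs.2.le
  have hp := h.p0Poly_eval_pos_of_gap hl1 hl hs
  have hq := h.qPoly_eval_ne_zero hp.le
  have h2 := h.discPoly_derivative_eval s
  rw [div_eq_zero_iff, or_iff_left (pow_ne_zero _ (pow_ne_zero _ h1))] at hs0
  have h3 : (s - 1) ^ (2 * k - 1) ≠ 0 := pow_ne_zero _ h1
  have h4 : (s - 1) ^ (2 * k) = (s - 1) ^ (2 * k - 1) * (s - 1) := by
    have := h.one_le
    rw [← pow_succ]; congr 1; omega
  rw [h4] at hs0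
  push_cast at hs0
  have h5 : (s - 1) ^ (2 * k - 1) * ((s - 1) * (discPoly α β).derivative.eval s -
      2 * k * (discPoly α β).eval s) = 0 := by linear_combination hs0
  rw [h2] at h5
  have hT : (trPoly α β).eval s ≠ 0 := by
    intro h0
    have h6 := discPoly_eval (α := α) (β := β) s
    rw [h0, h.discPoly_eval_eq, pow_mul] at h6
    have : 0 < (qPoly α β).eval s ^ 2 * (p0Poly α β).eval s := by positivity
    have : 0 ≤ ((s - 1) ^ 2) ^ k := by positivity
    linarith
  have h7 : (derPoly α β).eval s = 0 := by
    simpa [h3, hT] using h5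
  rw [h.derPoly_eval_eq] at h7
  exact (mul_eq_zero.mp h7).resolve_left hq

end Gap

end Admissible

/-! ### The parametrization and its sign properties -/

/-- The polynomial `p₀ / z`. -/
def p1Poly (α β : Fin k → ℝ) : ℝ[X] := (p0Poly α β).divX

/-- `z⁻¹ p₀^{3/2} (z S / p₀^{1/2})'`. -/
def lowerPoly (α β : Fin k → ℝ) : ℝ[X] :=
  (critPoly α β + X * (critPoly α β).derivative) * p1Poly α β -
    C (1 / 2) * critPoly α β * (p0Poly α β).derivative

/-- `p₀^{3/2} (S / p₀^{1/2})'`. -/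
def upperPoly (α β : Fin k → ℝ) : ℝ[X] :=
  (critPoly α β).derivative * p0Poly α β - C (1 / 2) * critPoly α β * (p0Poly α β).derivative

/-- The common denominator of the parametrization. -/
def curveDen (α β : Fin k → ℝ) : ℝ[X] := X * upperPoly α β - lowerPoly α β

/-- The numerator of `η` in the parametrization. -/
def curveNum (α β : Fin k → ℝ) : ℝ[X] := X * upperPoly α β + lowerPoly α β

/-- The parametrization of the boundary curves. -/
def curve (α β : Fin k → ℝ) (z : ℝ) : ℝ × ℝ :=
  (k * (p1Poly α β).eval z * √((p0Poly α β).eval z) / (curveDen α β).eval z,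
    (curveNum α β).eval z / (curveDen α β).eval z)

namespace Admissible

variable {α β : Fin k → ℝ} (h : Admissible α β)
include h

theorem p0Poly_eq_X_mul : p0Poly α β = X * p1Poly α β := by
  have h0 : (p0Poly α β).coeff 0 = 0 := by
    rw [coeff_zero_eq_eval_zero]
    exact h.p0Poly_eval_eq_zero_iff.mpr h.zero_mem_simple
  have := X_mul_divX_add (p0Poly α β)
  rw [h0, C_0, add_zero] at this
  exact this.symm

theorem p0Poly_eval_eq (z : ℝ) : (p0Poly α β).eval z = z * (p1Poly α β).eval z := by
  conv_lhs => rw [h.p0Poly_eq_X_mul]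
  simp

theorem ne_zero_of_p0Poly_pos {z : ℝ} (hz : 0 < (p0Poly α β).eval z) : z ≠ 0 := by
  rintro rfl
  rw [h.p0Poly_eval_eq, zero_mul] at hz
  exact lt_irrefl _ hz

theorem discPoly_eval_pos {z : ℝ} (hz : 0 < (p0Poly α β).eval z) :
    0 < (discPoly α β).eval z := by
  have := h.qPoly_eval_ne_zero hz.le
  rw [h.discPoly_eval_eq]; positivity

/-- The two edge factors have product `p > 0` and sum `2 T`, so both carry the sign of `T`. -/
theorem edgePoly_sign {z : ℝ} (hz : 0 < (p0Poly α β).eval z) {s : ℝ} (hs : s ^ 2 = 1) :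
    0 < (trPoly α β).eval z * (edgePoly α β s).eval z := by
  have h1 := h.discPoly_eval_pos hz
  rw [discPoly_eq, eval_mul] at h1
  have h2 : (edgePoly α β 1).eval z + (edgePoly α β (-1)).eval z = 2 * (trPoly α β).eval z := by
    rw [edgePoly_eval, edgePoly_eval]; ring
  rcases sq_eq_one_iff.mp hs with rfl | rfl
  · have : (edgePoly α β 1).eval z ≠ 0 := fun h0 => by rw [h0] at h1; simp at h1
    have := sq_pos_of_ne_zero this
    have h3 : 2 * ((trPoly α β).eval z * (edgePoly α β 1).eval z) = (edgePoly α β 1).eval z ^ 2 +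
        (edgePoly α β 1).eval z * (edgePoly α β (-1)).eval z := by
      linear_combination (-(edgePoly α β 1).eval z) * h2
    linarith
  · have : (edgePoly α β (-1)).eval z ≠ 0 := fun h0 => by rw [h0] at h1; simp at h1
    have := sq_pos_of_ne_zero this
    have h3 : 2 * ((trPoly α β).eval z * (edgePoly α β (-1)).eval z) =
        (edgePoly α β (-1)).eval z ^ 2 +
        (edgePoly α β 1).eval z * (edgePoly α β (-1)).eval z := by
      linear_combination (-(edgePoly α β (-1)).eval z) * h2
    linarith

/-- This is the derivative of `S/√p₀ = D/√(E_1 E_{-1})` (up to sign) cleared of denominators,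
arranged so that it is a combination of the Wronskians of `D` with the two edge factors. -/
theorem cube_mul_upperPoly : C 2 * qPoly α β ^ 3 * upperPoly α β =
    edgePoly α β 1 * ((derPoly α β).derivative * edgePoly α β (-1) -
      derPoly α β * (edgePoly α β (-1)).derivative) +
    edgePoly α β (-1) * ((derPoly α β).derivative * edgePoly α β 1 -
      derPoly α β * (edgePoly α β 1).derivative) := by
  have h1 : qPoly α β ^ 2 * p0Poly α β = edgePoly α β 1 * edgePoly α β (-1) := by
    rw [← h.discPoly_eq_sq_mul, discPoly_eq]
  have h2 := congrArg derivative h1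
  rw [derivative_mul, derivative_mul, sq (qPoly α β), derivative_mul] at h2
  rw [upperPoly, h.derPoly_eq_mul, derivative_mul]
  have h3 : (C 2 : ℝ[X]) * C (1 / 2) = 1 := by rw [← C_mul]; norm_num
  have h4 : (C 2 : ℝ[X]) = 2 := rfl
  rw [h4] at h3 ⊢
  linear_combination (2 * ((qPoly α β).derivative * critPoly α β +
    qPoly α β * (critPoly α β).derivative)) * h1 - qPoly α β * critPoly α β * h2 -
    qPoly α β ^ 3 * critPoly α β * (p0Poly α β).derivative * h3

theorem cube_mul_lowerPoly : C 2 * qPoly α β ^ 3 * (X * lowerPoly α β) =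
    edgePoly α β 1 * ((X * derPoly α β).derivative * edgePoly α β (-1) -
      X * derPoly α β * (edgePoly α β (-1)).derivative) +
    edgePoly α β (-1) * ((X * derPoly α β).derivative * edgePoly α β 1 -
      X * derPoly α β * (edgePoly α β 1).derivative) := by
  have h1 : qPoly α β ^ 2 * p0Poly α β = edgePoly α β 1 * edgePoly α β (-1) := by
    rw [← h.discPoly_eq_sq_mul, discPoly_eq]
  have h2 := h.cube_mul_upperPoly
  have h3 : X * lowerPoly α β = critPoly α β * p0Poly α β + X * upperPoly α β := by
    rw [lowerPoly, upperPoly]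
    linear_combination (-(critPoly α β + X * (critPoly α β).derivative)) * h.p0Poly_eq_X_mul
  rw [h3]
  simp only [derivative_mul, derivative_X, one_mul]
  have h4 : (C 2 : ℝ[X]) = 2 := rfl
  rw [h4] at h2 ⊢
  have h5 := h.derPoly_eq_mul
  linear_combination X * h2 + 2 * qPoly α β * critPoly α β * h1 -
    2 * edgePoly α β 1 * edgePoly α β (-1) * h5

section Sign

variable {z : ℝ} (hz : 0 < (p0Poly α β).eval z)
include hz

theorem edgePoly_eval_ne_zero {s : ℝ} (hs : s ^ 2 = 1) : (edgePoly α β s).eval z ≠ 0 := by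
  intro h0
  have := h.edgePoly_sign hz hs
  rw [h0, mul_zero] at this
  exact lt_irrefl _ this

/-- The coefficients `E_{±1}` have the sign of `T` and the Wronskians are nonnegative. Strictness
comes from the edge factor that vanishes at the origin. -/
theorem upperPoly_sign :
    0 < (trPoly α β).eval z * ((qPoly α β).eval z * (upperPoly α β).eval z) := by
  have h1 := congrArg (eval z) h.cube_mul_upperPoly
  simp only [eval_mul, eval_C, eval_pow, eval_add, eval_sub] at h1
  have hp := fun s hs => wronskian_nonneg (h.edgePoly_splits hs) (h.edgePoly_roots_nonpos hs)
    (h.derPoly_eq s) (h.edgePoly_eval_ne_zero hz hs)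
  have hpp := fun s hs => wronskian_pos (h.edgePoly_splits hs) (h.edgePoly_roots_nonpos hs)
    (h.derPoly_eq s) (h.edgePoly_eval_ne_zero hz hs)
  have s1 := h.edgePoly_sign hz (s := 1) (by norm_num)
  have s2 := h.edgePoly_sign hz (s := -1) (by norm_num)
  have a1 := hp 1 (by norm_num)
  have a2 := hp (-1) (by norm_num)
  have hq := sq_pos_of_ne_zero (h.qPoly_eval_ne_zero hz.le)
  have hpos : 0 < (trPoly α β).eval z * (edgePoly α β 1).eval z *
      ((derPoly α β).derivative.eval z * (edgePoly α β (-1)).eval z -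
        (derPoly α β).eval z * (edgePoly α β (-1)).derivative.eval z) +
      (trPoly α β).eval z * (edgePoly α β (-1)).eval z *
      ((derPoly α β).derivative.eval z * (edgePoly α β 1).eval z -
        (derPoly α β).eval z * (edgePoly α β 1).derivative.eval z) := by
    -- As `T(0) = 2`, the edge factor vanishing at `0` is the one with `s = (-1)^k`.
    rcases neg_one_pow_eq_or ℝ k with hk | hk
    · have := hpp 1 (by norm_num)
        (by rw [edgePoly_eval, h.trPoly_eval_zero, zero_sub, hk]; norm_num)
      have := mul_pos s2 this
      have := mul_nonneg s1.le a2
      linarith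
    · have := hpp (-1) (by norm_num)
        (by rw [edgePoly_eval, h.trPoly_eval_zero, zero_sub, hk]; norm_num)
      have := mul_pos s1 this
      have := mul_nonneg s2.le a1
      linarith
  by_contra! hcon
  have h2 : 2 * (qPoly α β).eval z ^ 2 *
      ((trPoly α β).eval z * ((qPoly α β).eval z * (upperPoly α β).eval z)) ≤ 0 :=
    mul_nonpos_of_nonneg_of_nonpos (by positivity) hcon
  have h3 := congrArg (fun x => (trPoly α β).eval z * x) h1
  linarith

/-- The Wronskians with `z D` are nonpositive. Strictness comes from `E_1`, whose degree is `k - 1`,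
so that `wronskian_X_nonpos` leaves a term `-E_1²`. -/
theorem lowerPoly_sign :
    (trPoly α β).eval z * ((qPoly α β).eval z * (z * (lowerPoly α β).eval z)) < 0 := by
  have h1 := congrArg (eval z) h.cube_mul_lowerPoly
  simp only [eval_mul, eval_C, eval_pow, eval_add, eval_sub, eval_X] at h1
  have hp := fun s hs => wronskian_X_nonpos (h.edgePoly_splits hs) (h.edgePoly_roots_nonpos hs)
    (h.derPoly_eq s) (h.edgePoly_eval_ne_zero hz hs)
  have s1 := h.edgePoly_sign hz (s := 1) (by norm_num)
  have s2 := h.edgePoly_sign hz (s := -1) (by norm_num)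
  have a1 := hp 1 (by norm_num)
  have a2 := hp (-1) (by norm_num)
  rw [h.natDegree_edgePoly_one.1, Nat.cast_sub h.one_le, Nat.cast_one, sub_sub_cancel,
    mul_one] at a1
  rw [h.natDegree_edgePoly_neg_one.1, sub_self, mul_zero, neg_zero] at a2
  have hq := sq_pos_of_ne_zero (h.qPoly_eval_ne_zero hz.le)
  have hq1 := sq_pos_of_ne_zero (h.edgePoly_eval_ne_zero hz (s := 1) (by norm_num))
  have b1 := mul_neg_of_pos_of_neg s2 (a1.trans_lt (neg_neg_of_pos hq1))
  have b2 := mul_nonpos_of_nonneg_of_nonpos s1.le a2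
  by_contra! hcon
  have h2 : 0 ≤ 2 * (qPoly α β).eval z ^ 2 *
      ((trPoly α β).eval z * ((qPoly α β).eval z * (z * (lowerPoly α β).eval z))) :=
    mul_nonneg (by positivity) hcon
  have h3 := congrArg (fun x => (trPoly α β).eval z * x) h1
  linarith

omit h hz in
theorem curveDen_eval (z : ℝ) :
    (curveDen α β).eval z = z * (upperPoly α β).eval z - (lowerPoly α β).eval z := by
  simp [curveDen]

omit h hz in
theorem curveNum_eval (z : ℝ) :
    (curveNum α β).eval z = z * (upperPoly α β).eval z + (lowerPoly α β).eval z := by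
  simp [curveNum]

theorem curveDen_sign :
    0 < (trPoly α β).eval z * ((qPoly α β).eval z * (z * (curveDen α β).eval z)) := by
  have h1 := h.upperPoly_sign hz
  have h2 := h.lowerPoly_sign hz
  have h3 := sq_pos_of_ne_zero (h.ne_zero_of_p0Poly_pos hz)
  rw [curveDen_eval]
  nlinarith

theorem curveDen_ne_zero : (curveDen α β).eval z ≠ 0 := by
  intro h0
  have := h.curveDen_sign hz
  rw [h0] at this
  simp at this

/-- For `η = (zB + A)/(zB - A)`, `|η| < 1` amounts to `z A B < 0`, which is the product of the two
sign lemmas. -/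
theorem curveNum_div_mem : (curveNum α β).eval z / (curveDen α β).eval z ∈ Ioo (-1 : ℝ) 1 := by
  have h1 := h.upperPoly_sign hz
  have h2 := h.lowerPoly_sign hz
  have h3 := h.curveDen_ne_zero hz
  have hz0 := sq_pos_of_ne_zero (h.ne_zero_of_p0Poly_pos hz)
  rw [mem_Ioo, ← abs_lt, abs_div, div_lt_one (abs_pos.mpr h3), ← sq_lt_sq, curveNum_eval,
    curveDen_eval]
  set t := (trPoly α β).eval z * (qPoly α β).eval z
  have h5 : 0 < t * (upperPoly α β).eval z := by simpa only [t, mul_assoc] using h1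
  have h6 : t * (z * (lowerPoly α β).eval z) < 0 := by simpa only [t, mul_assoc] using h2
  have h7 : (t * t) * (z * ((upperPoly α β).eval z * (lowerPoly α β).eval z)) < 0 := by
    have := mul_neg_of_pos_of_neg h5 h6
    linarith
  have h8 : z * ((upperPoly α β).eval z * (lowerPoly α β).eval z) < 0 := by
    by_contra! hcon
    have := mul_nonneg (mul_self_nonneg t) hcon
    linarith
  linarith

/-- This is the squared form of `|χ| < 1`. Adding `wronskian_diff_ge` for both edge factors gives `T
q³ z V ≥ k T² p`, hence `(q³ z V)² ≥ k² T² p²`; the excess `T² - p = 4(z-1)^{2k}` is positive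
exactly because `z ≠ 1`. -/
theorem curveDen_sq_gt (hz1 : z ≠ 1) :
    k ^ 2 * (p0Poly α β).eval z ^ 3 < (z * (curveDen α β).eval z) ^ 2 := by
  have h1 := congrArg (eval z) h.cube_mul_lowerPoly
  have h2 := congrArg (eval z) h.cube_mul_upperPoly
  simp only [eval_mul, eval_C, eval_pow, eval_add, eval_sub, eval_X] at h1 h2
  have hp := fun s hs => wronskian_diff_ge (h.edgePoly_splits hs) (h.edgePoly_roots_nonpos hs)
    (h.derPoly_eq s) (h.edgePoly_eval_ne_zero hz hs)
  have s1 := h.edgePoly_sign hz (s := 1) (by norm_num)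
  have s2 := h.edgePoly_sign hz (s := -1) (by norm_num)
  have a1 := mul_le_mul_of_nonneg_left (hp 1 (by norm_num)) s2.le
  have a2 := mul_le_mul_of_nonneg_left (hp (-1) (by norm_num)) s1.le
  have hq := h.qPoly_eval_ne_zero hz.le
  have hsum : (edgePoly α β 1).eval z + (edgePoly α β (-1)).eval z = 2 * (trPoly α β).eval z := by
    rw [edgePoly_eval, edgePoly_eval]; ring
  have hprod : (edgePoly α β 1).eval z * (edgePoly α β (-1)).eval z = (discPoly α β).eval z := by
    rw [discPoly_eq, eval_mul]
  have hd := h.discPoly_eval_pos hz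
  have hlt : (discPoly α β).eval z < (trPoly α β).eval z ^ 2 := by
    rw [discPoly_eval, pow_mul]
    have : z - 1 ≠ 0 := sub_ne_zero.mpr hz1
    have : 0 < ((z - 1) ^ 2) ^ k := by positivity
    linarith
  have hk : (0 : ℝ) < k := by exact_mod_cast h.one_le
  set p := (discPoly α β).eval z with hp
  set T := (trPoly α β).eval z with hT
  set W := (qPoly α β).eval z ^ 3 * (z * (curveDen α β).eval z) with hW
  have key : k * T ^ 2 * p ≤ T * W := by
    have e1 : 2 * (T * W) = T * (edgePoly α β (-1)).eval z *
        (z ^ 2 * ((derPoly α β).derivative.eval z * (edgePoly α β 1).eval z -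
          (derPoly α β).eval z * (edgePoly α β 1).derivative.eval z) -
        ((X * derPoly α β).derivative.eval z * (edgePoly α β 1).eval z -
          z * (derPoly α β).eval z * (edgePoly α β 1).derivative.eval z)) +
        T * (edgePoly α β 1).eval z *
        (z ^ 2 * ((derPoly α β).derivative.eval z * (edgePoly α β (-1)).eval z -
          (derPoly α β).eval z * (edgePoly α β (-1)).derivative.eval z) -
        ((X * derPoly α β).derivative.eval z * (edgePoly α β (-1)).eval z -
          z * (derPoly α β).eval z * (edgePoly α β (-1)).derivative.eval z)) := by
      rw [hW, curveDen_eval]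
      linear_combination z ^ 2 * T * h2 - T * h1
    have e2 : 2 * (k * T ^ 2 * p) =
        T * (edgePoly α β (-1)).eval z * (k * (edgePoly α β 1).eval z ^ 2) +
        T * (edgePoly α β 1).eval z * (k * (edgePoly α β (-1)).eval z ^ 2) := by
      linear_combination -k * T * p * hsum -
        T * k * ((edgePoly α β 1).eval z + (edgePoly α β (-1)).eval z) * hprod
    linarith
  have hT0 : 0 < T ^ 2 := hd.trans hlt
  have h3 : (k * T ^ 2 * p) ^ 2 ≤ (T * W) ^ 2 := pow_le_pow_left₀ (by positivity) key 2
  have h4 : k ^ 2 * p ^ 3 < W ^ 2 := by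
    have h5 : T ^ 2 * (k ^ 2 * T ^ 2 * p ^ 2) ≤ T ^ 2 * W ^ 2 := by linarith
    have h6 := le_of_mul_le_mul_left h5 hT0
    have h7 : (k ^ 2 * p ^ 2) * p < (k ^ 2 * p ^ 2) * T ^ 2 :=
      mul_lt_mul_of_pos_left hlt (by positivity)
    linarith
  have h8 : p = (qPoly α β).eval z ^ 2 * (p0Poly α β).eval z := h.discPoly_eval_eq z
  rw [h8, hW] at h4
  have h9 : 0 < (qPoly α β).eval z ^ 6 := by
    rw [show 6 = 2 * 3 by norm_num, pow_mul]; positivity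
  refine lt_of_mul_lt_mul_left ?_ h9.le
  linarith

theorem curve_fst_sq_lt (hz1 : z ≠ 1) : (curve α β z).1 ^ 2 < 1 := by
  have h1 := h.curveDen_sq_gt hz hz1
  have h2 := h.curveDen_ne_zero hz
  have h3 := h.ne_zero_of_p0Poly_pos hz
  rw [curve]
  simp only
  rw [div_pow, div_lt_one (by positivity), mul_pow, Real.sq_sqrt hz.le]
  have h4 := sq_pos_of_ne_zero h3
  refine lt_of_mul_lt_mul_left ?_ h4.le
  rw [h.p0Poly_eval_eq] at h1 ⊢
  linarith

theorem curve_fst_ne_zero : (curve α β z).1 ≠ 0 := by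
  have h2 := h.curveDen_ne_zero hz
  have hk : (0 : ℝ) < k := by exact_mod_cast h.one_le
  have h3 : (p1Poly α β).eval z ≠ 0 := by
    intro h0
    rw [h.p0Poly_eval_eq, h0, mul_zero] at hz
    exact lt_irrefl _ hz
  have h4 : √((p0Poly α β).eval z) ≠ 0 := (Real.sqrt_pos.mpr hz).ne'
  rw [curve]
  positivity

end Sign

/-- When `p₀` and `p₀/z` both vanish, only the `S p₀'` terms of `A` and `B` survive, and they cancel
in the quotient. -/
theorem curve_at_branch {z : ℝ} (hz : (p0Poly α β).eval z = 0) (hz0 : z ≠ 0) :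
    (curveDen α β).eval z ≠ 0 ∧ curve α β z = (0, (z + 1) / (z - 1)) := by
  have h1 := h.critPoly_eval_ne_zero hz
  have h2 := h.p0Poly_derivative_eval_ne_zero hz
  have h3 : (p1Poly α β).eval z = 0 := by
    rw [h.p0Poly_eval_eq] at hz
    exact (mul_eq_zero.mp hz).resolve_left hz0
  have h4 : z - 1 ≠ 0 := by
    intro h0
    have := h.p0Poly_eval_pos (x := z) (by linarith)
    linarith
  have e1 : (curveDen α β).eval z =
      -(1 / 2) * (critPoly α β).eval z * (p0Poly α β).derivative.eval z * (z - 1) := by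
    rw [curveDen_eval, upperPoly, lowerPoly]
    simp [hz, h3]; ring
  have e2 : (curveNum α β).eval z =
      -(1 / 2) * (critPoly α β).eval z * (p0Poly α β).derivative.eval z * (z + 1) := by
    rw [curveNum_eval, upperPoly, lowerPoly]
    simp [hz, h3]; ring
  have e3 : (curveDen α β).eval z ≠ 0 := by
    rw [e1]
    exact mul_ne_zero (mul_ne_zero (mul_ne_zero (by norm_num) h1) h2) h4
  refine ⟨e3, ?_⟩
  rw [curve, hz, Real.sqrt_zero, mul_zero, zero_div, Prod.mk.injEq]
  refine ⟨rfl, ?_⟩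
  rw [div_eq_div_iff e3 h4, e1, e2]; ring

/-- The origin is separate from the other branch points because `p₀/z` does not vanish there; its
value is `p₀'(0)`. -/
theorem curve_zero : (curveDen α β).eval 0 ≠ 0 ∧ curve α β 0 = (0, -1) := by
  have hz : (p0Poly α β).eval 0 = 0 := h.p0Poly_eval_eq_zero_iff.mpr h.zero_mem_simple
  have h1 := h.critPoly_eval_ne_zero hz
  have h2 := h.p0Poly_derivative_eval_ne_zero hz
  have h3 : (p0Poly α β).derivative.eval 0 = (p1Poly α β).eval 0 := by
    rw [h.p0Poly_eq_X_mul]; simp [derivative_mul]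
  have e1 : (curveDen α β).eval 0 =
      -(1 / 2) * (critPoly α β).eval 0 * (p0Poly α β).derivative.eval 0 := by
    rw [curveDen_eval, upperPoly, lowerPoly]
    simp [h3]; ring
  have e2 : (curveNum α β).eval 0 =
      (1 / 2) * (critPoly α β).eval 0 * (p0Poly α β).derivative.eval 0 := by
    rw [curveNum_eval, upperPoly, lowerPoly]
    simp [h3]; ring
  have e3 : (curveDen α β).eval 0 ≠ 0 := by
    rw [e1]
    exact mul_ne_zero (mul_ne_zero (by norm_num) h1) h2
  refine ⟨e3, ?_⟩
  rw [curve, hz, Real.sqrt_zero, mul_zero, zero_div, Prod.mk.injEq]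
  refine ⟨rfl, ?_⟩
  rw [div_eq_iff e3, e1, e2]; ring

/-- At `z = 1` the term `(z-1)^k` disappears: `p = T²` and `D = -kT`. As `T` and `q` are positive,
`√p₀ = T/q`, and this sign is why the first coordinate is `+1`. -/
theorem curve_one : curve α β 1 = (1, touchHeight α β) := by
  have hk : (0 : ℝ) < k := by exact_mod_cast h.one_le
  have hp := h.p0Poly_eval_pos one_pos
  have hq := h.qPoly_eval_pos zero_le_one
  have hT := h.trPoly_eval_pos zero_le_one
  have h1 : (p0Poly α β).eval 1 = (p1Poly α β).eval 1 := by rw [h.p0Poly_eval_eq, one_mul]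
  have hD : (derPoly α β).eval 1 = -k * (trPoly α β).eval 1 := by simp [derPoly]
  have hD' : (derPoly α β).derivative.eval 1 = (1 - k) * (trPoly α β).derivative.eval 1 := by
    simp [derPoly, derivative_mul]; ring
  have hdisc := h.discPoly_eval_eq 1
  have hdisc2 : (discPoly α β).eval 1 = (trPoly α β).eval 1 ^ 2 := by
    rw [discPoly_eval, sub_self, zero_pow (by have := h.one_le; omega)]; ring
  have hS := h.derPoly_eval_eq 1
  have hS' : (derPoly α β).derivative.eval 1 = (qPoly α β).derivative.eval 1 *
      (critPoly α β).eval 1 + (qPoly α β).eval 1 * (critPoly α β).derivative.eval 1 := by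
    rw [h.derPoly_eq_mul]; simp [derivative_mul]
  have hder : (discPoly α β).derivative.eval 1 =
      2 * (trPoly α β).eval 1 * (trPoly α β).derivative.eval 1 := by
    have hk2 : 2 * k - 1 ≠ 0 := by have := h.one_le; omega
    rw [discPoly, ← trPoly, sq (trPoly α β)]
    simp [derivative_mul, derivative_pow, hk2]
    ring
  have hder2 : (discPoly α β).derivative.eval 1 = 2 * (qPoly α β).eval 1 *
      (qPoly α β).derivative.eval 1 * (p0Poly α β).eval 1 +
        (qPoly α β).eval 1 ^ 2 * (p0Poly α β).derivative.eval 1 := by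
    rw [h.discPoly_eq_sq_mul, sq (qPoly α β)]; simp [derivative_mul]; ring
  have e1 : (curveDen α β).eval 1 = -(critPoly α β).eval 1 * (p0Poly α β).eval 1 := by
    rw [curveDen_eval, upperPoly, lowerPoly]
    simp [h1]; ring
  have e2 : (curveNum α β).eval 1 = ((critPoly α β).eval 1 +
      2 * (critPoly α β).derivative.eval 1) * (p0Poly α β).eval 1 -
        (critPoly α β).eval 1 * (p0Poly α β).derivative.eval 1 := by
    rw [curveNum_eval, upperPoly, lowerPoly]
    simp [h1]; ring
  set T := (trPoly α β).eval 1
  set q := (qPoly α β).eval 1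
  set S := (critPoly α β).eval 1
  set p := (p0Poly α β).eval 1
  have hSv : S = -(k * T) / q := by
    rw [eq_div_iff hq.ne']; linarith
  have hpv : p = (T / q) ^ 2 := by
    rw [div_pow, eq_div_iff (by positivity)]; linarith
  have hsq : √p = T / q := by
    rw [hpv, Real.sqrt_sq (by positivity)]
  have hS'v : (critPoly α β).derivative.eval 1 =
      ((1 - k) * (trPoly α β).derivative.eval 1 - (qPoly α β).derivative.eval 1 * S) / q := by
    rw [eq_div_iff hq.ne']; linarith
  have hp'v : (p0Poly α β).derivative.eval 1 = (2 * T * (trPoly α β).derivative.eval 1 -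
      2 * q * (qPoly α β).derivative.eval 1 * p) / q ^ 2 := by
    rw [eq_div_iff (by positivity)]; linarith
  rw [curve, touchHeight, ← h1, e1, e2, hsq, hdisc2, hder, hS'v, hp'v, hSv, hpv]
  refine Prod.ext ?_ ?_
  · simp only
    field_simp
  · simp only
    field_simp
    ring

/-- The symmetric form of `η - 1` and `η + 1` that the parametrization is based on. -/
theorem curve_identity (z : ℝ) :
    (z - 1) * (curveNum α β).eval z - (z + 1) * (curveDen α β).eval z =
      2 * (critPoly α β).eval z * (p0Poly α β).eval z := by
  rw [curveNum_eval, curveDen_eval, upperPoly, lowerPoly]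
  have := h.p0Poly_eval_eq z
  simp
  linear_combination (-2 * ((critPoly α β).eval z + z * (critPoly α β).derivative.eval z)) * this

end Admissible

/-! ### Counting real zeros with multiplicity -/

open scoped Classical in
/-- The number of zeros of `N` in `s`, with multiplicity. -/
def numRoots (N : ℝ[X]) (s : Set ℝ) : ℕ := N.roots.countP (· ∈ s)

theorem numRoots_X_sub_C_mul {M : ℝ[X]} (hM : M ≠ 0) {r : ℝ} {s : Set ℝ} (hr : r ∈ s) :
    numRoots ((X - C r) * M) s = numRoots M s + 1 := by
  rw [numRoots, roots_mul (mul_ne_zero (X_sub_C_ne_zero r) hM), roots_X_sub_C,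
    Multiset.singleton_add, Multiset.countP_cons, if_pos hr, numRoots]

theorem numRoots_eq_zero {N : ℝ[X]} {s : Set ℝ} (hs : ∀ r ∈ s, N.eval r ≠ 0) :
    numRoots N s = 0 := by
  classical
  rw [numRoots, Multiset.countP_eq_zero]
  exact fun r hrm hr => hs r hr (isRoot_of_mem_roots hrm)

theorem numRoots_pos {N : ℝ[X]} (hN : N ≠ 0) {s : Set ℝ} {r : ℝ} (hr : r ∈ s)
    (h0 : N.eval r = 0) : 0 < numRoots N s := by
  classical
  rw [numRoots, Multiset.countP_pos]
  exact ⟨r, (mem_roots hN).mpr h0, hr⟩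

/-- Each linear factor with zero inside the interval flips the sign of the product of end values;
once none is left, the intermediate value theorem gives equal signs. -/
theorem numRoots_parity (n : ℕ) : ∀ {N : ℝ[X]} (_ : N.natDegree = n) {a b : ℝ} (_ : a < b)
    (_ : N.eval a ≠ 0) (_ : N.eval b ≠ 0),
    0 < N.eval a * N.eval b ↔ Even (numRoots N (Ioo a b)) := by
  classical
  induction n with
  | zero =>
    intro N hN a b _ ha _
    rw [natDegree_eq_zero] at hN
    obtain ⟨c, rfl⟩ := hN
    simp only [eval_C] at ha
    simp [numRoots, ha]
  | succ n ih =>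
    intro N hN a b hab ha hb
    by_cases hr : ∃ r ∈ Ioo a b, N.eval r = 0
    · obtain ⟨r, hr, hr0⟩ := hr
      obtain ⟨M, rfl⟩ := dvd_iff_isRoot.mpr (show N.IsRoot r from hr0)
      have hM : M ≠ 0 := by rintro rfl; simp at ha
      rw [natDegree_mul (X_sub_C_ne_zero r) hM, natDegree_X_sub_C, add_comm] at hN
      simp only [eval_mul, eval_sub, eval_X, eval_C, mul_ne_zero_iff] at ha hb
      have h1 := ih (by omega) hab ha.2 hb.2
      have h2 := numRoots_X_sub_C_mul hM hr
      rw [h2, Nat.even_add_one, ← h1]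
      have h3 : (a - r) * (b - r) < 0 :=
        mul_neg_of_neg_of_pos (by linarith [hr.1]) (by linarith [hr.2])
      simp only [eval_mul, eval_sub, eval_X, eval_C]
      have h4 : (a - r) * M.eval a * ((b - r) * M.eval b) =
        (a - r) * (b - r) * (M.eval a * M.eval b) := by ring
      have h5 : M.eval a * M.eval b ≠ 0 := mul_ne_zero ha.2 hb.2
      rw [h4]
      constructor
      · intro h6 h7
        have := mul_neg_of_neg_of_pos h3 h7
        linarith
      · intro h6
        exact mul_pos_of_neg_of_neg h3 (lt_of_le_of_ne (not_lt.mp h6) h5)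
    · push Not at hr
      rw [numRoots_eq_zero hr]
      simp only [Even.zero, iff_true]
      by_contra! hcon
      have hc : ContinuousOn (fun x => N.eval x) (Icc a b) := N.continuous.continuousOn
      have hlt := lt_of_le_of_ne hcon (mul_ne_zero ha hb)
      rcases mul_neg_iff.mp hlt with ⟨h1, h2⟩ | ⟨h1, h2⟩
      · obtain ⟨r, hr1, hr2⟩ := intermediate_value_Ioo' hab.le hc ⟨h2, h1⟩
        exact hr r hr1 hr2
      · obtain ⟨r, hr1, hr2⟩ := intermediate_value_Ioo hab.le hc ⟨h1, h2⟩
        exact hr r hr1 hr2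

open scoped Classical in
theorem sum_countP_le {ι : Type*} (s : Finset ι) (P : ι → ℝ → Prop) (Q : ℝ → Prop)
    (hdisj : ∀ x, ∀ i ∈ s, ∀ j ∈ s, P i x → P j x → i = j) (hQ : ∀ i ∈ s, ∀ x, P i x → Q x)
    (m : Multiset ℝ) : ∑ i ∈ s, m.countP (P i) ≤ m.countP Q := by
  induction m using Multiset.induction with
  | empty => simp
  | cons a m ih =>
    simp only [Multiset.countP_cons, Finset.sum_add_distrib]
    refine add_le_add ih ?_
    by_cases hex : ∃ i ∈ s, P i a
    · obtain ⟨i, hi, hPi⟩ := hex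
      rw [Finset.sum_eq_single_of_mem i hi]
      · simp [hPi, hQ i hi a hPi]
      · intro j hj hji
        rw [if_neg]
        intro hPj
        exact hji (hdisj a j hj i hi hPj hPi)
    · push Not at hex
      rw [Finset.sum_eq_zero fun i hi => if_neg (hex i hi)]
      exact Nat.zero_le _

open scoped Classical in
theorem sum_count_eq_countP (F : Finset ℝ) (m : Multiset ℝ) :
    ∑ z ∈ F, m.count z = m.countP (· ∈ F) := by
  induction m using Multiset.induction with
  | empty => simp
  | cons a m ih =>
    simp only [Multiset.count_cons, Finset.sum_add_distrib, Multiset.countP_cons, ih]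
    simp

theorem sum_count_le_numRoots {N : ℝ[X]} {F : Finset ℝ} {s : Set ℝ} (hF : ∀ z ∈ F, z ∈ s) :
    ∑ z ∈ F, N.rootMultiplicity z ≤ numRoots N s := by
  classical
  simp_rw [← count_roots, sum_count_eq_countP, numRoots, Multiset.countP_eq_card_filter]
  exact Multiset.card_le_card (Multiset.monotone_filter_right _ hF)

theorem numRoots_eq_sum {N : ℝ[X]} {F : Finset ℝ} {s : Set ℝ}
    (hF : ∀ r, N.eval r = 0 → (r ∈ s ↔ r ∈ F)) :
    numRoots N s = ∑ z ∈ F, N.rootMultiplicity z := by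
  classical
  simp_rw [← count_roots, sum_count_eq_countP, numRoots]
  exact Multiset.countP_congr rfl fun r hr => propext (hF r (isRoot_of_mem_roots hr))

/-! ### The zero budget and coincidences -/

/-- The polynomial whose zeros are the finite critical points of `F`, on both sheets. -/
def countPoly (α β : Fin k → ℝ) (c : ℝ × ℝ) : ℝ[X] :=
  C ((k : ℝ) ^ 2) * (C (c.2 - 1) * X - C (c.2 + 1)) ^ 2 * p0Poly α β -
    C (4 * c.1 ^ 2) * (X * critPoly α β) ^ 2

theorem countPoly_flip (α β : Fin k → ℝ) (c : ℝ × ℝ) :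
    countPoly α β (flipChi c) = countPoly α β c := by simp [countPoly, flipChi]

theorem countPoly_eval (α β : Fin k → ℝ) (c : ℝ × ℝ) (z : ℝ) : (countPoly α β c).eval z =
    k ^ 2 * ((c.2 - 1) * z - (c.2 + 1)) ^ 2 * (p0Poly α β).eval z -
      4 * c.1 ^ 2 * (z * (critPoly α β).eval z) ^ 2 := by simp [countPoly]

namespace Admissible

variable {α β : Fin k → ℝ} (h : Admissible α β)
include h

/-- At `z = 1` one has `S² = k² p₀`, so the value is `4 k² p₀(1) (1 - χ²)`. -/
theorem countPoly_ne_zero {c : ℝ × ℝ} (hc : c.1 ^ 2 < 1) : countPoly α β c ≠ 0 := by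
  intro h0
  have h1 := countPoly_eval α β c 1
  rw [h0, eval_zero] at h1
  have hk : (0 : ℝ) < k := by exact_mod_cast h.one_le
  have hp := h.p0Poly_eval_pos one_pos
  have hq := h.qPoly_eval_pos zero_le_one
  have hD : (derPoly α β).eval 1 = -k * (trPoly α β).eval 1 := by simp [derPoly]
  have hdisc := h.discPoly_eval_eq 1
  rw [discPoly_eval, sub_self, zero_pow (by have := h.one_le; omega)] at hdisc
  have hS := h.derPoly_eval_eq 1
  rw [hD] at hS
  have h2 : (qPoly α β).eval 1 ^ 2 * (critPoly α β).eval 1 ^ 2 =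
      (qPoly α β).eval 1 ^ 2 * (k ^ 2 * (p0Poly α β).eval 1) := by
    linear_combination (k * (trPoly α β).eval 1 -
      (qPoly α β).eval 1 * (critPoly α β).eval 1) * hS + k ^ 2 * hdisc
  have h3 := mul_left_cancel₀ (by positivity) h2
  have h4 : 0 < 4 * k ^ 2 * (p0Poly α β).eval 1 * (1 - c.1 ^ 2) := by
    have : 0 < 1 - c.1 ^ 2 := by linarith
    positivity
  rw [one_mul, h3] at h1
  linarith

theorem natDegree_countPoly_le (c : ℝ × ℝ) :
    (countPoly α β c).natDegree ≤ 2 * kPrime α β + 1 := by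
  have h1 := h.one_le_kPrime
  have h2 := h.critPoly_natDegree
  refine (natDegree_sub_le _ _).trans (max_le ?_ ?_)
  · refine natDegree_mul_le.trans ?_
    have : (C ((k : ℝ) ^ 2) * (C (c.2 - 1) * X - C (c.2 + 1)) ^ 2).natDegree ≤ 2 := by
      refine (natDegree_C_mul_le _ _).trans ?_
      refine natDegree_pow_le.trans ?_
      have := natDegree_linear_le (a := c.2 - 1) (b := -(c.2 + 1))
      rw [C_neg, ← sub_eq_add_neg] at this
      omega
    omega
  · refine (natDegree_C_mul_le _ _).trans (natDegree_pow_le.trans ?_)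
    have := natDegree_mul_le (p := X) (q := critPoly α β)
    rw [natDegree_X] at this
    omega

section Count

variable {c : ℝ × ℝ} (hc0 : c.1 ≠ 0) (hc1 : c.1 ^ 2 < 1)

include hc0 in
theorem countPoly_eval_branch {z : ℝ} (hz : (p0Poly α β).eval z = 0) (hz0 : z ≠ 0) :
    (countPoly α β c).eval z < 0 := by
  have := h.critPoly_eval_ne_zero hz
  rw [countPoly_eval, hz]
  have : 0 < 4 * c.1 ^ 2 * (z * (critPoly α β).eval z) ^ 2 := by positivity
  linarith

omit h in
theorem countPoly_eval_nonneg {z : ℝ} (hz : 0 ≤ (p0Poly α β).eval z)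
    (hs : (critPoly α β).eval z = 0) : 0 ≤ (countPoly α β c).eval z := by
  rw [countPoly_eval, hs]
  have : 0 ≤ k ^ 2 * ((c.2 - 1) * z - (c.2 + 1)) ^ 2 * (p0Poly α β).eval z := by positivity
  linarith

/-- The open gap `(x_{2l}, x_{2l-1})`. -/
def _root_.PeriodicAztec.gap (α β : Fin k → ℝ) (l : ℕ) : Set ℝ :=
  Ioo (branchPt α β (2 * l)) (branchPt α β (2 * l - 1))

include hc0

theorem countPoly_gap_ends {l : ℕ} (hl1 : 1 ≤ l) (hl : l < kPrime α β) :
    (countPoly α β c).eval (branchPt α β (2 * l)) < 0 ∧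
      (countPoly α β c).eval (branchPt α β (2 * l - 1)) < 0 := by
  have hi := h.gap_index hl1 hl
  exact ⟨h.countPoly_eval_branch hc0 (h.p0Poly_eval_branchPt hi.1)
    (h.branchPt_neg (by omega) hi.1).ne, h.countPoly_eval_branch hc0 (h.p0Poly_eval_branchPt hi.2)
    (h.branchPt_neg (by omega) hi.2).ne⟩

include hc1

/-- `N` is negative at both ends, so the number of zeros is even, and nonnegative at a zero of `S`,
so it is not zero. -/
theorem numRoots_gap {l : ℕ} (hl1 : 1 ≤ l) (hl : l < kPrime α β) :
    Even (numRoots (countPoly α β c) (gap α β l)) ∧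
      2 ≤ numRoots (countPoly α β c) (gap α β l) := by
  classical
  obtain ⟨e1, e2⟩ := h.countPoly_gap_ends hc0 hl1 hl
  have hev := (numRoots_parity _ rfl (h.gap_lt hl1 hl) e1.ne e2.ne).mp (mul_pos_of_neg_of_neg e1 e2)
  refine ⟨hev, ?_⟩
  obtain ⟨s, hs, hs0⟩ := h.exists_critPoly_zero hl1 hl
  have h1 := countPoly_eval_nonneg (c := c) (h.p0Poly_eval_pos_of_gap hl1 hl hs).le hs0
  have hcont : ContinuousOn (fun x => (countPoly α β c).eval x)
      (Icc (branchPt α β (2 * l)) s) := (countPoly α β c).continuous.continuousOn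
  obtain ⟨r, hr1, hr2⟩ := intermediate_value_Icc hs.1.le hcont ⟨e1.le, h1⟩
  have hr3 : r ∈ gap α β l := by
    refine ⟨lt_of_le_of_ne hr1.1 ?_, hr1.2.trans_lt hs.2⟩
    rintro rfl
    simp only at hr2
    linarith
  have hpos := numRoots_pos (h.countPoly_ne_zero hc1) hr3 hr2
  change Even (numRoots (countPoly α β c) (gap α β l)) at hev
  obtain ⟨m, hm⟩ := hev
  omega

omit hc0 in
-- The zero at the origin uses up one of the at most `2k' + 1` zeros; the gaps are disjoint and
-- negative, so they compete with `(0, ∞)` for the remaining `2k'`.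
theorem sum_numRoots_le :
    ∑ l ∈ Finset.Ico 1 (kPrime α β), numRoots (countPoly α β c) (gap α β l) +
      numRoots (countPoly α β c) (Ioi 0) ≤ 2 * kPrime α β := by
  classical
  have hne := h.countPoly_ne_zero hc1
  have h1 := (card_roots' (countPoly α β c)).trans (h.natDegree_countPoly_le c)
  have h0 : 1 ≤ (countPoly α β c).roots.countP (fun x => x = 0) := by
    rw [Nat.one_le_iff_ne_zero, ← Nat.pos_iff_ne_zero, Multiset.countP_pos]
    refine ⟨0, (mem_roots hne).mpr ?_, rfl⟩
    rw [IsRoot.def, countPoly_eval, h.p0Poly_eval_eq]; ring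
  have h2 : ∑ l ∈ Finset.Ico 1 (kPrime α β), numRoots (countPoly α β c) (gap α β l) ≤
      (countPoly α β c).roots.countP (fun x => x < 0) := by
    refine sum_countP_le _ (fun l x => x ∈ gap α β l) _ ?_ ?_ _
    · intro x i hi j hj hxi hxj
      rw [Finset.mem_Ico] at hi hj
      by_contra hne
      wlog hij : i < j generalizing i j
      · exact this j hj i hi hxj hxi (Ne.symm hne) (by omega)
      -- For `i < j` one has `2i ≤ 2j - 1`, so the right end of gap `j` is not to the right of the
      -- left end of gap `i`.
      have h3 := h.branchPt_le (i := 2 * i) (j := 2 * j - 1) (by omega)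
        (h.gap_index hj.1 hj.2).2
      have h4 := hxi.1
      have h5 := hxj.2
      linarith
    · intro l hl x hx
      rw [Finset.mem_Ico] at hl
      exact hx.2.trans (h.gap_neg hl.1 hl.2)
  have h3 : ∀ m : Multiset ℝ, m.countP (fun x => x < 0) + m.countP (fun x => x = 0) +
      m.countP (fun x => x ∈ Ioi 0) = Multiset.card m := by
    intro m
    induction m using Multiset.induction with
    | empty => simp
    | cons a m ih =>
      simp only [Multiset.countP_cons, Multiset.card_cons, ← ih]
      rcases lt_trichotomy a 0 with h4 | h4 | h4
      · simp [h4, h4.ne, h4.not_gt]; ring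
      · simp [h4]; ring
      · simp [h4, h4.ne', h4.not_gt]; ring
  have h4 := h3 (countPoly α β c).roots
  change _ + (countPoly α β c).roots.countP (fun x => x ∈ Ioi 0) ≤ _
  omega

/-- The `k' - 1` gaps claim at least two each of the `2k'` zeros. The next two bounds leave out one
or two gaps from the same count. -/
theorem numRoots_pos_le : numRoots (countPoly α β c) (Ioi 0) ≤ 2 := by
  have h1 := h.sum_numRoots_le hc1
  have h2 := Finset.card_nsmul_le_sum (Finset.Ico 1 (kPrime α β))
    (fun l => numRoots (countPoly α β c) (gap α β l)) 2 fun l hl => by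
      rw [Finset.mem_Ico] at hl; exact (h.numRoots_gap hc0 hc1 hl.1 hl.2).2
  rw [Nat.card_Ico, smul_eq_mul] at h2
  have := h.one_le_kPrime.1
  omega

theorem numRoots_gap_add_pos_le {l : ℕ} (hl1 : 1 ≤ l) (hl : l < kPrime α β) :
    numRoots (countPoly α β c) (gap α β l) + numRoots (countPoly α β c) (Ioi 0) ≤ 4 := by
  have h1 := h.sum_numRoots_le hc1
  have hmem : l ∈ Finset.Ico 1 (kPrime α β) := Finset.mem_Ico.mpr ⟨hl1, hl⟩
  have h2 := Finset.card_nsmul_le_sum ((Finset.Ico 1 (kPrime α β)).erase l)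
    (fun l => numRoots (countPoly α β c) (gap α β l)) 2 fun l hl => by
      have hl := Finset.mem_Ico.mp (Finset.mem_of_mem_erase hl)
      exact (h.numRoots_gap hc0 hc1 hl.1 hl.2).2
  rw [Finset.card_erase_of_mem hmem, Nat.card_Ico, smul_eq_mul] at h2
  rw [← Finset.add_sum_erase _ _ hmem] at h1
  omega

theorem numRoots_gap_add_gap_le {l l' : ℕ} (hl1 : 1 ≤ l) (hl : l < kPrime α β) (hl1' : 1 ≤ l')
    (hl' : l' < kPrime α β) (hne : l ≠ l') :
    numRoots (countPoly α β c) (gap α β l) + numRoots (countPoly α β c) (gap α β l') ≤ 6 := by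
  have h1 := h.sum_numRoots_le hc1
  have hmem : l ∈ Finset.Ico 1 (kPrime α β) := Finset.mem_Ico.mpr ⟨hl1, hl⟩
  have hmem' : l' ∈ (Finset.Ico 1 (kPrime α β)).erase l :=
    Finset.mem_erase.mpr ⟨hne.symm, Finset.mem_Ico.mpr ⟨hl1', hl'⟩⟩
  have h2 := Finset.card_nsmul_le_sum (((Finset.Ico 1 (kPrime α β)).erase l).erase l')
    (fun l => numRoots (countPoly α β c) (gap α β l)) 2 fun l hl => by
      have hl := Finset.mem_Ico.mp (Finset.mem_of_mem_erase (Finset.mem_of_mem_erase hl))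
      exact (h.numRoots_gap hc0 hc1 hl.1 hl.2).2
  rw [Finset.card_erase_of_mem hmem', Finset.card_erase_of_mem hmem, Nat.card_Ico,
    smul_eq_mul] at h2
  rw [← Finset.add_sum_erase _ _ hmem, ← Finset.add_sum_erase _ _ hmem'] at h1
  omega

end Count

section Double

variable {z : ℝ} (hz : 0 < (p0Poly α β).eval z) (hz1 : z ≠ 1)
include hz

theorem countPoly_curve_data :
    let c := curve α β z
    ((c.2 - 1) * z - (c.2 + 1)) * (curveDen α β).eval z =
        2 * (critPoly α β).eval z * (p0Poly α β).eval z ∧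
      (c.2 - 1) * (curveDen α β).eval z = 2 * (lowerPoly α β).eval z ∧
      c.1 ^ 2 * (curveDen α β).eval z ^ 2 =
        k ^ 2 * (p1Poly α β).eval z ^ 2 * (p0Poly α β).eval z := by
  have hV := h.curveDen_ne_zero hz
  have h1 : (curve α β z).2 * (curveDen α β).eval z = (curveNum α β).eval z :=
    div_mul_cancel₀ _ hV
  have h2 : (curve α β z).1 * (curveDen α β).eval z =
      k * (p1Poly α β).eval z * √((p0Poly α β).eval z) := div_mul_cancel₀ _ hV
  have h3 := Real.sq_sqrt hz.le
  have h4 := h.curve_identity z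
  have h5 := curveNum_eval (α := α) (β := β) z
  have h6 := curveDen_eval (α := α) (β := β) z
  refine ⟨?_, ?_, ?_⟩
  · linear_combination h4 + (z - 1) * h1
  · linear_combination h1 + h5 - h6
  · rw [← mul_pow, h2]
    linear_combination k ^ 2 * (p1Poly α β).eval z ^ 2 * h3

/-- Only `χ²` enters, so no choice of square root of `p₀` matters. A zero of `S` raises the order
because both squares in `N` then vanish at `z`, and their second derivatives turn out to cancel. -/
theorem countPoly_curve_eval : (countPoly α β (curve α β z)).eval z = 0 ∧
    (countPoly α β (curve α β z)).derivative.eval z = 0 ∧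
    ((critPoly α β).eval z = 0 →
      (countPoly α β (curve α β z)).derivative.derivative.eval z = 0) := by
  obtain ⟨h1, h2, h3⟩ := h.countPoly_curve_data hz
  have hV := h.curveDen_ne_zero hz
  have hp := h.p0Poly_eval_eq z
  have hA : (lowerPoly α β).eval z = ((critPoly α β).eval z + z * (critPoly α β).derivative.eval z) *
      (p1Poly α β).eval z - 1 / 2 * (critPoly α β).eval z * (p0Poly α β).derivative.eval z := by
    simp [lowerPoly]
  set c := curve α β z
  set V := (curveDen α β).eval z
  set a := (c.2 - 1) * z - (c.2 + 1)
  set S := (critPoly α β).eval z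
  set S' := (critPoly α β).derivative.eval z
  set p := (p0Poly α β).eval z
  set p' := (p0Poly α β).derivative.eval z
  set p1 := (p1Poly α β).eval z
  refine ⟨?_, ?_, fun hS => ?_⟩
  · refine (mul_eq_zero.mp (?_ : V ^ 2 * (countPoly α β c).eval z = 0)).resolve_left
      (pow_ne_zero 2 hV)
    rw [countPoly_eval]
    linear_combination k ^ 2 * p * (a * V + 2 * S * p) * h1 - 4 * z ^ 2 * S ^ 2 * h3 +
      4 * k ^ 2 * p * S ^ 2 * (p + z * p1) * hp
  · have e : (countPoly α β c).derivative.eval z = k ^ 2 * (2 * a * (c.2 - 1) * p + a ^ 2 * p') -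
        8 * c.1 ^ 2 * (z * S) * (S + z * S') := by
      rw [countPoly, sq (C (c.2 - 1) * X - C (c.2 + 1)), sq (X * critPoly α β)]
      simp only [derivative_sub, derivative_mul, derivative_C, derivative_X, zero_mul, zero_add,
        eval_sub, eval_mul, eval_add, eval_C, eval_X, mul_one, sub_zero, one_mul, a]
      ring
    refine (mul_eq_zero.mp (?_ : V ^ 2 * (countPoly α β c).derivative.eval z = 0)).resolve_left
      (pow_ne_zero 2 hV)
    rw [e]
    have e2 : V ^ 2 * (k ^ 2 * (2 * a * (c.2 - 1) * p + a ^ 2 * p') -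
        8 * c.1 ^ 2 * (z * S) * (S + z * S')) =
        k ^ 2 * (2 * (a * V) * ((c.2 - 1) * V) * p + (a * V) ^ 2 * p') -
        8 * (c.1 ^ 2 * V ^ 2) * (z * S) * (S + z * S') := by ring
    rw [e2, h1, h2, h3, hA, hp]
    ring
  -- With `S = 0` the linear factor vanishes too, so `N''` is a difference of two squared first
  -- derivatives, equal because `A = z S' p₀/z` in this case.
  · have ha : a = 0 := by
      rw [hS] at h1
      have : a * V = 0 := by linarith
      exact (mul_eq_zero.mp this).resolve_right hV
    have e : (countPoly α β c).derivative.derivative.eval z = 2 * k ^ 2 * (c.2 - 1) ^ 2 * p -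
        8 * c.1 ^ 2 * (z * S') ^ 2 := by
      rw [countPoly, sq (C (c.2 - 1) * X - C (c.2 + 1)), sq (X * critPoly α β)]
      simp only [derivative_sub, derivative_mul, derivative_C, derivative_X, zero_mul, zero_add,
        derivative_add,
        eval_sub, eval_mul, eval_add, eval_C, eval_X, mul_one, sub_zero, one_mul, mul_zero,
        add_zero]
      have ha' : (c.2 - 1) * z - (c.2 + 1) = 0 := ha
      have hS' : eval z (critPoly α β) = 0 := hS
      rw [ha', hS']
      ring
    refine (mul_eq_zero.mp
      (?_ : V ^ 2 * (countPoly α β c).derivative.derivative.eval z = 0)).resolve_left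
      (pow_ne_zero 2 hV)
    rw [e]
    have e2 : V ^ 2 * (2 * k ^ 2 * (c.2 - 1) ^ 2 * p - 8 * c.1 ^ 2 * (z * S') ^ 2) =
        2 * k ^ 2 * ((c.2 - 1) * V) ^ 2 * p - 8 * (c.1 ^ 2 * V ^ 2) * (z * S') ^ 2 := by ring
    rw [e2, h2, h3, hA, hS]
    ring

include hz1 in
theorem two_le_rootMultiplicity_countPoly {c : ℝ × ℝ}
    (hc : c = curve α β z ∨ c = flipChi (curve α β z)) :
    2 ≤ (countPoly α β c).rootMultiplicity z ∧
      ((critPoly α β).eval z = 0 → 3 ≤ (countPoly α β c).rootMultiplicity z) := by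
  have e : countPoly α β c = countPoly α β (curve α β z) := by
    rcases hc with rfl | rfl
    · rfl
    · exact countPoly_flip _ _ _
  have hne := h.countPoly_ne_zero (h.curve_fst_sq_lt hz hz1)
  obtain ⟨h1, h2, h3⟩ := h.countPoly_curve_eval hz
  rw [e]
  constructor
  · exact (one_lt_rootMultiplicity_iff_isRoot hne).mpr ⟨h1, h2⟩
  · intro hS
    refine (lt_rootMultiplicity_iff_isRoot_iterate_derivative hne).mpr fun m hm => ?_
    interval_cases m
    · exact h1
    · exact h2
    · exact h3 hS

end Double

section Coincidence

variable {c : ℝ × ℝ} (hc0 : c.1 ≠ 0) (hc1 : c.1 ^ 2 < 1)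
include hc0 hc1

/-- Multiplicities give at least `2 |F|`. In case of equality all zeros in the gap lie in `F` and
are exactly double, so `N` never changes sign from the left end to a zero `s` of `S`. But `N` is
negative at the end and positive at `s`. -/
theorem two_mul_card_lt_numRoots {l : ℕ} (hl1 : 1 ≤ l) (hl : l < kPrime α β) (F : Finset ℝ)
    (hF : ∀ z ∈ F, z ∈ gap α β l ∧ (c = curve α β z ∨ c = flipChi (curve α β z))) :
    2 * F.card < numRoots (countPoly α β c) (gap α β l) := by
  classical
  by_contra! hcon
  have hne := h.countPoly_ne_zero hc1
  have hmul : ∀ z ∈ F, 2 ≤ (countPoly α β c).rootMultiplicity z ∧ ((critPoly α β).eval z = 0 →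
      3 ≤ (countPoly α β c).rootMultiplicity z) := by
    intro z hz
    obtain ⟨h1, h2⟩ := hF z hz
    have h3 : z < 0 := h1.2.trans (h.gap_neg hl1 hl)
    exact h.two_le_rootMultiplicity_countPoly (h.p0Poly_eval_pos_of_gap hl1 hl h1) (by linarith) h2
  have hsum := sum_count_le_numRoots (N := countPoly α β c) (F := F) fun z hz => (hF z hz).1
  have hconst : ∑ _z ∈ F, 2 = 2 * F.card := by rw [Finset.sum_const, smul_eq_mul, mul_comm]
  have hle : ∑ _z ∈ F, 2 ≤ ∑ z ∈ F, (countPoly α β c).rootMultiplicity z :=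
    Finset.sum_le_sum fun z hz => (hmul z hz).1
  have heq : ∑ _z ∈ F, 2 = ∑ z ∈ F, (countPoly α β c).rootMultiplicity z := by omega
  have hmult : ∀ z ∈ F, 2 = (countPoly α β c).rootMultiplicity z :=
    (Finset.sum_eq_sum_iff_of_le fun z hz => (hmul z hz).1).mp heq
  have hall : ∀ r ∈ gap α β l, (countPoly α β c).eval r = 0 → r ∈ F := by
    intro r hr hr0
    by_contra hrF
    have h1 := sum_count_le_numRoots (N := countPoly α β c) (F := insert r F)
      (s := gap α β l) fun z hz => by
        rcases Finset.mem_insert.mp hz with rfl | hz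
        · exact hr
        · exact (hF z hz).1
    rw [Finset.sum_insert hrF] at h1
    have h2 : 0 < (countPoly α β c).rootMultiplicity r := (rootMultiplicity_pos hne).mpr hr0
    omega
  obtain ⟨s, hs, hs0⟩ := h.exists_critPoly_zero hl1 hl
  have hsn := countPoly_eval_nonneg (c := c) (h.p0Poly_eval_pos_of_gap hl1 hl hs).le hs0
  -- A zero of `N` at `s` would belong to `F` and be exactly double, whereas `S(s) = 0` forces
  -- multiplicity three.
  have hs1 : (countPoly α β c).eval s ≠ 0 := by
    intro h0
    have h1 := hall s hs h0
    have h2 := (hmul s h1).2 hs0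
    have h3 := hmult s h1
    omega
  have hend := (h.countPoly_gap_ends hc0 hl1 hl).1
  have hpar := numRoots_parity _ rfl hs.1 hend.ne hs1
  have hev : Even (numRoots (countPoly α β c) (Ioo (branchPt α β (2 * l)) s)) := by
    have h1 := numRoots_eq_sum (N := countPoly α β c) (F := F.filter (· < s))
      (s := Ioo (branchPt α β (2 * l)) s) fun r hr0 => by
        rw [Finset.mem_filter]
        exact ⟨fun h2 => ⟨hall r ⟨h2.1, h2.2.trans hs.2⟩ hr0, h2.2⟩,
          fun h2 => ⟨(hF r h2.1).1.1, h2.2⟩⟩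
    rw [h1, ← Finset.sum_congr rfl fun z hz => hmult z (Finset.mem_filter.mp hz).1]
    rw [Finset.sum_const, smul_eq_mul]
    exact even_two.mul_left _
  have h1 := hpar.mpr hev
  have h2 := mul_nonpos_of_nonpos_of_nonneg hend.le hsn
  linarith

theorem four_le_numRoots_gap {l : ℕ} (hl1 : 1 ≤ l) (hl : l < kPrime α β) {z : ℝ}
    (hz : z ∈ gap α β l) (hc : c = curve α β z ∨ c = flipChi (curve α β z)) :
    4 ≤ numRoots (countPoly α β c) (gap α β l) := by
  have h1 := h.two_mul_card_lt_numRoots hc0 hc1 hl1 hl {z} fun w hw => by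
    rw [Finset.mem_singleton] at hw; subst hw; exact ⟨hz, hc⟩
  rw [Finset.card_singleton] at h1
  obtain ⟨m, hm⟩ := (h.numRoots_gap hc0 hc1 hl1 hl).1
  omega

/-- Two distinct parameters would put more than four zeros into the gap, above the budget for one
gap together with `(0, ∞)`. -/
theorem eq_of_curve_gap {l : ℕ} (hl1 : 1 ≤ l) (hl : l < kPrime α β) {z w : ℝ}
    (hz : z ∈ gap α β l) (hw : w ∈ gap α β l) (hcz : c = curve α β z ∨ c = flipChi (curve α β z))
    (hcw : c = curve α β w ∨ c = flipChi (curve α β w)) : z = w := by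
  by_contra hne
  have h1 := h.two_mul_card_lt_numRoots hc0 hc1 hl1 hl {z, w} fun x hx => by
    rcases Finset.mem_insert.mp hx with rfl | hx
    · exact ⟨hz, hcz⟩
    · rw [Finset.mem_singleton] at hx; subst hx; exact ⟨hw, hcw⟩
  rw [Finset.card_pair hne] at h1
  have h2 := h.numRoots_gap_add_pos_le hc0 hc1 hl1 hl
  omega

omit hc0 hc1 in
theorem two_le_numRoots_pos {z : ℝ} (hz : 0 < z) (hz1 : z ≠ 1)
    (hc : c = curve α β z ∨ c = flipChi (curve α β z)) :
    2 ≤ numRoots (countPoly α β c) (Ioi 0) := by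
  have h1 := sum_count_le_numRoots (N := countPoly α β c) (F := {z}) (s := Ioi 0) fun w hw => by
    rw [Finset.mem_singleton] at hw; subst hw; exact hz
  rw [Finset.sum_singleton] at h1
  exact ((h.two_le_rootMultiplicity_countPoly (h.p0Poly_eval_pos hz) hz1 hc).1).trans h1

theorem eq_of_curve_pos {z w : ℝ} (hz : 0 < z) (hz1 : z ≠ 1) (hw : 0 < w) (hw1 : w ≠ 1)
    (hcz : c = curve α β z ∨ c = flipChi (curve α β z))
    (hcw : c = curve α β w ∨ c = flipChi (curve α β w)) : z = w := by
  by_contra hne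
  have h1 := sum_count_le_numRoots (N := countPoly α β c) (F := {z, w}) (s := Ioi 0) fun x hx => by
    rcases Finset.mem_insert.mp hx with rfl | hx
    · exact hz
    · rw [Finset.mem_singleton] at hx; subst hx; exact hw
  rw [Finset.sum_pair hne] at h1
  have h2 := (h.two_le_rootMultiplicity_countPoly (h.p0Poly_eval_pos hz) hz1 hcz).1
  have h3 := (h.two_le_rootMultiplicity_countPoly (h.p0Poly_eval_pos hw) hw1 hcw).1
  have h4 := h.numRoots_pos_le hc0 hc1
  omega

/-- This is why critical points over `(0, ∞)` have order exactly two, as the definition of the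
frozen-rough boundary demands. -/
theorem rootMultiplicity_le_of_pos {z : ℝ} (hz : 0 < z) :
    (countPoly α β c).rootMultiplicity z ≤ 2 := by
  have h1 := sum_count_le_numRoots (N := countPoly α β c) (F := {z}) (s := Ioi 0) fun w hw => by
    rw [Finset.mem_singleton] at hw; subst hw; exact hz
  rw [Finset.sum_singleton] at h1
  exact h1.trans (h.numRoots_pos_le hc0 hc1)

end Coincidence

end Admissible

/-! ### The derivative of `F` on the surface -/

/-- `4 z (z - 1) w` times the derivative of `F` with respect to `z`. -/
def critFun (α β : Fin k → ℝ) (χ η : ℝ) (z w : ℂ) : ℂ :=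
  k * ((η - 1) * z - (η + 1)) * w - 2 * χ * (z * aeval z (critPoly α β))

theorem aeval_ofReal (P : ℝ[X]) (x : ℝ) : aeval (x : ℂ) P = ((P.eval x : ℝ) : ℂ) :=
  aeval_algebraMap_apply_eq_algebraMap_eval (A := ℂ) x P

theorem deriv_of_sq_eq {P : ℝ[X]} {Z W : ℂ → ℂ} {t Z' W' : ℂ} (hZ : HasDerivAt Z Z' t)
    (hW : HasDerivAt W W' t) (heq : ∀ᶠ s in 𝓝 t, W s ^ 2 = aeval (Z s) P) :
    2 * W t * W' = aeval (Z t) P.derivative * Z' := by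
  have h1 : HasDerivAt (fun s => W s ^ 2) (2 * W t * W') t := by
    simpa using hW.fun_pow 2
  have h2 : HasDerivAt (fun s => aeval (Z s) P) (aeval (Z t) P.derivative * Z') t :=
    (P.hasDerivAt_aeval (Z t)).comp t hZ
  exact h1.unique (h2.congr_of_eventuallyEq heq)

namespace Admissible

variable {α β : Fin k → ℝ} (h : Admissible α β)
include h

theorem trace_Phi {z : ℂ} (h0 : z ≠ 0) (h1 : z ≠ 1) :
    (Phi α β z).trace = aeval z (trPoly α β) / (z - 1) ^ k := by
  have h2 := congrArg Matrix.trace (map_phiPoly α β h0 h1 (fun m => (h.pos_left m).ne')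
    (fun m => (h.pos_right m).ne'))
  rw [Matrix.trace_smul, smul_eq_mul] at h2
  rw [eq_div_iff (pow_ne_zero _ (sub_ne_zero.mpr h1)), mul_comm, ← h2, trPoly,
    Matrix.trace_fin_two, Matrix.trace_fin_two, map_add]
  rfl

theorem rho_eq {z : ℂ} (w : ℂ) (h0 : z ≠ 0) (h1 : z ≠ 1) :
    rho α β z w = (aeval z (trPoly α β) + aeval z (qPoly α β) * w) / (2 * (z - 1) ^ k) := by
  have h2 : (z - 1) ^ k ≠ 0 := pow_ne_zero _ (sub_ne_zero.mpr h1)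
  rw [rho, h.trace_Phi h0 h1]
  field_simp

/-- The formula `d log ρ = S dz/((z-1) w)` along an arbitrary pair `(Z, W)` on the surface, so that
it serves both local coordinates and the branch `sqrtP0`. -/
theorem logDeriv_rho {Z W : ℂ → ℂ} {t Z' W' : ℂ} (hZ : HasDerivAt Z Z' t)
    (hW : HasDerivAt W W' t) (heq : ∀ᶠ s in 𝓝 t, W s ^ 2 = aeval (Z s) (p0Poly α β))
    (h0 : Z t ≠ 0) (h1 : Z t ≠ 1) (hw : W t ≠ 0) :
    rho α β (Z t) (W t) ≠ 0 ∧ HasDerivAt (fun s => rho α β (Z s) (W s))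
      (rho α β (Z t) (W t) * (aeval (Z t) (critPoly α β) * Z' / ((Z t - 1) * W t))) t := by
  have hk := h.one_le
  have hz1 : Z t - 1 ≠ 0 := sub_ne_zero.mpr h1
  have hWW := deriv_of_sq_eq hZ hW heq
  have hev : ∀ᶠ s in 𝓝 t, rho α β (Z s) (W s) =
      (aeval (Z s) (trPoly α β) + aeval (Z s) (qPoly α β) * W s) / (2 * (Z s - 1) ^ k) := by
    filter_upwards [hZ.continuousAt.eventually_ne h0, hZ.continuousAt.eventually_ne h1]
      with s hs0 hs1 using h.rho_eq _ hs0 hs1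
  have hT := ((trPoly α β).hasDerivAt_aeval (Z t)).comp t hZ
  have hq := ((qPoly α β).hasDerivAt_aeval (Z t)).comp t hZ
  have hden : (2 * (Z t - 1) ^ k) ≠ 0 := mul_ne_zero two_ne_zero (pow_ne_zero _ hz1)
  have hder := ((hT.add (hq.mul hW)).div (((hZ.sub_const 1).pow k).const_mul 2) hden)
  have hw2 := heq.self_of_nhds
  have hdisc : aeval (Z t) (trPoly α β) ^ 2 - 4 * (Z t - 1) ^ (2 * k) =
      aeval (Z t) (qPoly α β) ^ 2 * aeval (Z t) (p0Poly α β) := by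
    have := congrArg (aeval (Z t)) h.discPoly_eq_sq_mul
    rw [discPoly, ← trPoly] at this
    simpa [map_ofNat (aeval (Z t)) 4] using this
  have hid := congrArg (aeval (Z t)) h.spectral_identity
  have hD := congrArg (aeval (Z t)) h.derPoly_eq_mul
  rw [derPoly] at hD
  simp only [map_sub, map_mul, map_add, aeval_X, map_one, aeval_C, map_ofNat,
    Complex.coe_algebraMap, Complex.ofReal_natCast] at hid hD
  set z := Z t
  set w := W t
  set T := aeval z (trPoly α β)
  set q := aeval z (qPoly α β)
  set S := aeval z (critPoly α β)
  set p := aeval z (p0Poly α β)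
  -- The product with the other sheet, `(T + q w)(T - q w) = 4 (z-1)^{2k}`, is nonzero: `ρ` has no
  -- zeros away from the special points.
  have hy : T + q * w ≠ 0 := by
    intro hy
    have : (4 : ℂ) * (z - 1) ^ (2 * k) = 0 := by
      linear_combination (T - q * w) * hy + q ^ 2 * hw2 - hdisc
    exact mul_ne_zero (by norm_num) (pow_ne_zero _ hz1) this
  have hrho : rho α β z w = (T + q * w) / (2 * (z - 1) ^ k) := h.rho_eq _ h0 h1
  refine ⟨by rw [hrho]; exact div_ne_zero hy hden, ?_⟩
  refine (hder.congr_of_eventuallyEq hev).congr_deriv ?_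
  rw [hrho]
  simp only [Pi.add_apply, Pi.mul_apply, Function.comp_apply, Pi.pow_apply]
  have key : ((aeval z (trPoly α β).derivative + aeval z (qPoly α β).derivative * w) * (2 * w) +
      q * aeval z (p0Poly α β).derivative) * (z - 1) - 2 * k * (T + q * w) * w =
      2 * S * (T + q * w) := by
    linear_combination 2 * w * hD + hid +
      (2 * (z - 1) * aeval z (qPoly α β).derivative - 2 * k * q) * hw2
  have hW' : W' = aeval z (p0Poly α β).derivative * Z' / (2 * w) := by
    rw [eq_div_iff (mul_ne_zero two_ne_zero hw)]; linear_combination hWW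
  rw [hW']
  have hpow : (z - 1) ^ k = (z - 1) ^ (k - 1) * (z - 1) := by
    rw [← pow_succ]; congr 1; omega
  have hpn : (z - 1) ^ (k - 1) ≠ 0 := pow_ne_zero _ hz1
  change ((aeval z (trPoly α β).derivative * Z' + (aeval z (qPoly α β).derivative * Z' * w +
    q * (aeval z (p0Poly α β).derivative * Z' / (2 * w)))) * (2 * (z - 1) ^ k) -
    (T + q * w) * (2 * (k * (z - 1) ^ (k - 1) * Z'))) / (2 * (z - 1) ^ k) ^ 2 = _
  rw [hpow]
  field_simp
  linear_combination Z' * key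

theorem derivF_eq {Z W : ℂ → ℂ} {t : ℂ} (χ η : ℝ) (hZ : DifferentiableAt ℂ Z t)
    (hW : DifferentiableAt ℂ W t) (heq : ∀ᶠ s in 𝓝 t, W s ^ 2 = aeval (Z s) (p0Poly α β))
    (h0 : Z t ≠ 0) (h1 : Z t ≠ 1) (hw : W t ≠ 0) : derivF α β χ η Z W t =
      deriv Z t * critFun α β χ η (Z t) (W t) / (4 * Z t * (Z t - 1) * W t) := by
  obtain ⟨hr0, hr⟩ := h.logDeriv_rho hZ.hasDerivAt hW.hasDerivAt heq h0 h1 hw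
  have hz1 : Z t - 1 ≠ 0 := sub_ne_zero.mpr h1
  have e : logDeriv (fun s => rho α β (Z s) (W s)) t =
      aeval (Z t) (critPoly α β) * deriv Z t / ((Z t - 1) * W t) := by
    rw [logDeriv_apply, hr.deriv, mul_div_cancel_left₀ _ hr0]
  have e2 : logDeriv (fun s => Z s - 1) t = deriv Z t / (Z t - 1) := by
    rw [logDeriv_apply, deriv_sub_const]
  rw [derivF, e, e2, logDeriv_apply, critFun]
  field_simp
  ring

/-- The order sees only a punctured neighbourhood, where a nonconstant `Z` avoids `0`, `1` and the
branch points, so the explicit formula applies even at the special points. -/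
theorem order_derivF {Z W : ℂ → ℂ} (χ η : ℝ) (hZ : MeromorphicAt Z 0) (hW : MeromorphicAt W 0)
    (heq : ∀ᶠ t in 𝓝[≠] (0 : ℂ), W t ^ 2 = aeval (Z t) (p0Poly α β))
    (hne : ∀ c : ℂ, ∀ᶠ t in 𝓝[≠] (0 : ℂ), Z t ≠ c) :
    meromorphicOrderAt (derivF α β χ η Z W) 0 = meromorphicOrderAt (fun t =>
      deriv Z t * critFun α β χ η (Z t) (W t) / (4 * Z t * (Z t - 1) * W t)) 0 := by
  refine meromorphicOrderAt_congr ?_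
  have h1 : ∀ᶠ t in 𝓝[≠] (0 : ℂ), ∀ j ∈ Finset.range (p0Poly α β).natDegree,
      Z t ≠ (branchPt α β j : ℂ) := by
    rw [Filter.eventually_all_finset]
    exact fun j _ => hne _
  filter_upwards [h1, hne 0, hne 1, heq, eventually_eventually_nhdsWithin.mpr heq,
    hZ.eventually_analyticAt, hW.eventually_analyticAt, self_mem_nhdsWithin]
    with t ht1 ht2 ht3 ht4 ht5 ht6 ht7 ht8
  rw [(isOpen_compl_singleton.nhdsWithin_eq ht8)] at ht5
  refine h.derivF_eq χ η ht6.differentiableAt ht7.differentiableAt ht5 ht2 ht3 fun hw => ?_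
  rw [hw, zero_pow two_ne_zero] at ht4
  obtain ⟨j, hj, hj2⟩ := h.p0Poly_aeval_eq_zero_iff.mp ht4.symm
  exact ht1 j (Finset.mem_range.mpr hj) hj2

end Admissible

/-! ### Orders at regular points, branch points, `0`, `1` and infinity -/

theorem order_of_ne_zero {f : ℂ → ℂ} (hf : AnalyticAt ℂ f 0) (h0 : f 0 ≠ 0) :
    meromorphicOrderAt f 0 = ((0 : ℤ) : WithTop ℤ) := by
  rw [hf.meromorphicOrderAt_eq, hf.analyticOrderAt_eq_zero.mpr h0]; rfl

theorem order_of_deriv_ne_zero {f : ℂ → ℂ} (hf : AnalyticAt ℂ f 0) (h0 : f 0 = 0)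
    (h1 : deriv f 0 ≠ 0) : meromorphicOrderAt f 0 = ((1 : ℤ) : WithTop ℤ) := by
  rw [hf.meromorphicOrderAt_eq, hf.analyticOrderAt_eq_one_of_zero_deriv_ne_zero h0 h1]; rfl

/-- If `Z` were equal to `d` near the point, `Z - c` would be constant and have order `0` or `⊤`. -/
theorem eventually_ne_of_order {Z : ℂ → ℂ} (c : ℂ) {n : ℤ}
    (hn : meromorphicOrderAt (fun t => Z t - c) 0 = (n : WithTop ℤ))
    (hZ : MeromorphicAt Z 0) (d : ℂ) (hn0 : n ≠ 0) :
    ∀ᶠ t in 𝓝[≠] (0 : ℂ), Z t ≠ d := by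
  have hm : MeromorphicAt (fun t => Z t - d) 0 := hZ.sub (MeromorphicAt.const d 0)
  have hm' : MeromorphicAt (fun t => Z t - c) 0 := hZ.sub (MeromorphicAt.const c 0)
  rcases hm.eventually_eq_zero_or_eventually_ne_zero with h1 | h1
  · exfalso
    have h2 : (fun t => Z t - c) =ᶠ[𝓝[≠] 0] fun _ => d - c := by
      filter_upwards [h1] with t ht
      rw [← sub_eq_zero.mp ht]
    rw [meromorphicOrderAt_congr h2] at hn
    classical
    rw [meromorphicOrderAt_const] at hn
    split_ifs at hn with h3
    · exact WithTop.top_ne_coe hn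
    · exact hn0 (by exact_mod_cast hn.symm)
  · filter_upwards [h1] with t ht using sub_ne_zero.mp ht

theorem analyticAt_critFun (α β : Fin k → ℝ) (χ η : ℝ) {Z W : ℂ → ℂ} (hZ : AnalyticAt ℂ Z 0)
    (hW : AnalyticAt ℂ W 0) : AnalyticAt ℂ (fun t => critFun α β χ η (Z t) (W t)) 0 := by
  have := hZ.aeval_polynomial (critPoly α β)
  unfold critFun
  fun_prop

theorem deriv_critFun (α β : Fin k → ℝ) (χ η : ℝ) {Z W : ℂ → ℂ} {t Z' W' : ℂ}
    (hZ : HasDerivAt Z Z' t) (hW : HasDerivAt W W' t) :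
    HasDerivAt (fun t => critFun α β χ η (Z t) (W t))
      (k * ((η - 1) * Z') * W t + k * ((η - 1) * Z t - (η + 1)) * W' -
        2 * χ * (Z' * aeval (Z t) (critPoly α β) +
          Z t * (aeval (Z t) (critPoly α β).derivative * Z'))) t := by
  have h1 := ((critPoly α β).hasDerivAt_aeval (Z t)).comp t hZ
  exact ((((hZ.const_mul ((η : ℂ) - 1)).sub_const ((η : ℂ) + 1)).const_mul (k : ℂ)).mul hW).sub
    ((hZ.mul h1).const_mul (2 * (χ : ℂ)))

section Orders

variable {α β : Fin k → ℝ} (h : Admissible α β) {Z W : ℂ → ℂ} (χ η : ℝ)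
include h

omit h in
theorem regular_param (hZ : AnalyticAt ℂ Z 0) (hW : AnalyticAt ℂ W 0)
    (hd : deriv Z 0 ≠ 0 ∨ deriv W 0 ≠ 0)
    (heq : ∀ᶠ t in 𝓝 (0 : ℂ), W t ^ 2 = aeval (Z t) (p0Poly α β)) (hw : W 0 ≠ 0) :
    deriv Z 0 ≠ 0 := by
  intro hZ'
  have := deriv_of_sq_eq hZ.differentiableAt.hasDerivAt hW.differentiableAt.hasDerivAt heq
  rw [hZ', mul_zero] at this
  rcases hd with h1 | h1
  · exact h1 hZ'
  · exact mul_ne_zero (mul_ne_zero two_ne_zero hw) h1 this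

theorem order_derivF_regular (hZ : AnalyticAt ℂ Z 0) (hW : AnalyticAt ℂ W 0)
    (hd : deriv Z 0 ≠ 0 ∨ deriv W 0 ≠ 0)
    (heq : ∀ᶠ t in 𝓝 (0 : ℂ), W t ^ 2 = aeval (Z t) (p0Poly α β)) (hw : W 0 ≠ 0)
    (h0 : Z 0 ≠ 0) (h1 : Z 0 ≠ 1) :
    meromorphicOrderAt (derivF α β χ η Z W) 0 =
      meromorphicOrderAt (fun t => critFun α β χ η (Z t) (W t)) 0 := by
  have hZ' := regular_param hZ hW hd heq hw
  have hord : meromorphicOrderAt (fun t => Z t - Z 0) 0 = ((1 : ℤ) : WithTop ℤ) :=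
    order_of_deriv_ne_zero (by fun_prop) (sub_self _) (by rwa [deriv_sub_const])
  rw [h.order_derivF χ η hZ.meromorphicAt hW.meromorphicAt (heq.filter_mono nhdsWithin_le_nhds)
    fun c => eventually_ne_of_order (Z 0) hord hZ.meromorphicAt c one_ne_zero]
  have hz1 : Z 0 - 1 ≠ 0 := sub_ne_zero.mpr h1
  have hden : 4 * Z 0 * (Z 0 - 1) * W 0 ≠ 0 := by
    refine mul_ne_zero (mul_ne_zero (mul_ne_zero ?_ h0) hz1) hw; norm_num
  have hg : AnalyticAt ℂ (fun t => deriv Z t / (4 * Z t * (Z t - 1) * W t)) 0 := by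
    have := hZ.deriv
    fun_prop (disch := assumption)
  have := meromorphicOrderAt_mul_of_ne_zero (f := fun t => critFun α β χ η (Z t) (W t)) hg
    (div_ne_zero hZ' hden)
  rw [← this]
  congr 1
  ext t
  simp only [Pi.mul_apply]
  ring

/-- The factor `z - 1` in the denominator is not cancelled, so `dF` has a simple pole. -/
theorem order_derivF_one (hZ : AnalyticAt ℂ Z 0) (hW : AnalyticAt ℂ W 0)
    (hd : deriv Z 0 ≠ 0 ∨ deriv W 0 ≠ 0)
    (heq : ∀ᶠ t in 𝓝 (0 : ℂ), W t ^ 2 = aeval (Z t) (p0Poly α β)) (hw : W 0 ≠ 0)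
    (h1 : Z 0 = 1) (hK : critFun α β χ η (Z 0) (W 0) ≠ 0) :
    meromorphicOrderAt (derivF α β χ η Z W) 0 = ((-1 : ℤ) : WithTop ℤ) := by
  have hZ' := regular_param hZ hW hd heq hw
  have hord : meromorphicOrderAt (fun t => Z t - 1) 0 = ((1 : ℤ) : WithTop ℤ) :=
    order_of_deriv_ne_zero (by fun_prop) (by simp [h1]) (by rwa [deriv_sub_const])
  rw [h.order_derivF χ η hZ.meromorphicAt hW.meromorphicAt (heq.filter_mono nhdsWithin_le_nhds)
    fun c => eventually_ne_of_order 1 hord hZ.meromorphicAt c one_ne_zero]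
  have hden : 4 * Z 0 * W 0 ≠ 0 := by
    rw [h1]; refine mul_ne_zero ?_ hw; norm_num
  have hKa := analyticAt_critFun α β χ η hZ hW
  have hg : AnalyticAt ℂ (fun t => deriv Z t * critFun α β χ η (Z t) (W t) /
      (4 * Z t * W t)) 0 := by
    have := hZ.deriv
    fun_prop (disch := assumption)
  have h2 := order_of_ne_zero hg (div_ne_zero (mul_ne_zero hZ' hK) hden)
  have h3 := meromorphicOrderAt_div hg.meromorphicAt
    (show MeromorphicAt (fun t => Z t - 1) 0 by fun_prop)
  rw [h2, hord] at h3
  have h4 : ((fun t => deriv Z t * critFun α β χ η (Z t) (W t) / (4 * Z t * W t)) /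
      fun t => Z t - 1) = fun t => deriv Z t * critFun α β χ η (Z t) (W t) /
        (4 * Z t * (Z t - 1) * W t) := by
    ext t
    simp only [Pi.div_apply, div_div]
    congr 1; ring
  rw [← h4, h3]
  rfl

/-- Orders at a branch point `x`. -/
theorem branch_param {x : ℝ} (hx : (p0Poly α β).eval x = 0) (hZ : AnalyticAt ℂ Z 0)
    (hW : AnalyticAt ℂ W 0) (hZ0 : Z 0 = x)
    (hd : deriv Z 0 ≠ 0 ∨ deriv W 0 ≠ 0)
    (heq : ∀ᶠ t in 𝓝 (0 : ℂ), W t ^ 2 = aeval (Z t) (p0Poly α β)) :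
    W 0 = 0 ∧ deriv W 0 ≠ 0 ∧ deriv Z 0 = 0 ∧
      meromorphicOrderAt W 0 = ((1 : ℤ) : WithTop ℤ) ∧
      meromorphicOrderAt (fun t => Z t - x) 0 = ((2 : ℤ) : WithTop ℤ) ∧
      meromorphicOrderAt (deriv Z) 0 = ((1 : ℤ) : WithTop ℤ) := by
  have hW0 : W 0 = 0 := by
    have := heq.self_of_nhds
    rw [hZ0, aeval_ofReal, hx] at this
    simpa using this
  have hZ' : deriv Z 0 = 0 := by
    have := deriv_of_sq_eq hZ.differentiableAt.hasDerivAt hW.differentiableAt.hasDerivAt heq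
    rw [hW0, mul_zero, zero_mul, hZ0, aeval_ofReal] at this
    refine (mul_eq_zero.mp this.symm).resolve_left ?_
    exact_mod_cast h.p0Poly_derivative_eval_ne_zero hx
  have hW' : deriv W 0 ≠ 0 := hd.resolve_left (not_not.mpr hZ')
  have o1 := order_of_deriv_ne_zero hW hW0 hW'
  obtain ⟨P, hP⟩ := dvd_iff_isRoot.mpr (show (p0Poly α β).IsRoot x from hx)
  have hPx : aeval (Z 0) P ≠ 0 := by
    rw [hZ0, aeval_ofReal]
    have := h.p0Poly_derivative_eval_ne_zero hx
    rw [hP] at this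
    simp [derivative_mul] at this
    exact_mod_cast this
  have hPa : AnalyticAt ℂ (fun t => aeval (Z t) P) 0 := hZ.aeval_polynomial P
  have hZx : AnalyticAt ℂ (fun t => Z t - x) 0 := by fun_prop
  have o2 := order_of_ne_zero hPa hPx
  have o3 : meromorphicOrderAt (fun t => Z t - x) 0 = ((2 : ℤ) : WithTop ℤ) := by
    have e1 : meromorphicOrderAt ((fun t => Z t - x) * fun t => aeval (Z t) P) 0 =
        meromorphicOrderAt (W * W) 0 := by
      refine meromorphicOrderAt_congr ?_
      filter_upwards [heq.filter_mono nhdsWithin_le_nhds] with t ht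
      rw [Pi.mul_apply, Pi.mul_apply, ← sq, ht, hP]
      simp
    rw [meromorphicOrderAt_mul hZx.meromorphicAt hPa.meromorphicAt,
      meromorphicOrderAt_mul hW.meromorphicAt hW.meromorphicAt, o1, o2] at e1
    have e2 : meromorphicOrderAt (fun t => Z t - x) 0 + ((0 : ℤ) : WithTop ℤ) =
      meromorphicOrderAt (fun t => Z t - x) 0 := add_zero _
    rw [e2] at e1
    rw [e1]; rfl
  refine ⟨hW0, hW', hZ', o1, o3, ?_⟩
  have := meromorphicOrderAt_deriv_eq_sub_one (f := fun t => Z t - x) (x := 0) (n := 2)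
    (by norm_num) o3
  have e : deriv (fun t => Z t - (x : ℂ)) = deriv Z := by ext t; rw [deriv_sub_const]
  rw [e] at this
  rw [this]; rfl

/-- The simple zero of `Z'` cancels the simple zero of `W` in the denominator. -/
theorem order_derivF_branch {x : ℝ} (hx : (p0Poly α β).eval x = 0) (hx0 : x ≠ 0)
    (hZ : AnalyticAt ℂ Z 0)
    (hW : AnalyticAt ℂ W 0) (hZ0 : Z 0 = x)
    (hd : deriv Z 0 ≠ 0 ∨ deriv W 0 ≠ 0)
    (heq : ∀ᶠ t in 𝓝 (0 : ℂ), W t ^ 2 = aeval (Z t) (p0Poly α β)) :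
    meromorphicOrderAt (derivF α β χ η Z W) 0 =
      meromorphicOrderAt (fun t => critFun α β χ η (Z t) (W t)) 0 := by
  obtain ⟨hW0, hW', hZ', o1, o2, o3⟩ := branch_param h hx hZ hW hZ0 hd heq
  have hx1 : x ≠ 1 := by
    rintro rfl
    have := h.p0Poly_eval_pos one_pos
    linarith
  rw [h.order_derivF χ η hZ.meromorphicAt hW.meromorphicAt (heq.filter_mono nhdsWithin_le_nhds)
    fun c => eventually_ne_of_order x o2 hZ.meromorphicAt c two_ne_zero]
  have hg : AnalyticAt ℂ (fun t => 4 * Z t * (Z t - 1)) 0 := by fun_prop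
  have hg0 : 4 * Z 0 * (Z 0 - 1) ≠ 0 := by
    rw [hZ0]
    have h1 : (x : ℂ) ≠ 0 := by exact_mod_cast hx0
    have h2 : (x : ℂ) - 1 ≠ 0 := sub_ne_zero.mpr (by exact_mod_cast hx1)
    exact mul_ne_zero (mul_ne_zero (by norm_num) h1) h2
  have hKa := analyticAt_critFun α β χ η hZ hW
  have e := meromorphicOrderAt_div (hZ.deriv.meromorphicAt.mul hKa.meromorphicAt)
    (hg.meromorphicAt.mul hW.meromorphicAt)
  rw [meromorphicOrderAt_mul hZ.deriv.meromorphicAt hKa.meromorphicAt,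
    meromorphicOrderAt_mul hg.meromorphicAt hW.meromorphicAt, o1, o3,
    order_of_ne_zero hg hg0] at e
  refine Eq.trans e ?_
  cases meromorphicOrderAt (fun t => critFun α β χ η (Z t) (W t)) 0 with
  | top => rfl
  | coe n => norm_cast; ring

/-- Here `Z'`, `K` and `W` vanish to order one and `Z` to order two: `1 + 1 - 2 - 1 = -1`. The order
of `K` is one because `η + 1 ≠ 0`. -/
theorem order_derivF_zero (hη : η ≠ -1) (hZ : AnalyticAt ℂ Z 0)
    (hW : AnalyticAt ℂ W 0) (hZ0 : Z 0 = 0)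
    (hd : deriv Z 0 ≠ 0 ∨ deriv W 0 ≠ 0)
    (heq : ∀ᶠ t in 𝓝 (0 : ℂ), W t ^ 2 = aeval (Z t) (p0Poly α β)) :
    meromorphicOrderAt (derivF α β χ η Z W) 0 = ((-1 : ℤ) : WithTop ℤ) := by
  obtain ⟨hW0, hW', hZ', o1, o2, o3⟩ := branch_param h (x := 0)
    (h.p0Poly_eval_eq_zero_iff.mpr h.zero_mem_simple) hZ hW (by simpa using hZ0) hd heq
  have hk : (k : ℂ) ≠ 0 := by exact_mod_cast (by have := h.one_le; omega : k ≠ 0)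
  rw [h.order_derivF χ η hZ.meromorphicAt hW.meromorphicAt (heq.filter_mono nhdsWithin_le_nhds)
    fun c => eventually_ne_of_order _ o2 hZ.meromorphicAt c two_ne_zero]
  simp only [Complex.ofReal_zero, sub_zero] at o2
  have hg : AnalyticAt ℂ (fun t => 4 * (Z t - 1)) 0 := by fun_prop
  have hg0 : 4 * (Z 0 - 1) ≠ 0 := by rw [hZ0]; norm_num
  have hKa := analyticAt_critFun α β χ η hZ hW
  have o4 : meromorphicOrderAt (fun t => critFun α β χ η (Z t) (W t)) 0 =
      ((1 : ℤ) : WithTop ℤ) := by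
    refine order_of_deriv_ne_zero hKa (by simp [critFun, hZ0, hW0]) ?_
    rw [(deriv_critFun α β χ η hZ.differentiableAt.hasDerivAt
      hW.differentiableAt.hasDerivAt).deriv, hZ', hZ0, hW0]
    have : (η : ℂ) + 1 ≠ 0 := by
      intro h0
      apply hη
      have : (η : ℂ) = ((-1 : ℝ) : ℂ) := by push_cast; linear_combination h0
      exact_mod_cast this
    have h5 : -1 + -(η : ℂ) ≠ 0 := by
      intro h0
      apply this
      linear_combination -h0
    simp [hk, h5, hW']
  have e := meromorphicOrderAt_div (hZ.deriv.meromorphicAt.mul hKa.meromorphicAt)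
    ((hg.meromorphicAt.mul hZ.meromorphicAt).mul hW.meromorphicAt)
  rw [meromorphicOrderAt_mul hZ.deriv.meromorphicAt hKa.meromorphicAt,
    meromorphicOrderAt_mul (hg.meromorphicAt.mul hZ.meromorphicAt) hW.meromorphicAt,
    meromorphicOrderAt_mul hg.meromorphicAt hZ.meromorphicAt, o1, o3, o4,
    order_of_ne_zero hg hg0, o2] at e
  refine Eq.trans ?_ (e.trans rfl)
  congr 1
  ext t
  simp only [Pi.mul_apply, Pi.div_apply]
  congr 1; ring

omit h in
theorem order_aeval_of_pole {P : ℝ[X]} (hP : P ≠ 0) (hZ : MeromorphicAt Z 0)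
    (ho : meromorphicOrderAt Z 0 = ((-2 : ℤ) : WithTop ℤ)) :
    MeromorphicAt (fun t => aeval (Z t) P) 0 ∧
    meromorphicOrderAt (fun t => aeval (Z t) P) 0 = ((-2 * P.natDegree : ℤ) : WithTop ℤ) := by
  have hlin : ∀ a : ℂ, MeromorphicAt (fun t => Z t - a) 0 ∧
      meromorphicOrderAt (fun t => Z t - a) 0 = ((-2 : ℤ) : WithTop ℤ) := by
    intro a
    refine ⟨hZ.sub (MeromorphicAt.const a 0), ?_⟩
    have h1 : meromorphicOrderAt Z 0 < meromorphicOrderAt (fun _ : ℂ => -a) 0 := by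
      rw [ho]
      exact lt_of_lt_of_le (by exact_mod_cast (by norm_num : (-2 : ℤ) < 0))
        (analyticAt_const.meromorphicOrderAt_nonneg)
    have h2 := meromorphicOrderAt_add_eq_left_of_lt (MeromorphicAt.const (-a) 0) h1
    rw [ho] at h2
    rw [← h2]
    congr 1
  have hprod : ∀ m : Multiset ℂ, MeromorphicAt (fun t => (m.map fun a => Z t - a).prod) 0 ∧
      meromorphicOrderAt (fun t => (m.map fun a => Z t - a).prod) 0 =
        ((-2 * Multiset.card m : ℤ) : WithTop ℤ) := by
    intro m
    induction m using Multiset.induction with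
    | empty =>
      simp only [Multiset.map_zero, Multiset.prod_zero, Multiset.card_zero]
      exact ⟨MeromorphicAt.const 1 0, order_of_ne_zero analyticAt_const one_ne_zero⟩
    | cons a m ih =>
      simp only [Multiset.map_cons, Multiset.prod_cons, Multiset.card_cons]
      refine ⟨(hlin a).1.mul ih.1, ?_⟩
      refine (meromorphicOrderAt_mul (hlin a).1 ih.1).trans ?_
      rw [(hlin a).2, ih.2]
      norm_cast
      push_cast; ring
  have hs : (P.map (algebraMap ℝ ℂ)).Splits := IsAlgClosed.splits _
  have e : (fun t => aeval (Z t) P) = (fun _ => (P.leadingCoeff : ℂ)) *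
      fun t => ((P.map (algebraMap ℝ ℂ)).roots.map fun a => Z t - a).prod := by
    ext t
    rw [Pi.mul_apply, ← eval_map_algebraMap, hs.eval_eq_prod_roots, leadingCoeff_map]
    rfl
  have hcard : Multiset.card (P.map (algebraMap ℝ ℂ)).roots = P.natDegree := by
    rw [← hs.natDegree_eq_card_roots, natDegree_map]
  have hl : (P.leadingCoeff : ℂ) ≠ 0 := by exact_mod_cast leadingCoeff_ne_zero.mpr hP
  rw [e]
  refine ⟨(MeromorphicAt.const _ 0).mul (hprod _).1, ?_⟩
  rw [meromorphicOrderAt_mul (MeromorphicAt.const _ 0) (hprod _).1, (hprod _).2, hcard,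
    order_of_ne_zero analyticAt_const hl]
  norm_cast
  rw [zero_add]

/-- With `s = deg S` the function `w` has a pole of order `2s + 1`. As `η ≠ 1`, the first term of
`K` has order `-(2s + 3)` and dominates the second, of order at least `-(2s + 2)`. The total is `-3
- (2s + 3) + 2 + 2 + (2s + 1) = -1`. -/
theorem order_derivF_infty (hη : η ≠ 1) (hZ : MeromorphicAt Z 0) (hW : MeromorphicAt W 0)
    (ho : meromorphicOrderAt Z 0 = -2)
    (heq : ∀ᶠ t in 𝓝[≠] (0 : ℂ), W t ^ 2 = aeval (Z t) (p0Poly α β)) :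
    meromorphicOrderAt (derivF α β χ η Z W) 0 = ((-1 : ℤ) : WithTop ℤ) := by
  have ho' : meromorphicOrderAt Z 0 = ((-2 : ℤ) : WithTop ℤ) := ho
  have hk : (k : ℂ) ≠ 0 := by exact_mod_cast (by have := h.one_le; omega : k ≠ 0)
  rw [h.order_derivF χ η hZ hW heq fun c => eventually_ne_of_order (n := -2) 0
    (by simpa using ho') hZ c (by norm_num)]
  obtain ⟨mp, op⟩ := order_aeval_of_pole h.p0Poly_ne_zero hZ ho'
  obtain ⟨mS, oS⟩ := order_aeval_of_pole h.critPoly_ne_zero hZ ho'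
  obtain ⟨mL, oL⟩ := order_aeval_of_pole (P := C (k * (η - 1)) * X + C (-(k * (η + 1)))) (by
    intro h0
    have h1 := congrArg (fun P => P.coeff 1) h0
    simp only [coeff_add, coeff_C_mul, coeff_X_one, coeff_C, one_ne_zero, if_false,
      coeff_zero, mul_one, add_zero] at h1
    have h2 : (k : ℝ) ≠ 0 := by exact_mod_cast hk
    exact hη (by linarith [(mul_eq_zero.mp h1).resolve_left h2])) hZ ho'
  obtain ⟨m1, o1⟩ := order_aeval_of_pole (P := (X - 1 : ℝ[X]))
    (by rw [← C_1]; exact X_sub_C_ne_zero 1) hZ ho'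
  rw [natDegree_linear (mul_ne_zero (by exact_mod_cast hk) (sub_ne_zero.mpr hη))] at oL
  rw [← C_1, natDegree_X_sub_C] at o1
  simp only [map_sub, aeval_X, map_one, map_add, map_mul, aeval_C, Complex.coe_algebraMap,
    Complex.ofReal_mul, Complex.ofReal_natCast, Complex.ofReal_one,
    Complex.ofReal_neg, Complex.ofReal_add] at oL o1 mL m1
  have hdeg : (p0Poly α β).natDegree = 2 * (critPoly α β).natDegree + 1 := by
    have := h.one_le_kPrime
    have := h.critPoly_natDegree
    omega
  set s : ℕ := (critPoly α β).natDegree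
  have oW : meromorphicOrderAt W 0 = ((-(2 * s + 1) : ℤ) : WithTop ℤ) := by
    have e1 : meromorphicOrderAt (W * W) 0 = ((-2 * (p0Poly α β).natDegree : ℤ) : WithTop ℤ) := by
      rw [← op]
      refine meromorphicOrderAt_congr ?_
      filter_upwards [heq] with t ht
      rw [Pi.mul_apply, ← sq, ht]
    rw [meromorphicOrderAt_mul hW hW, hdeg] at e1
    cases hn : meromorphicOrderAt W 0 with
    | top => rw [hn] at e1; exact absurd e1 WithTop.top_ne_coe
    | coe n =>
      rw [hn] at e1
      norm_cast at e1 ⊢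
      push_cast at e1 ⊢
      omega
  have oZ' : meromorphicOrderAt (deriv Z) 0 = ((-3 : ℤ) : WithTop ℤ) := by
    rw [meromorphicOrderAt_deriv_eq_sub_one (n := -2) (by norm_num) ho']; rfl
  have mLW := mL.mul hW
  have mZS := hZ.mul mS
  have oLW := meromorphicOrderAt_mul mL hW
  have oZS := meromorphicOrderAt_mul hZ mS
  rw [oL, oW] at oLW
  rw [ho', oS] at oZS
  have mcZS := (MeromorphicAt.const (-(2 * (χ : ℂ))) 0).mul mZS
  have ocZS := meromorphicOrderAt_mul (MeromorphicAt.const (-(2 * (χ : ℂ))) 0) mZS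
  have hlt := lt_of_lt_of_le (b := meromorphicOrderAt (Z * fun t => aeval (Z t) (critPoly α β)) 0)
    (a := ((-(2 * s + 1) - 2 : ℤ) : WithTop ℤ))
    (c := meromorphicOrderAt ((fun _ => (-(2 * (χ : ℂ)))) *
      (Z * fun t => aeval (Z t) (critPoly α β))) 0) (by
        rw [oZS]; norm_cast; omega) (by
        rw [ocZS]
        exact le_add_of_nonneg_left analyticAt_const.meromorphicOrderAt_nonneg)
  have e3 : ((-2 * ((1 : ℕ) : ℤ) : ℤ) : WithTop ℤ) + ((-(2 * s + 1) : ℤ) : WithTop ℤ) =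
      ((-(2 * s + 1) - 2 : ℤ) : WithTop ℤ) := by
    norm_cast; push_cast; ring
  rw [e3] at oLW
  have oK := meromorphicOrderAt_add_eq_left_of_lt mcZS (by rw [oLW]; exact hlt)
  rw [oLW] at oK
  have mK := mLW.add mcZS
  have e := meromorphicOrderAt_div (hZ.deriv.mul mK)
    ((((MeromorphicAt.const (4 : ℂ) 0).mul hZ).mul m1).mul hW)
  rw [meromorphicOrderAt_mul hZ.deriv mK,
    meromorphicOrderAt_mul (((MeromorphicAt.const (4 : ℂ) 0).mul hZ).mul m1) hW,
    meromorphicOrderAt_mul ((MeromorphicAt.const (4 : ℂ) 0).mul hZ) m1,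
    meromorphicOrderAt_mul (MeromorphicAt.const (4 : ℂ) 0) hZ, oZ', oK, ho', o1, oW,
    order_of_ne_zero analyticAt_const (by norm_num : (4 : ℂ) ≠ 0)] at e
  refine Eq.trans ?_ (e.trans ?_)
  · congr 1
    ext t
    simp only [Pi.mul_apply, Pi.div_apply, Pi.add_apply, critFun]
    congr 2; ring
  · norm_cast
    push_cast; ring

end Orders

/-! ### Double zeros of `K` and local parametrizations -/

theorem two_le_order_iff {f : ℂ → ℂ} (hf : AnalyticAt ℂ f 0) :
    ((2 : ℤ) : WithTop ℤ) ≤ meromorphicOrderAt f 0 ↔ f 0 = 0 ∧ deriv f 0 = 0 := by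
  have h1 := natCast_le_analyticOrderAt_iff_iteratedDeriv_eq_zero (n := 2) hf
  have h2 : (∀ i < 2, iteratedDeriv i f 0 = 0) ↔ f 0 = 0 ∧ deriv f 0 = 0 := by
    constructor
    · intro h
      exact ⟨by simpa using h 0 (by norm_num), by simpa using h 1 (by norm_num)⟩
    · rintro ⟨h3, h4⟩ i hi
      interval_cases i
      · simpa using h3
      · simpa using h4
  rw [← h2, ← h1, hf.meromorphicOrderAt_eq]
  cases analyticOrderAt f 0 with
  | top => simp
  | coe n =>
    simp only [ENat.map_natCast]
    norm_cast

theorem exists_analytic_sqrt {f : ℂ → ℂ} (hf : AnalyticAt ℂ f 0) (h0 : f 0 = 1) :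
    ∃ g : ℂ → ℂ, AnalyticAt ℂ g 0 ∧ g 0 = 1 ∧ ∀ t, g t ^ 2 = f t := by
  refine ⟨fun t => f t ^ (((2 : ℕ) : ℂ)⁻¹), ?_, ?_, fun t =>
    Complex.cpow_nat_inv_pow _ two_ne_zero⟩
  · exact hf.cpow analyticAt_const (by rw [h0]; exact Complex.one_mem_slitPlane)
  · simp only [h0, Complex.one_cpow]

namespace Admissible

variable {α β : Fin k → ℝ} (h : Admissible α β)
include h

/-- The left side is `K = 0` and `w dK/dz = 0`. It is equivalent to `k(η-1) w p₁ = 2χ A` and `k(η+1)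
w p₁ = 2χ x B` with `p₁ = p₀/x`. Their difference determines `χ`, and their sum, divided by `χ ≠ 0`,
determines `η`. -/
theorem double_zero_iff {x w χ η : ℝ} (hz : 0 < (p0Poly α β).eval x)
    (hw : w ^ 2 = (p0Poly α β).eval x) :
    (k * ((η - 1) * x - (η + 1)) * w - 2 * χ * (x * (critPoly α β).eval x) = 0 ∧
      k * (η - 1) * (p0Poly α β).eval x + k * ((η - 1) * x - (η + 1)) *
        (p0Poly α β).derivative.eval x / 2 - 2 * χ * w * ((critPoly α β).eval x +
          x * (critPoly α β).derivative.eval x) = 0) ↔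
    χ * (curveDen α β).eval x = k * (p1Poly α β).eval x * w ∧
      η * (curveDen α β).eval x = (curveNum α β).eval x := by
  have hk : (k : ℝ) ≠ 0 := by exact_mod_cast (by have := h.one_le; omega : k ≠ 0)
  have hV := h.curveDen_ne_zero hz
  have hx := h.ne_zero_of_p0Poly_pos hz
  have hp := h.p0Poly_eval_eq x
  have hw0 : w ≠ 0 := by rintro rfl; rw [← hw] at hz; simp at hz
  have hp1 : (p1Poly α β).eval x ≠ 0 := by
    intro h0; rw [hp, h0, mul_zero] at hz; exact lt_irrefl _ hz
  have hA : (lowerPoly α β).eval x = ((critPoly α β).eval x +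
      x * (critPoly α β).derivative.eval x) * (p1Poly α β).eval x -
        1 / 2 * (critPoly α β).eval x * (p0Poly α β).derivative.eval x := by
    simp [lowerPoly]
  have hB : (upperPoly α β).eval x = (critPoly α β).derivative.eval x * (p0Poly α β).eval x -
        1 / 2 * (critPoly α β).eval x * (p0Poly α β).derivative.eval x := by
    simp [upperPoly]
  have hV1 := curveDen_eval (α := α) (β := β) x
  have hU1 := curveNum_eval (α := α) (β := β) x
  generalize (curveDen α β).eval x = V at *
  generalize (curveNum α β).eval x = U at *
  generalize (lowerPoly α β).eval x = A at *
  generalize (upperPoly α β).eval x = B at *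
  generalize (critPoly α β).eval x = S at *
  generalize (critPoly α β).derivative.eval x = S' at *
  generalize (p0Poly α β).derivative.eval x = p' at *
  generalize (p0Poly α β).eval x = p at *
  generalize (p1Poly α β).eval x = p1 at *
  subst hp
  constructor
  · rintro ⟨e1, e2⟩
    have a1 : k * ((η - 1) * x - (η + 1)) * p1 = 2 * χ * w * S := by
      apply mul_left_cancel₀ hx
      linear_combination w * e1 - k * ((η - 1) * x - (η + 1)) * hw
    have a2 : k * (η - 1) * w * p1 = 2 * χ * A := by
      apply mul_left_cancel₀ hw0
      linear_combination p1 * e2 - p' / 2 * a1 - 2 * χ * w * hA + k * (η - 1) * p1 * hw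
    have a3 : k * (η + 1) * w * p1 = 2 * χ * (x * B) := by
      linear_combination x * a2 - w * a1 - 2 * χ * S * hw + 2 * χ * (x * hA - x * hB)
    have b1 : χ * V = k * p1 * w := by
      linear_combination χ * hV1 + (a2 - a3) / 2
    refine ⟨b1, ?_⟩
    have hχ : χ ≠ 0 := by
      rintro rfl
      rw [zero_mul] at b1
      exact mul_ne_zero (mul_ne_zero hk hp1) hw0 b1.symm
    apply mul_left_cancel₀ hχ
    linear_combination η * b1 - χ * hU1 + (a2 + a3) / 2
  · rintro ⟨b1, b2⟩
    have c1 : k * (η - 1) * w * p1 = 2 * χ * A := by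
      apply mul_left_cancel₀ hV
      linear_combination k * w * p1 * b2 - 2 * A * b1 + k * w * p1 * (hU1 - hV1)
    have c2 : k * (η + 1) * w * p1 = 2 * χ * (x * B) := by
      apply mul_left_cancel₀ hV
      linear_combination k * w * p1 * b2 - 2 * (x * B) * b1 + k * w * p1 * (hU1 + hV1)
    have a1 : k * ((η - 1) * x - (η + 1)) * p1 = 2 * χ * w * S := by
      apply mul_left_cancel₀ hw0
      linear_combination x * c1 - c2 - 2 * χ * S * hw + 2 * χ * (x * hA - x * hB)
    constructor
    · apply mul_left_cancel₀ hw0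
      linear_combination x * a1 + k * ((η - 1) * x - (η + 1)) * hw
    · apply mul_left_cancel₀ hp1
      linear_combination w * c1 + p' / 2 * a1 + 2 * χ * w * hA - k * (η - 1) * p1 * hw

theorem double_zero_iff_curve {x χ η : ℝ} (hz : 0 < (p0Poly α β).eval x) :
    (∃ w : ℝ, w ^ 2 = (p0Poly α β).eval x ∧ χ * (curveDen α β).eval x =
      k * (p1Poly α β).eval x * w ∧ η * (curveDen α β).eval x = (curveNum α β).eval x) ↔
    (χ, η) = curve α β x ∨ (χ, η) = flipChi (curve α β x) := by
  have hV := h.curveDen_ne_zero hz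
  have hs := Real.sq_sqrt hz.le
  simp only [curve, flipChi, Prod.mk.injEq, eq_div_iff hV, ← neg_div]
  constructor
  · rintro ⟨w, hw, h1, h2⟩
    rw [← hs, sq_eq_sq_iff_eq_or_eq_neg] at hw
    rcases hw with rfl | rfl
    · exact Or.inl ⟨h1, h2⟩
    · exact Or.inr ⟨by rw [h1]; ring, h2⟩
  · rintro (⟨h1, h2⟩ | ⟨h1, h2⟩)
    · exact ⟨_, hs, h1, h2⟩
    · exact ⟨-√((p0Poly α β).eval x), by rw [neg_sq, hs], by rw [h1]; ring, h2⟩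

/-- A local parameter near a regular point hits a zero of order `≥ 2` exactly on the curve. -/
theorem two_le_order_critFun_iff {x w : ℝ} (χ η : ℝ) (hz : 0 < (p0Poly α β).eval x)
    (hw : w ^ 2 = (p0Poly α β).eval x) {Z W : ℂ → ℂ} (hZ : AnalyticAt ℂ Z 0)
    (hW : AnalyticAt ℂ W 0) (hZ0 : Z 0 = x) (hW0 : W 0 = w) (hZ' : deriv Z 0 ≠ 0)
    (heq : ∀ᶠ t in 𝓝 (0 : ℂ), W t ^ 2 = aeval (Z t) (p0Poly α β)) :
    ((2 : ℤ) : WithTop ℤ) ≤ meromorphicOrderAt (fun t => critFun α β χ η (Z t) (W t)) 0 ↔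
      χ * (curveDen α β).eval x = k * (p1Poly α β).eval x * w ∧
      η * (curveDen α β).eval x = (curveNum α β).eval x := by
  have hw0 : (w : ℂ) ≠ 0 := by
    intro h0
    have : w = 0 := by exact_mod_cast h0
    rw [this] at hw; rw [← hw] at hz; simp at hz
  rw [two_le_order_iff (analyticAt_critFun α β χ η hZ hW), ← h.double_zero_iff hz hw,
    (deriv_critFun α β χ η hZ.differentiableAt.hasDerivAt hW.differentiableAt.hasDerivAt).deriv]
  have hd := deriv_of_sq_eq hZ.differentiableAt.hasDerivAt hW.differentiableAt.hasDerivAt heq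
  have hwc : (w : ℂ) ^ 2 = (((p0Poly α β).eval x : ℝ) : ℂ) := by rw [← hw]; push_cast; rfl
  rw [critFun]
  rw [hZ0, hW0] at hd ⊢
  simp only [aeval_ofReal] at hd ⊢
  refine and_congr ?_ ?_
  · rw [← Complex.ofReal_inj]; push_cast; rfl
  · rw [← Complex.ofReal_inj, ← (mul_left_injective₀ hw0).eq_iff, ← (mul_right_injective₀ hZ').eq_iff
      (b := ((0 : ℝ) : ℂ))]
    push_cast
    rw [mul_zero, zero_mul]
    constructor <;> intro e
    · linear_combination e - k * ((η - 1) * x - (η + 1)) / 2 * hd -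
        deriv Z 0 * k * (η - 1) * hwc
    · linear_combination e + k * ((η - 1) * x - (η + 1)) / 2 * hd +
        deriv Z 0 * k * (η - 1) * hwc

omit h in
-- Changing the sign of `χ` amounts to changing the sheet, up to a sign: the product of `K` for `χ`
-- and `-χ` is `N` composed with `Z`. Its order is the multiplicity of `x`, and both factors are
-- analytic, so neither exceeds it.
theorem exists_order_critFun_le {x χ η : ℝ} (hN : countPoly α β (χ, η) ≠ 0) {Z W : ℂ → ℂ}
    (hZ : AnalyticAt ℂ Z 0) (hW : AnalyticAt ℂ W 0) (hZ0 : Z 0 = x) (hZ' : deriv Z 0 ≠ 0)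
    (heq : ∀ᶠ t in 𝓝 (0 : ℂ), W t ^ 2 = aeval (Z t) (p0Poly α β)) :
    ∃ n : ℕ, meromorphicOrderAt (fun t => critFun α β χ η (Z t) (W t)) 0 =
      ((n : ℤ) : WithTop ℤ) ∧ n ≤ (countPoly α β (χ, η)).rootMultiplicity x := by
  set N := countPoly α β (χ, η)
  obtain ⟨M, hM, hMx⟩ := exists_eq_pow_rootMultiplicity_mul_and_not_dvd N hN x
  set m := N.rootMultiplicity x
  have hMx' : aeval (Z 0) M ≠ 0 := by
    rw [hZ0, aeval_ofReal]
    rw [dvd_iff_isRoot] at hMx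
    exact_mod_cast hMx
  have o1 : meromorphicOrderAt (fun t => Z t - x) 0 = ((1 : ℤ) : WithTop ℤ) :=
    order_of_deriv_ne_zero (by fun_prop) (by simp [hZ0]) (by rwa [deriv_sub_const])
  have hZx : MeromorphicAt (fun t => Z t - x) 0 :=
    (show AnalyticAt ℂ (fun t => Z t - x) 0 by fun_prop).meromorphicAt
  have hMa := hZ.aeval_polynomial M
  have o2 : meromorphicOrderAt ((fun t => Z t - x) ^ m * fun t => aeval (Z t) M) 0 =
      ((m : ℤ) : WithTop ℤ) := by
    rw [meromorphicOrderAt_mul (hZx.pow m) hMa.meromorphicAt, meromorphicOrderAt_pow hZx, o1,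
      order_of_ne_zero hMa hMx']
    norm_cast
    simp
  have hK := analyticAt_critFun α β χ η hZ hW
  have hK' := analyticAt_critFun α β (-χ) η hZ hW
  have e : meromorphicOrderAt ((fun t => critFun α β χ η (Z t) (W t)) *
      fun t => critFun α β (-χ) η (Z t) (W t)) 0 = ((m : ℤ) : WithTop ℤ) := by
    rw [← o2]
    refine meromorphicOrderAt_congr ?_
    filter_upwards [heq.filter_mono nhdsWithin_le_nhds] with t ht
    have h1 : aeval (Z t) N = (Z t - x) ^ m * aeval (Z t) M := by
      rw [hM]; simp
    rw [Pi.mul_apply, Pi.mul_apply, Pi.pow_apply, ← h1]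
    simp only [critFun, N, countPoly]
    simp only [map_sub, map_mul, map_pow, aeval_X, aeval_C, Complex.coe_algebraMap, ← ht, map_natCast,
      map_add, map_one, map_ofNat]
    push_cast
    ring
  rw [meromorphicOrderAt_mul hK.meromorphicAt hK'.meromorphicAt] at e
  have p1 := hK.meromorphicOrderAt_nonneg
  have p2 := hK'.meromorphicOrderAt_nonneg
  generalize meromorphicOrderAt (fun t => critFun α β χ η (Z t) (W t)) 0 = a at *
  generalize meromorphicOrderAt (fun t => critFun α β (-χ) η (Z t) (W t)) 0 = b at *
  cases a with
  | top => exact absurd e (by simp)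
  | coe a =>
    cases b with
    | top => exact absurd e (by simp)
    | coe b =>
      norm_cast at e p1 p2
      refine ⟨a.toNat, ?_, by omega⟩
      rw [Int.toNat_of_nonneg p1]

omit h in
theorem exists_param_regular {x w : ℝ} (hz : 0 < (p0Poly α β).eval x)
    (hw : w ^ 2 = (p0Poly α β).eval x) : ∃ Z W : ℂ → ℂ, AnalyticAt ℂ Z 0 ∧ AnalyticAt ℂ W 0 ∧
      Z 0 = x ∧ W 0 = w ∧ deriv Z 0 ≠ 0 ∧
      ∀ t, W t ^ 2 = aeval (Z t) (p0Poly α β) := by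
  have hp : (((p0Poly α β).eval x : ℝ) : ℂ) ≠ 0 := by exact_mod_cast hz.ne'
  have hZ : AnalyticAt ℂ (fun t : ℂ => (x : ℂ) + t) 0 := by fun_prop
  have hf : AnalyticAt ℂ (fun t : ℂ => aeval ((x : ℂ) + t) (p0Poly α β) /
      (((p0Poly α β).eval x : ℝ) : ℂ)) 0 :=
    (hZ.aeval_polynomial _).div analyticAt_const hp
  obtain ⟨g, hg, hg0, hg2⟩ := exists_analytic_sqrt hf (by
    rw [add_zero, aeval_ofReal, div_self hp])
  refine ⟨_, fun t => w * g t, hZ, analyticAt_const.mul hg, by simp, by simp [hg0], ?_,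
    fun t => ?_⟩
  · rw [deriv_const_add]; simp
  · rw [mul_pow, hg2]
    have : (w : ℂ) ^ 2 = (((p0Poly α β).eval x : ℝ) : ℂ) := by rw [← hw]; push_cast; rfl
    rw [this]
    field_simp

/-- With `p₀ = (X - x) P`, the choice `Z = x + t²` makes `p₀(Z) = t² P(Z)`, and `P(Z)` has an
analytic square root since `P(x) ≠ 0`. -/
theorem exists_param_branch {x : ℝ} (hz : (p0Poly α β).eval x = 0) :
    ∃ Z W : ℂ → ℂ, AnalyticAt ℂ Z 0 ∧ AnalyticAt ℂ W 0 ∧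
      Z 0 = x ∧ W 0 = 0 ∧ deriv W 0 ≠ 0 ∧
      ∀ t, W t ^ 2 = aeval (Z t) (p0Poly α β) := by
  obtain ⟨P, hP⟩ := dvd_iff_isRoot.mpr (show (p0Poly α β).IsRoot x from hz)
  have hPx : ((P.eval x : ℝ) : ℂ) ≠ 0 := by
    have := h.p0Poly_derivative_eval_ne_zero hz
    rw [hP] at this
    simp [derivative_mul] at this
    exact_mod_cast this
  have hZ : AnalyticAt ℂ (fun t : ℂ => (x : ℂ) + t ^ 2) 0 := by fun_prop
  obtain ⟨g, hg, hg0, hg2⟩ := exists_analytic_sqrt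
    ((hZ.aeval_polynomial P).div analyticAt_const hPx) (by
      simp only [Pi.div_apply]
      rw [zero_pow two_ne_zero, add_zero, aeval_ofReal, div_self hPx])
  obtain ⟨c, hc⟩ := IsAlgClosed.exists_pow_nat_eq ((P.eval x : ℝ) : ℂ) two_pos
  have hc0 : c ≠ 0 := by rintro rfl; simp at hc; exact hPx (by exact_mod_cast hc.symm)
  refine ⟨_, fun t => t * (c * g t), hZ, analyticAt_id.mul (analyticAt_const.mul hg), by simp,
    by simp, ?_, fun t => ?_⟩
  · have h1 : HasDerivAt (fun t => t * (c * g t)) (1 * (c * g 0) + 0 * deriv (fun t => c * g t) 0) 0 :=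
      (hasDerivAt_id (0 : ℂ)).mul
        (analyticAt_const.mul hg).differentiableAt.hasDerivAt
    rw [h1.deriv, hg0]
    simpa using hc0
  · have h1 : aeval ((x : ℂ) + t ^ 2) (p0Poly α β) = t ^ 2 * aeval ((x : ℂ) + t ^ 2) P := by
      rw [hP]; simp
    rw [mul_pow, mul_pow, hg2, hc, h1]
    simp only [Pi.div_apply]
    field_simp

end Admissible

/-! ### The critical sets as images of the curve -/

namespace Admissible

variable {α β : Fin k → ℝ} (h : Admissible α β) {χ η : ℝ}
include h

theorem not_critical_infty {n : ℕ} (hη : η ≠ 1) :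
    ¬ IsCriticalOfOrder α β χ η OnePoint.infty n := by
  rintro ⟨-, Z, W, ⟨hZ, hW, ho, heq⟩, hn⟩
  rw [order_derivF_infty h χ η hη hZ hW ho heq] at hn
  have : (-1 : ℤ) = n := by exact_mod_cast hn
  omega

section Affine

variable {P : {P : ℂ × ℂ // P.2 ^ 2 = aeval P.1 (p0Poly α β)}} {n : ℕ} {x : ℝ}
  (hcrit : IsCriticalOfOrder α β χ η (OnePoint.some P) n) (hx : P.1.1 = x)
include hcrit hx

theorem not_critical_zero (hη : η ≠ -1) : x ≠ 0 := by
  rintro rfl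
  obtain ⟨-, Z, W, ⟨hZ, hW, hZ0, -, hd, heq⟩, hn⟩ := hcrit
  rw [order_derivF_zero h χ η hη hZ hW (by rw [hZ0, hx, Complex.ofReal_zero]) hd heq] at hn
  have : (-1 : ℤ) = n := by exact_mod_cast hn
  omega

theorem not_critical_one (hχ : χ ^ 2 < 1) : x ≠ 1 := by
  rintro rfl
  obtain ⟨-, Z, W, ⟨hZ, hW, hZ0, hW0, hd, heq⟩, hn⟩ := hcrit
  have hp := h.p0Poly_eval_pos one_pos
  have hk : (0 : ℝ) < k := by exact_mod_cast h.one_le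
  have hw2 := P.2
  rw [hx, aeval_ofReal] at hw2
  have hw : W 0 ≠ 0 := by
    rw [hW0]
    intro h0
    rw [h0, zero_pow two_ne_zero] at hw2
    exact hp.ne (by exact_mod_cast hw2)
  have hK : critFun α β χ η (Z 0) (W 0) ≠ 0 := by
    -- Vanishing of `K` over `z = 1` means `k w = -χ S(1)`; since `S(1)² = k² p₀(1)`, squaring would
    -- give `χ² = 1`.
    intro h0
    rw [critFun, hZ0, hW0, hx, aeval_ofReal] at h0
    have h1 : ((k ^ 2 * (p0Poly α β).eval 1 : ℝ) : ℂ) =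
        ((χ ^ 2 * (critPoly α β).eval 1 ^ 2 : ℝ) : ℂ) := by
      push_cast at h0 hw2 ⊢
      linear_combination (- (k : ℂ) * P.1.2 / 2 + χ * (((critPoly α β).eval 1 : ℝ) : ℂ) / 2) * h0 -
        (k : ℂ) ^ 2 * hw2
    have h2 : k ^ 2 * (p0Poly α β).eval 1 = χ ^ 2 * (critPoly α β).eval 1 ^ 2 := by
      exact_mod_cast h1
    have hD : (derPoly α β).eval 1 = -k * (trPoly α β).eval 1 := by simp [derPoly]
    have hS := h.derPoly_eval_eq 1
    have hdisc := h.discPoly_eval_eq 1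
    have hdisc2 : (discPoly α β).eval 1 = (trPoly α β).eval 1 ^ 2 := by
      rw [discPoly_eval, sub_self, zero_pow (by have := h.one_le; omega)]; ring
    have hq := h.qPoly_eval_pos zero_le_one
    have h3 : (critPoly α β).eval 1 ^ 2 = k ^ 2 * (p0Poly α β).eval 1 := by
      apply mul_left_cancel₀ (pow_ne_zero 2 hq.ne')
      have : (qPoly α β).eval 1 * (critPoly α β).eval 1 = -k * (trPoly α β).eval 1 := by
        linear_combination hD - hS
      calc _ = ((qPoly α β).eval 1 * (critPoly α β).eval 1) ^ 2 := by ring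
        _ = k ^ 2 * (trPoly α β).eval 1 ^ 2 := by rw [this]; ring
        _ = _ := by rw [← hdisc2, hdisc]; ring
    rw [h3] at h2
    have : 0 < k ^ 2 * (p0Poly α β).eval 1 := by positivity
    nlinarith
  rw [order_derivF_one h χ η hZ hW hd heq hw (by rw [hZ0, hx]; simp) hK] at hn
  have : (-1 : ℤ) = n := by exact_mod_cast hn
  omega

theorem eq_curve_of_critical (hn2 : 2 ≤ n) (hz : 0 < (p0Poly α β).eval x) (hx1 : x ≠ 1) :
    (χ, η) = curve α β x ∨ (χ, η) = flipChi (curve α β x) := by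
  obtain ⟨-, Z, W, ⟨hZ, hW, hZ0, hW0, hd, heq⟩, hn⟩ := hcrit
  have hw2 := P.2
  rw [hx, aeval_ofReal] at hw2
  obtain ⟨w, hw, hPw⟩ : ∃ w : ℝ, w ^ 2 = (p0Poly α β).eval x ∧ P.1.2 = w := by
    have h1 : P.1.2 ^ 2 = ((√((p0Poly α β).eval x) : ℝ) : ℂ) ^ 2 := by
      rw [hw2, ← Complex.ofReal_pow, Real.sq_sqrt hz.le]
    rcases sq_eq_sq_iff_eq_or_eq_neg.mp h1 with h2 | h2
    · exact ⟨_, Real.sq_sqrt hz.le, h2⟩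
    · exact ⟨-√((p0Poly α β).eval x), by rw [neg_sq, Real.sq_sqrt hz.le], by rw [h2]; simp⟩
  rw [hx] at hZ0
  rw [hPw] at hW0
  have hx0 := h.ne_zero_of_p0Poly_pos hz
  have hwne : W 0 ≠ 0 := by
    rw [hW0]
    intro h0
    have : w = 0 := by exact_mod_cast h0
    rw [this] at hw; rw [← hw] at hz; simp at hz
  rw [order_derivF_regular h χ η hZ hW hd heq hwne (by rw [hZ0]; exact_mod_cast hx0)
    (by rw [hZ0]; exact_mod_cast hx1)] at hn
  have hZ' := regular_param hZ hW hd heq hwne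
  have h2 := (h.two_le_order_critFun_iff χ η hz hw hZ hW hZ0 hW0 hZ' heq).mp (by
    rw [hn]; exact_mod_cast hn2)
  exact (h.double_zero_iff_curve hz).mp ⟨w, hw, h2⟩

/-- At a branch point `w = 0` and `Z' = 0`. The value of `K` is `-2χ x S(x)`, forcing `χ = 0`; its
derivative is `k((η-1)x - (η+1)) W'`, which determines `η`. -/
theorem eq_curve_of_critical_branch (hn2 : 2 ≤ n) (hz : (p0Poly α β).eval x = 0) (hx0 : x ≠ 0) :
    (χ, η) = curve α β x := by
  obtain ⟨-, Z, W, ⟨hZ, hW, hZ0, -, hd, heq⟩, hn⟩ := hcrit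
  rw [hx] at hZ0
  have hk : (k : ℂ) ≠ 0 := by exact_mod_cast (by have := h.one_le; omega : k ≠ 0)
  have hx1 : x - 1 ≠ 0 := by
    intro h1
    have := h.p0Poly_eval_pos (x := x) (by linarith)
    linarith
  rw [order_derivF_branch h χ η hz hx0 hZ hW hZ0 hd heq] at hn
  obtain ⟨hW0, hW', hZ', -⟩ := branch_param h hz hZ hW hZ0 hd heq
  have h2 := (two_le_order_iff (analyticAt_critFun α β χ η hZ hW)).mp (by
    rw [hn]; exact_mod_cast hn2)
  rw [(deriv_critFun α β χ η hZ.differentiableAt.hasDerivAt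
    hW.differentiableAt.hasDerivAt).deriv, critFun, hZ', hW0, hZ0] at h2
  obtain ⟨h3, h4⟩ := h2
  have hS : aeval (x : ℂ) (critPoly α β) ≠ 0 := by
    rw [aeval_ofReal]; exact_mod_cast h.critPoly_eval_ne_zero hz
  have hχ : χ = 0 := by
    have hxc : (x : ℂ) ≠ 0 := by exact_mod_cast hx0
    have : (χ : ℂ) = 0 := by simpa [hxc, hS] using h3
    exact_mod_cast this
  have h5 : (k : ℂ) * (((η - 1) * x - (η + 1) : ℝ) : ℂ) * deriv W 0 = 0 := by
    push_cast; linear_combination h4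
  have h6 : (η - 1) * x - (η + 1) = 0 := by
    have : (((η - 1) * x - (η + 1) : ℝ) : ℂ) = 0 := by
      simpa only [mul_eq_zero, hk, hW', false_or, or_false] using h5
    exact_mod_cast this
  rw [(h.curve_at_branch hz hx0).2, hχ, Prod.mk.injEq, eq_div_iff hx1]
  exact ⟨rfl, by linear_combination h6⟩

end Affine

theorem exists_critical {x : ℝ} (hz : 0 < (p0Poly α β).eval x) (hx1 : x ≠ 1)
    (hc : (χ, η) = curve α β x ∨ (χ, η) = flipChi (curve α β x)) :
    ∃ P : {P : ℂ × ℂ // P.2 ^ 2 = aeval P.1 (p0Poly α β)}, P.1.1 = x ∧ ∃ n : ℕ, 2 ≤ n ∧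
      n ≤ (countPoly α β (χ, η)).rootMultiplicity x ∧
      IsCriticalOfOrder α β χ η (OnePoint.some P) n := by
  have hx0 := h.ne_zero_of_p0Poly_pos hz
  have hχ : (χ, η).1 ^ 2 < 1 := by
    have := h.curve_fst_sq_lt hz hx1
    rcases hc with hc | hc <;> rw [hc]
    · exact this
    · simpa [flipChi] using this
  obtain ⟨w, hw, hc⟩ := (h.double_zero_iff_curve hz).mpr hc
  obtain ⟨Z, W, hZ, hW, hZ0, hW0, hZ', heq⟩ := exists_param_regular hz hw
  have heq' := Filter.Eventually.of_forall (f := 𝓝 (0 : ℂ)) heq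
  obtain ⟨n, hn, hnle⟩ := exists_order_critFun_le (h.countPoly_ne_zero hχ) hZ hW hZ0 hZ' heq'
  have h2 := (h.two_le_order_critFun_iff χ η hz hw hZ hW hZ0 hW0 hZ' heq').mpr hc
  have hn2 : 2 ≤ n := by rw [hn] at h2; exact_mod_cast h2
  have hwne : W 0 ≠ 0 := by
    rw [hW0]
    intro h0
    have : w = 0 := by exact_mod_cast h0
    rw [this] at hw; rw [← hw] at hz; simp at hz
  refine ⟨⟨(x, w), ?_⟩, rfl, n, hn2, hnle, by omega, Z, W,
    ⟨hZ, hW, hZ0, hW0, Or.inl hZ', heq'⟩, ?_⟩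
  · have := heq 0; rwa [hZ0, hW0] at this
  · rw [order_derivF_regular h χ η hZ hW (Or.inl hZ') heq' hwne
      (by rw [hZ0]; exact_mod_cast hx0) (by rw [hZ0]; exact_mod_cast hx1), hn]

/-- For these parameters `K = k(η-1)(Z - x) W`, a double zero times a simple one. The order is
therefore three, which is why the rough-smooth boundary is defined with order at least two. -/
theorem exists_critical_branch {x : ℝ} (hz : (p0Poly α β).eval x = 0) (hx0 : x ≠ 0)
    (hc : (χ, η) = curve α β x) :
    ∃ P : {P : ℂ × ℂ // P.2 ^ 2 = aeval P.1 (p0Poly α β)}, P.1.1 = x ∧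
      IsCriticalOfOrder α β χ η (OnePoint.some P) 3 := by
  obtain ⟨Z, W, hZ, hW, hZ0, hW0, hW', heq⟩ := h.exists_param_branch hz
  have heq' := Filter.Eventually.of_forall (f := 𝓝 (0 : ℂ)) heq
  have hk : (k : ℂ) ≠ 0 := by exact_mod_cast (by have := h.one_le; omega : k ≠ 0)
  have hx1 : x - 1 ≠ 0 := by
    intro h1
    have := h.p0Poly_eval_pos (x := x) (by linarith)
    linarith
  refine ⟨⟨(x, 0), ?_⟩, rfl, by omega, Z, W, ⟨hZ, hW, hZ0, hW0, Or.inr hW', heq'⟩, ?_⟩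
  · have := heq 0; rwa [hZ0, hW0] at this
  obtain ⟨-, -, -, o1, o2, -⟩ := branch_param h hz hZ hW hZ0 (Or.inr hW') heq'
  rw [order_derivF_branch h χ η hz hx0 hZ hW hZ0 (Or.inr hW') heq']
  rw [(h.curve_at_branch hz hx0).2, Prod.mk.injEq, eq_div_iff hx1] at hc
  obtain ⟨rfl, hη⟩ := hc
  have hη1 : η - 1 ≠ 0 := by
    intro h1
    have : (η - 1) * (x - 1) = 2 := by linear_combination hη
    rw [h1, zero_mul] at this
    norm_num at this
  have hcst : (k : ℂ) * (η - 1) ≠ 0 := by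
    refine mul_ne_zero hk ?_
    exact_mod_cast hη1
  have e : (fun t => critFun α β 0 η (Z t) (W t)) =
      (fun _ => (k : ℂ) * (η - 1)) * ((fun t => Z t - x) * W) := by
    ext t
    have : (η : ℂ) * (x - 1) = x + 1 := by exact_mod_cast hη
    simp only [critFun, Pi.mul_apply, Complex.ofReal_zero]
    linear_combination k * W t * this
  have hZx : MeromorphicAt (fun t => Z t - x) 0 :=
    (show AnalyticAt ℂ (fun t => Z t - x) 0 by fun_prop).meromorphicAt
  rw [e, meromorphicOrderAt_mul (MeromorphicAt.const _ 0) (hZx.mul hW.meromorphicAt),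
    meromorphicOrderAt_mul hZx hW.meromorphicAt, order_of_ne_zero analyticAt_const hcst, o1, o2]
  rfl

theorem curve_mem_square {x : ℝ} (hz : 0 ≤ (p0Poly α β).eval x) (hx0 : x ≠ 0) (hx1 : x ≠ 1) :
    (curve α β x).1 ∈ Ioo (-1 : ℝ) 1 ∧ (curve α β x).2 ∈ Ioo (-1 : ℝ) 1 := by
  rcases hz.lt_or_eq with hz | hz
  · exact ⟨abs_lt.mp (sq_lt_one_iff_abs_lt_one _ |>.mp (h.curve_fst_sq_lt hz hx1)),
      h.curveNum_div_mem hz⟩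
  · rw [(h.curve_at_branch hz.symm hx0).2]
    have hx : x < 0 := by
      by_contra! h1
      have := h.p0Poly_eval_pos (lt_of_le_of_ne h1 hx0.symm)
      linarith
    refine ⟨by norm_num, ?_, ?_⟩
    · rw [lt_div_iff_of_neg (by linarith)]; linarith
    · rw [div_lt_iff_of_neg (by linarith)]; linarith

theorem roughSmooth_eq {l : ℕ} (hl1 : 1 ≤ l) (hl : l < kPrime α β) : roughSmooth α β l =
    {c | ∃ x ∈ Icc (branchPt α β (2 * l)) (branchPt α β (2 * l - 1)),
      c = curve α β x ∨ c = flipChi (curve α β x)} := by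
  have hi := h.gap_index hl1 hl
  have hneg := h.gap_neg hl1 hl
  have hsplit : ∀ x ∈ Icc (branchPt α β (2 * l)) (branchPt α β (2 * l - 1)),
      0 < (p0Poly α β).eval x ∨ (p0Poly α β).eval x = 0 := by
    rintro x ⟨h1, h2⟩
    rcases h1.eq_or_lt with rfl | h1
    · exact Or.inr (h.p0Poly_eval_branchPt hi.1)
    rcases h2.eq_or_lt with rfl | h2
    · exact Or.inr (h.p0Poly_eval_branchPt hi.2)
    exact Or.inl (h.p0Poly_eval_pos_of_gap hl1 hl ⟨h1, h2⟩)
  ext ⟨χ, η⟩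
  constructor
  · rintro ⟨hχ, hη, Q, ⟨P, rfl, x, hx, hPx⟩, n, hn2, hcrit⟩
    refine ⟨x, hx, ?_⟩
    rcases hsplit x hx with hz | hz
    · exact h.eq_curve_of_critical hcrit hPx hn2 hz (by linarith [hx.2])
    · exact Or.inl (h.eq_curve_of_critical_branch hcrit hPx hn2 hz (by linarith [hx.2]))
  · rintro ⟨x, hx, hc⟩
    have hx0 : x ≠ 0 := by linarith [hx.2]
    have hx1 : x ≠ 1 := by linarith [hx.2]
    have hsq := h.curve_mem_square (by rcases hsplit x hx with h1 | h1 <;> linarith) hx0 hx1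
    refine ⟨?_, ?_, ?_⟩
    · rcases hc with hc | hc <;> rw [hc]
      · exact hsq.1
      · exact ⟨by simpa [flipChi] using neg_lt_neg hsq.1.2,
          by simpa [flipChi] using neg_lt_neg hsq.1.1⟩
    · rcases hc with hc | hc <;> rw [hc] <;> exact hsq.2
    rcases hsplit x hx with hz | hz
    · obtain ⟨P, hP, n, hn2, -, hcrit⟩ := h.exists_critical hz hx1 hc
      exact ⟨_, ⟨P, rfl, x, hx, hP⟩, n, hn2, hcrit⟩
    · have hc' : (χ, η) = curve α β x := by
        rcases hc with hc | hc
        · exact hc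
        · rw [hc, (h.curve_at_branch hz hx0).2]; simp [flipChi]
      obtain ⟨P, hP, hcrit⟩ := h.exists_critical_branch hz hx0 hc'
      exact ⟨_, ⟨P, rfl, x, hx, hP⟩, 3, by norm_num, hcrit⟩

/-- The points over `0`, `1` and `∞` drop out because `dF` has a pole there for parameters in the
open square. -/
theorem frozenRough_eq : frozenRough α β =
    {c | ∃ x : ℝ, 0 < x ∧ x ≠ 1 ∧ (c = curve α β x ∨ c = flipChi (curve α β x))} := by
  ext ⟨χ, η⟩
  constructor
  · rintro ⟨hχ, hη, Q, hQ, hcrit⟩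
    rcases hQ with rfl | ⟨P, rfl, x, hx, hPx⟩
    · exact absurd hcrit (h.not_critical_infty hη.2.ne)
    have hx0 := h.not_critical_zero hcrit hPx hη.1.ne'
    have hx1 := h.not_critical_one hcrit hPx (by
      rw [sq_lt_one_iff_abs_lt_one, abs_lt]; exact hχ)
    have hx' : 0 < x := lt_of_le_of_ne hx hx0.symm
    exact ⟨x, hx', hx1, h.eq_curve_of_critical hcrit hPx le_rfl (h.p0Poly_eval_pos hx') hx1⟩
  · rintro ⟨x, hx, hx1, hc⟩
    have hz := h.p0Poly_eval_pos hx
    have hsq := h.curve_mem_square hz.le hx.ne' hx1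
    have hsq1 := h.curve_fst_sq_lt hz hx1
    have hne := h.curve_fst_ne_zero hz
    refine ⟨?_, ?_, ?_⟩
    · rcases hc with hc | hc <;> rw [hc]
      · exact hsq.1
      · exact ⟨by simpa [flipChi] using neg_lt_neg hsq.1.2,
          by simpa [flipChi] using neg_lt_neg hsq.1.1⟩
    · rcases hc with hc | hc <;> rw [hc] <;> exact hsq.2
    obtain ⟨P, hP, n, hn2, hnle, hcrit⟩ := h.exists_critical hz hx1 hc
    have h0 : (χ, η).1 ≠ 0 := by
      rcases hc with hc | hc <;> rw [hc]
      · exact hne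
      · simpa [flipChi] using hne
    have h1 : (χ, η).1 ^ 2 < 1 := by
      rcases hc with hc | hc <;> rw [hc]
      · exact hsq1
      · simpa [flipChi] using hsq1
    have := h.rootMultiplicity_le_of_pos h0 h1 hx
    obtain rfl : n = 2 := by omega
    exact ⟨_, Or.inr ⟨P, rfl, x, hx.le, hP⟩, hcrit⟩

end Admissible

/-! ### The branch of the square root and the functions `χ(z)`, `η(z)` -/

theorem sqrt_eq_of_re_neg {u : ℂ} (hu : u.re < 0) : u ^ (1 / 2 : ℂ) =
    (if 0 ≤ u.im then Complex.I else -Complex.I) * (-u) ^ (1 / 2 : ℂ) := by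
  have hu0 : u ≠ 0 := by rintro rfl; simp at hu
  have hI : Complex.exp (Real.pi * Complex.I * (1 / 2)) = Complex.I := by
    rw [show (Real.pi : ℂ) * Complex.I * (1 / 2) = Real.pi / 2 * Complex.I by ring,
      Complex.exp_pi_div_two_mul_I]
  rw [Complex.cpow_def_of_ne_zero hu0, Complex.cpow_def_of_ne_zero (neg_ne_zero.mpr hu0),
    Complex.log, Complex.log, norm_neg]
  split_ifs with him
  · rw [Complex.arg_neg_eq_arg_sub_pi_iff.mpr (by
      rcases him.lt_or_eq with h1 | h1
      · exact Or.inl h1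
      · exact Or.inr ⟨h1.symm, hu⟩)]
    nth_rewrite 2 [← hI]
    rw [← Complex.exp_add]
    congr 1
    push_cast
    ring
  · rw [Complex.arg_neg_eq_arg_add_pi_iff.mpr (Or.inl (not_le.mp him)), neg_mul]
    have : Complex.exp (-(Real.pi * Complex.I * (1 / 2))) = -Complex.I := by
      rw [Complex.exp_neg, hI, Complex.inv_I]
    rw [← neg_mul, ← this, ← Complex.exp_add]
    congr 1
    push_cast
    ring

namespace Admissible

variable {α β : Fin k → ℝ} (h : Admissible α β)
include h

theorem sqrtP0_eq (z : ℂ) : sqrtP0 α β z = (√(p0Poly α β).leadingCoeff : ℂ) *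
    ∏ j ∈ Finset.range (p0Poly α β).natDegree, (z - (branchPt α β j : ℂ)) ^ (1 / 2 : ℂ) := by
  rw [sqrtP0, h.p0Poly_roots_eq, Multiset.map_map]
  rfl

theorem sqrtP0_sq (z : ℂ) : sqrtP0 α β z ^ 2 = aeval z (p0Poly α β) := by
  rw [h.sqrtP0_eq, h.p0Poly_aeval_eq_prod, mul_pow, ← Finset.prod_pow, ← Complex.ofReal_pow,
    Real.sq_sqrt h.p0Poly_leadingCoeff_pos.le]
  congr 1
  refine Finset.prod_congr rfl fun j _ => ?_
  simp

section Branch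

variable {l : ℕ} {x : ℝ} (hl : 2 * l ≤ (p0Poly α β).natDegree)
  (hx : ∀ j < (p0Poly α β).natDegree,
    (j < 2 * l → x < branchPt α β j) ∧ (2 * l ≤ j → branchPt α β j < x))
include hl hx

/-- Near a real point with an even number of branch points to its right, the jumps of the
principal square roots cancel. -/
theorem sqrtP0_eventuallyEq : sqrtP0 α β =ᶠ[𝓝 (x : ℂ)] fun z =>
    (√(p0Poly α β).leadingCoeff : ℂ) * ((-1) ^ l *
      (∏ j ∈ Finset.range (2 * l), ((branchPt α β j : ℂ) - z) ^ (1 / 2 : ℂ)) *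
      ∏ j ∈ Finset.Ico (2 * l) (p0Poly α β).natDegree,
        (z - (branchPt α β j : ℂ)) ^ (1 / 2 : ℂ)) := by
  have hev : ∀ᶠ z : ℂ in 𝓝 (x : ℂ), ∀ j ∈ Finset.range (2 * l), (z - branchPt α β j).re < 0 := by
    rw [Filter.eventually_all_finset]
    intro j hj
    have hj' := Finset.mem_range.mp hj
    have h1 := (hx j (by omega)).1 hj'
    refine (show Continuous fun z : ℂ => (z - branchPt α β j).re by fun_prop).continuousAt.eventually_lt
      continuousAt_const ?_
    simpa using h1
  filter_upwards [hev] with z hz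
  rw [h.sqrtP0_eq, ← Finset.prod_range_mul_prod_Ico _ hl]
  congr 2
  rw [Finset.prod_congr rfl fun j hj => sqrt_eq_of_re_neg (hz j hj), Finset.prod_mul_distrib]
  simp only [Complex.sub_im, Complex.ofReal_im, sub_zero, neg_sub]
  rw [Finset.prod_const, Finset.card_range, pow_mul]
  congr 2
  -- The factors `±i` have the same sign for all `j`, as it depends only on `Im z`; each pair gives
  -- `-1` for either sign.
  split_ifs <;> simp

theorem analyticAt_sqrtP0 : AnalyticAt ℂ (sqrtP0 α β) x := by
  refine AnalyticAt.congr ?_ (h.sqrtP0_eventuallyEq hl hx).symm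
  refine analyticAt_const.mul ((analyticAt_const.mul ?_).mul ?_)
  · refine Finset.analyticAt_fun_prod _ fun j hj => ?_
    have hj' := Finset.mem_range.mp hj
    refine AnalyticAt.cpow (by fun_prop) analyticAt_const ?_
    rw [← Complex.ofReal_sub, Complex.ofReal_mem_slitPlane]
    linarith [(hx j (by omega)).1 hj']
  · refine Finset.analyticAt_fun_prod _ fun j hj => ?_
    have hj' := Finset.mem_Ico.mp hj
    refine AnalyticAt.cpow (by fun_prop) analyticAt_const ?_
    rw [← Complex.ofReal_sub, Complex.ofReal_mem_slitPlane]
    linarith [(hx j hj'.2).2 hj'.1]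

/-- The local product shows that the value is `(-1)^l` times a nonnegative number, which the square
then identifies. -/
theorem sqrtP0_ofReal :
    sqrtP0 α β x = (((-1) ^ l * √((p0Poly α β).eval x) : ℝ) : ℂ) := by
  obtain ⟨r, hr, hrx⟩ : ∃ r : ℝ, 0 ≤ r ∧ sqrtP0 α β x = (((-1) ^ l * r : ℝ) : ℂ) := by
    refine ⟨√(p0Poly α β).leadingCoeff *
      ((∏ j ∈ Finset.range (2 * l), (branchPt α β j - x) ^ (1 / 2 : ℝ)) *
      ∏ j ∈ Finset.Ico (2 * l) (p0Poly α β).natDegree, (x - branchPt α β j) ^ (1 / 2 : ℝ)), ?_, ?_⟩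
    · refine mul_nonneg (Real.sqrt_nonneg _) (mul_nonneg ?_ ?_)
      · refine Finset.prod_nonneg fun j hj => Real.rpow_nonneg ?_ _
        have hj' := Finset.mem_range.mp hj
        linarith [(hx j (by omega)).1 hj']
      · refine Finset.prod_nonneg fun j hj => Real.rpow_nonneg ?_ _
        have hj' := Finset.mem_Ico.mp hj
        linarith [(hx j hj'.2).2 hj'.1]
    · rw [(h.sqrtP0_eventuallyEq hl hx).self_of_nhds]
      have e1 : ∏ j ∈ Finset.range (2 * l), ((branchPt α β j : ℂ) - x) ^ (1 / 2 : ℂ) =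
          ((∏ j ∈ Finset.range (2 * l), (branchPt α β j - x) ^ (1 / 2 : ℝ) : ℝ) : ℂ) := by
        rw [Complex.ofReal_prod]
        refine Finset.prod_congr rfl fun j hj => ?_
        have hj' := Finset.mem_range.mp hj
        rw [Complex.ofReal_cpow (by linarith [(hx j (by omega)).1 hj'])]
        push_cast; rfl
      have e2 : ∏ j ∈ Finset.Ico (2 * l) (p0Poly α β).natDegree,
          ((x : ℂ) - branchPt α β j) ^ (1 / 2 : ℂ) =
          ((∏ j ∈ Finset.Ico (2 * l) (p0Poly α β).natDegree,
            (x - branchPt α β j) ^ (1 / 2 : ℝ) : ℝ) : ℂ) := by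
        rw [Complex.ofReal_prod]
        refine Finset.prod_congr rfl fun j hj => ?_
        have hj' := Finset.mem_Ico.mp hj
        rw [Complex.ofReal_cpow (by linarith [(hx j hj'.2).2 hj'.1])]
        push_cast; rfl
      simp only [e1, e2]
      push_cast
      ring
  have h1 := h.sqrtP0_sq x
  rw [hrx, aeval_ofReal] at h1
  have h2 : ((-1) ^ l * r) ^ 2 = (p0Poly α β).eval x := by exact_mod_cast h1
  rw [mul_pow, ← pow_mul, mul_comm l 2, pow_mul, neg_one_sq, one_pow, one_mul] at h2
  rw [hrx, ← h2, Real.sqrt_sq hr]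

/-- Here `g = z S/((z-1) √p₀)` and `g' = z V/((z-1)² p₀^{3/2})`. In `χ(z)` one factor `√p₀` survives
and carries the sign `(-1)^l`; in `η(z)` only even powers remain, and `curve_identity` finishes. -/
theorem chiFun_etaFun_eq (hz : 0 < (p0Poly α β).eval x) (hx1 : x ≠ 1) :
    chiFun α β x = (((-1) ^ l * (curve α β x).1 : ℝ) : ℂ) ∧
      etaFun α β x = (((curve α β x).2 : ℝ) : ℂ) := by
  have hx0 := h.ne_zero_of_p0Poly_pos hz
  have hW := h.analyticAt_sqrtP0 hl hx
  have hWx := h.sqrtP0_ofReal hl hx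
  have hsq : sqrtP0 α β x ^ 2 = (((p0Poly α β).eval x : ℝ) : ℂ) := by
    rw [h.sqrtP0_sq, aeval_ofReal]
  have hpc : (((p0Poly α β).eval x : ℝ) : ℂ) ≠ 0 := by exact_mod_cast hz.ne'
  have hw0 : sqrtP0 α β x ≠ 0 := by
    intro h0; rw [h0, zero_pow two_ne_zero] at hsq; exact hpc hsq.symm
  have hxc0 : (x : ℂ) ≠ 0 := by exact_mod_cast hx0
  have hxc1 : (x : ℂ) ≠ 1 := by exact_mod_cast hx1
  have hxc2 : (x : ℂ) - 1 ≠ 0 := sub_ne_zero.mpr hxc1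
  have hG : zLogDeriv α β =ᶠ[𝓝 (x : ℂ)] fun z =>
      z * aeval z (critPoly α β) / ((z - 1) * sqrtP0 α β z) := by
    filter_upwards [hW.eventually_analyticAt, hW.continuousAt.eventually_ne hw0,
      eventually_ne_nhds hxc0, eventually_ne_nhds hxc1] with z hz1 hz2 hz3 hz4
    obtain ⟨hr0, hr⟩ := h.logDeriv_rho (hasDerivAt_id z) hz1.differentiableAt.hasDerivAt
      (Eventually.of_forall fun s => h.sqrtP0_sq s) hz3 hz4 hz2
    simp only [id] at hr0 hr
    rw [zLogDeriv]
    have e : deriv (rho1 α β) z = _ := hr.deriv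
    rw [e, rho1]
    field_simp
  have hder : HasDerivAt (zLogDeriv α β)
      ((x : ℂ) * (((curveDen α β).eval x : ℝ) : ℂ) / ((x - 1) ^ 2 * sqrtP0 α β x ^ 3)) x := by
    refine HasDerivAt.congr_of_eventuallyEq ?_ hG
    have hWd := hW.differentiableAt.hasDerivAt
    have hWW := deriv_of_sq_eq (hasDerivAt_id (x : ℂ)) hWd
      (Eventually.of_forall fun s => h.sqrtP0_sq s)
    simp only [id, aeval_ofReal, mul_one] at hWW
    have hd := ((hasDerivAt_id (x : ℂ)).mul ((critPoly α β).hasDerivAt_aeval (x : ℂ))).div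
      (((hasDerivAt_id (x : ℂ)).sub_const 1).mul hWd) (mul_ne_zero hxc2 hw0)
    refine hd.congr_deriv ?_
    simp only [id, aeval_ofReal, Pi.mul_apply]
    have hV : (x : ℂ) * (((curveDen α β).eval x : ℝ) : ℂ) =
        ((x ^ 2 * (critPoly α β).derivative.eval x - (critPoly α β).eval x -
          x * (critPoly α β).derivative.eval x) * (p0Poly α β).eval x -
        1 / 2 * x * (x - 1) * (critPoly α β).eval x * (p0Poly α β).derivative.eval x : ℝ) := by
      rw [← Complex.ofReal_mul, Complex.ofReal_inj, curveDen_eval, upperPoly, lowerPoly]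
      simp only [eval_sub, eval_mul, eval_add, eval_X, eval_C]
      linear_combination ((critPoly α β).eval x + x * (critPoly α β).derivative.eval x) *
        h.p0Poly_eval_eq x
    rw [hV, div_eq_div_iff (pow_ne_zero 2 (mul_ne_zero hxc2 hw0))
      (mul_ne_zero (pow_ne_zero 2 hxc2) (pow_ne_zero 3 hw0))]
    push_cast
    generalize sqrtP0 α β (x : ℂ) = w at *
    generalize deriv (sqrtP0 α β) (x : ℂ) = W' at *
    linear_combination ((x : ℂ) - 1) ^ 2 * w ^ 2 *
      ((((((critPoly α β).eval x : ℝ) : ℂ) + x * (((critPoly α β).derivative.eval x : ℝ) : ℂ)) *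
        (x - 1) - x * (((critPoly α β).eval x : ℝ) : ℂ)) * hsq -
        x * (((critPoly α β).eval x : ℝ) : ℂ) * (x - 1) / 2 * hWW)
  have hV : (((curveDen α β).eval x : ℝ) : ℂ) ≠ 0 := by
    exact_mod_cast h.curveDen_ne_zero hz
  have hp1 : (((p0Poly α β).eval x : ℝ) : ℂ) = x * (((p1Poly α β).eval x : ℝ) : ℂ) := by
    rw [h.p0Poly_eval_eq]; push_cast; rfl
  constructor
  · rw [chiFun, hder.deriv, curve]
    have : (((-1) ^ l * (k * (p1Poly α β).eval x * √((p0Poly α β).eval x) / (curveDen α β).eval x) : ℝ) : ℂ)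
        = k * (((p1Poly α β).eval x : ℝ) : ℂ) * sqrtP0 α β x / (((curveDen α β).eval x : ℝ) : ℂ) := by
      rw [hWx]; push_cast; ring
    rw [this]
    field_simp
    rw [hsq, hp1]
    ring
  · rw [etaFun, hder.deriv, hG.self_of_nhds, curve]
    have hid : ((x : ℂ) - 1) * (((curveNum α β).eval x : ℝ) : ℂ) -
        (x + 1) * (((curveDen α β).eval x : ℝ) : ℂ) = 2 * (((critPoly α β).eval x : ℝ) : ℂ) *
          (((p0Poly α β).eval x : ℝ) : ℂ) := by
      exact_mod_cast h.curve_identity x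
    simp only [aeval_ofReal]
    push_cast
    field_simp
    rw [hsq]
    linear_combination -hid

end Branch

end Admissible

/-! ### Closed curves from an arc and its mirror image -/

@[simp] theorem flipChi_flipChi (c : ℝ × ℝ) : flipChi (flipChi c) = c := by simp [flipChi]

theorem continuous_flipChi : Continuous flipChi := by unfold flipChi; fun_prop

theorem injective_flipChi : Function.Injective flipChi :=
  Function.LeftInverse.injective flipChi_flipChi

/-- The circle is projected to the interval by its real part; the upper half runs through the arc,
the lower half through its mirror image. They agree where the imaginary part vanishes, since the
ends lie on `χ = 0`, and are otherwise separated by the sign of `χ`. -/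
theorem isSimpleClosedCurve_of_pos {γ : unitInterval → ℝ × ℝ} (hc : Continuous γ)
    (hi : Function.Injective γ) (h0 : (γ 0).1 = 0) (h1 : (γ 1).1 = 0)
    (hpos : ∀ t, t ≠ 0 → t ≠ 1 → 0 < (γ t).1) :
    IsSimpleClosedCurve (range γ ∪ range fun t => flipChi (γ t)) := by
  have hre : ∀ z : Circle, ((z : ℂ).re + 1) / 2 ∈ unitInterval := by
    intro z
    have h2 := Complex.abs_re_le_norm (z : ℂ)
    rw [Circle.norm_coe, abs_le] at h2
    constructor <;> linarith
  have hnorm : ∀ z : Circle, (z : ℂ).re ^ 2 + (z : ℂ).im ^ 2 = 1 := by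
    intro z
    have := Complex.sq_norm (z : ℂ)
    rw [Circle.norm_coe, Complex.normSq_apply] at this
    linarith
  set u : Circle → unitInterval := fun z => ⟨((z : ℂ).re + 1) / 2, hre z⟩
  have hu : Continuous u := by
    refine Continuous.subtype_mk ?_ _
    exact ((Complex.continuous_re.comp continuous_subtype_val).add_const 1).div_const 2
  have him : Continuous fun z : Circle => (z : ℂ).im :=
    Complex.continuous_im.comp continuous_subtype_val
  have hend : ∀ z : Circle, (z : ℂ).im = 0 → (γ (u z)).1 = 0 := by
    intro z hz
    have h2 := hnorm z
    rw [hz] at h2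
    have h3 : ((z : ℂ).re - 1) * ((z : ℂ).re + 1) = 0 := by linarith
    rcases mul_eq_zero.mp h3 with h4 | h4
    · have : u z = 1 := by ext; simp only [u]; norm_num; linarith
      rw [this, h1]
    · have : u z = 0 := by ext; simp only [u]; norm_num; linarith
      rw [this, h0]
  have hpos' : ∀ z : Circle, (z : ℂ).im ≠ 0 → 0 < (γ (u z)).1 := by
    intro z hz
    have h2 := hnorm z
    have h3 : 0 < (z : ℂ).im ^ 2 := by positivity
    refine hpos _ ?_ ?_ <;> intro h4 <;> have h5 := congrArg Subtype.val h4 <;>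
      simp only [u] at h5 <;> norm_num at h5
    · have : (z : ℂ).re = -1 := by linarith
      rw [this] at h2; linarith
    · have : (z : ℂ).re = 1 := by linarith
      rw [this] at h2; linarith
  have hnn : ∀ z, 0 ≤ (γ (u z)).1 := fun z => by
    by_cases hz : (z : ℂ).im = 0
    · exact (hend z hz).ge
    · exact (hpos' z hz).le
  have hext : ∀ z w : Circle, u z = u w → 0 ≤ (z : ℂ).im * (w : ℂ).im → z = w := by
    intro z w h2 h3
    have h4 := congrArg Subtype.val h2
    simp only [u] at h4
    have h5 : (z : ℂ).re = (w : ℂ).re := by linarith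
    have h6 := hnorm z
    have h7 := hnorm w
    rw [h5] at h6
    have h8 : (z : ℂ).im = (w : ℂ).im := by
      have h9 : ((z : ℂ).im - (w : ℂ).im) * ((z : ℂ).im + (w : ℂ).im) = 0 := by nlinarith
      rcases mul_eq_zero.mp h9 with h10 | h10
      · linarith
      · have : (z : ℂ).im = -(w : ℂ).im := by linarith
        rw [this] at h3 ⊢
        have : (w : ℂ).im = 0 := by
          have : (w : ℂ).im ^ 2 ≤ 0 := by nlinarith
          exact pow_eq_zero_iff two_ne_zero |>.mp (le_antisymm this (sq_nonneg _))
        rw [this, neg_zero]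
    exact Circle.ext (Complex.ext h5 h8)
  have hmixed : ∀ z w : Circle, ¬ 0 ≤ (w : ℂ).im → γ (u z) ≠ flipChi (γ (u w)) := by
    intro z w hw h2
    have h3 := congrArg Prod.fst h2
    have h4 := hpos' w (by intro h5; exact hw h5.ge)
    have h5 := hnn z
    simp only [flipChi] at h3
    linarith
  refine ⟨fun z => if 0 ≤ (z : ℂ).im then γ (u z) else flipChi (γ (u z)), ?_, ?_, ?_⟩
  · refine Continuous.if_le (hc.comp hu) (continuous_flipChi.comp (hc.comp hu)) continuous_const him
      fun z hz => ?_
    have := hend z hz.symm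
    ext
    · simp [flipChi, this]
    · rfl
  · intro z w hzw
    simp only at hzw
    split_ifs at hzw with h2 h3 h3
    · exact hext z w (hi hzw) (mul_nonneg h2 h3)
    · exact absurd hzw (hmixed z w h3)
    · exact absurd hzw.symm (hmixed w z h2)
    · exact hext z w (hi (injective_flipChi hzw))
        (mul_nonneg_of_nonpos_of_nonpos (not_le.mp h2).le (not_le.mp h3).le)
  · apply Subset.antisymm
    · rintro _ ⟨z, rfl⟩
      by_cases h2 : 0 ≤ (z : ℂ).im
      · exact Or.inl ⟨u z, by simp [h2]⟩
      · exact Or.inr ⟨u z, by simp [h2]⟩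
    · have hex : ∀ t : unitInterval, ∀ s : ℝ, s ^ 2 = 1 → ∃ z : Circle, u z = t ∧
          (z : ℂ).im = s * √(1 - (2 * (t : ℝ) - 1) ^ 2) := by
        intro t s hs
        have ht := t.2
        have h2 : 0 ≤ 1 - (2 * (t : ℝ) - 1) ^ 2 := by nlinarith [ht.1, ht.2]
        refine ⟨⟨⟨2 * (t : ℝ) - 1, s * √(1 - (2 * (t : ℝ) - 1) ^ 2)⟩, ?_⟩, ?_, rfl⟩
        · change _ ∈ Metric.sphere (0 : ℂ) 1
          rw [mem_sphere_zero_iff_norm, ← sq_eq_sq₀ (norm_nonneg _) zero_le_one, Complex.sq_norm,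
            Complex.normSq_apply]
          simp only
          have := Real.sq_sqrt h2
          nlinarith
        · ext; simp only [u]; ring
      rintro _ (⟨t, rfl⟩ | ⟨t, rfl⟩)
      · obtain ⟨z, rfl, hz⟩ := hex t 1 (one_pow 2)
        refine ⟨z, if_pos ?_⟩
        rw [hz, one_mul]
        exact Real.sqrt_nonneg _
      · obtain ⟨z, rfl, hz⟩ := hex t (-1) (by norm_num)
        refine ⟨z, ?_⟩
        simp only
        split_ifs with h2
        · have h3 : (z : ℂ).im = 0 := le_antisymm (by
            rw [hz]; linarith [Real.sqrt_nonneg (1 - (2 * ((u z : unitInterval) : ℝ) - 1) ^ 2)]) h2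
          have := hend z h3
          ext
          · simp [flipChi, this]
          · rfl
        · rfl

/-- By connectedness `χ` has constant sign on the open arc; if negative, the arc and its mirror
image change roles. -/
theorem isSimpleClosedCurve_of_ne_zero {γ : unitInterval → ℝ × ℝ} (hc : Continuous γ)
    (hi : Function.Injective γ) (h0 : (γ 0).1 = 0) (h1 : (γ 1).1 = 0)
    (hne : ∀ t, t ≠ 0 → t ≠ 1 → (γ t).1 ≠ 0) :
    IsSimpleClosedCurve (range γ ∪ range fun t => flipChi (γ t)) := by
  by_cases hpos : ∀ t, t ≠ 0 → t ≠ 1 → 0 < (γ t).1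
  · exact isSimpleClosedCurve_of_pos hc hi h0 h1 hpos
  have hneg : ∀ t, t ≠ 0 → t ≠ 1 → (γ t).1 < 0 := by
    by_contra! h2
    obtain ⟨y, hy0, hy1, hy⟩ := h2
    push Not at hpos
    obtain ⟨x, hx0, hx1, hx⟩ := hpos
    have hmem : ∀ t : unitInterval, t ≠ 0 → t ≠ 1 → t ∈ Ioo (0 : unitInterval) 1 :=
      fun t ht0 ht1 => ⟨unitInterval.pos_iff_ne_zero.mpr ht0, unitInterval.lt_one_iff_ne_one.mpr ht1⟩
    obtain ⟨t, ht, ht'⟩ := (isPreconnected_Ioo (a := (0 : unitInterval)) (b := 1)).intermediate_value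
      (hmem x hx0 hx1) (hmem y hy0 hy1) (f := fun t => (γ t).1)
      (continuous_fst.comp hc).continuousOn ⟨hx, hy⟩
    exact hne t ht.1.ne' ht.2.ne ht'
  have h2 := isSimpleClosedCurve_of_pos (γ := fun t => flipChi (γ t))
    (continuous_flipChi.comp hc) (injective_flipChi.comp hi) (by simp [flipChi, h0])
    (by simp [flipChi, h1]) fun t ht0 ht1 => by simpa [flipChi] using hneg t ht0 ht1
  simp only [flipChi_flipChi] at h2
  rwa [union_comm] at h2

theorem isSimpleClosedCurve_Icc {γ : ℝ → ℝ × ℝ} {a b : ℝ} (hab : a < b)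
    (hc : ContinuousOn γ (Icc a b)) (hi : InjOn γ (Icc a b)) (ha : (γ a).1 = 0)
    (hb : (γ b).1 = 0) (hne : ∀ t ∈ Ioo a b, (γ t).1 ≠ 0) :
    IsSimpleClosedCurve (γ '' Icc a b ∪ (fun t => flipChi (γ t)) '' Icc a b) := by
  set e := iccHomeoI a b hab
  have he : ∀ t : unitInterval, ((e.symm t : Icc a b) : ℝ) = (b - a) * t + a :=
    fun t => iccHomeoI_symm_apply_coe a b hab t
  have h2 := isSimpleClosedCurve_of_ne_zero (γ := fun t => γ (e.symm t))
    (hc.comp_continuous (continuous_subtype_val.comp e.symm.continuous) fun t => (e.symm t).2)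
    (fun s t hst => e.symm.injective (Subtype.ext (hi (e.symm s).2 (e.symm t).2 hst)))
    (by rw [he]; simpa using ha) (by rw [he]; simpa using hb) fun t ht0 ht1 => by
      refine hne _ ?_
      have h3 : 0 < (t : ℝ) := unitInterval.pos_iff_ne_zero.mpr ht0
      have h4 : (t : ℝ) < 1 := unitInterval.lt_one_iff_ne_one.mpr ht1
      rw [he]
      constructor <;> nlinarith
  have h3 : ∀ f : ℝ → ℝ × ℝ, (range fun t : unitInterval => f (e.symm t)) = f '' Icc a b := by
    intro f
    have : (range fun t : unitInterval => f (e.symm t)) = range fun s : Icc a b => f s :=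
      e.symm.surjective.range_comp fun s : Icc a b => f s
    rw [this, image_eq_range]
  rw [h3, h3 fun t => flipChi (γ t)] at h2
  exact h2

theorem isSimpleClosedCurve_ennreal {γ : ENNReal → ℝ × ℝ} (hc : Continuous γ)
    (hi : Function.Injective γ) (h0 : (γ 0).1 = 0) (h1 : (γ ⊤).1 = 0)
    (hne : ∀ t, t ≠ 0 → t ≠ ⊤ → (γ t).1 ≠ 0) :
    IsSimpleClosedCurve (range γ ∪ range fun t => flipChi (γ t)) := by
  set e := ENNReal.orderIsoUnitIntervalBirational.symm
  have e0 : e 0 = 0 := e.map_bot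
  have e1 : e 1 = ⊤ := e.map_top
  have h2 := isSimpleClosedCurve_of_ne_zero (γ := fun t => γ (e t))
    (hc.comp e.continuous) (hi.comp e.injective) (by rw [e0, h0]) (by rw [e1, h1])
    fun t ht0 ht1 => hne _ (fun h3 => ht0 (e.injective (h3.trans e0.symm)))
      (fun h3 => ht1 (e.injective (h3.trans e1.symm)))
  have h3 : ∀ f : ENNReal → ℝ × ℝ, (range fun t => f (e t)) = range f :=
    fun f => e.surjective.range_comp f
  rw [h3, h3 fun t => flipChi (γ t)] at h2
  exact h2

/-! ### Continuity and the limit at infinity -/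

theorem coeff_X_mul_derivative (P : ℝ[X]) (n : ℕ) :
    (X * P.derivative).coeff n = n * P.coeff n := by
  cases n with
  | zero => simp
  | succ n => rw [coeff_X_mul, coeff_derivative]; push_cast; ring

theorem natDegree_X_mul_derivative_le (P : ℝ[X]) :
    (X * P.derivative).natDegree ≤ P.natDegree := by
  rw [natDegree_le_iff_coeff_eq_zero]
  intro n hn
  rw [coeff_X_mul_derivative, coeff_eq_zero_of_natDegree_lt hn, mul_zero]

namespace Admissible

variable {α β : Fin k → ℝ} (h : Admissible α β)
include h

theorem p0Poly_natDegree_eq : (p0Poly α β).natDegree = 2 * (critPoly α β).natDegree + 1 := by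
  have := h.one_le_kPrime
  have := h.critPoly_natDegree
  omega

theorem natDegree_lowerPoly_le : (lowerPoly α β).natDegree ≤ 3 * (critPoly α β).natDegree := by
  have hp := h.p0Poly_natDegree_eq
  have hp1 : (p1Poly α β).natDegree = 2 * (critPoly α β).natDegree := by
    rw [p1Poly, natDegree_divX_eq_natDegree_tsub_one, hp]; omega
  rw [lowerPoly]
  refine (natDegree_sub_le _ _).trans (max_le ?_ ?_)
  · refine natDegree_mul_le.trans ?_
    have := (natDegree_add_le (critPoly α β) (X * (critPoly α β).derivative)).trans
      (max_le le_rfl (natDegree_X_mul_derivative_le _))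
    omega
  · refine natDegree_mul_le.trans ?_
    have h1 := natDegree_C_mul_le (1 / 2) (critPoly α β)
    have h2 := natDegree_derivative_le (p0Poly α β)
    omega

/-- With `s = deg S`, the top coefficients combine with the factor `s - (2s + 1)/2 = -1/2`,
independent of `s`, so they never cancel. -/
theorem natDegree_curveDen : (curveDen α β).natDegree = 3 * (critPoly α β).natDegree + 1 := by
  have hp := h.p0Poly_natDegree_eq
  set s := (critPoly α β).natDegree with hs
  have hX := natDegree_X_mul_derivative_le (critPoly α β)
  have hXp := natDegree_X_mul_derivative_le (p0Poly α β)
  have e : curveDen α β = X * (critPoly α β).derivative * p0Poly α β -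
      C (1 / 2) * critPoly α β * (X * (p0Poly α β).derivative) - lowerPoly α β := by
    rw [curveDen, upperPoly]; ring
  have hA := h.natDegree_lowerPoly_le
  have hS2 := natDegree_C_mul_le (1 / 2) (critPoly α β)
  refine le_antisymm ?_ ?_
  · rw [e]
    refine (natDegree_sub_le _ _).trans (max_le ((natDegree_sub_le _ _).trans (max_le ?_ ?_)) ?_)
    · refine natDegree_mul_le.trans ?_
      omega
    · refine natDegree_mul_le.trans ?_
      omega
    · omega
  · refine le_natDegree_of_ne_zero ?_
    have h1 : (X * (critPoly α β).derivative * p0Poly α β).coeff (s + (2 * s + 1)) =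
        s * (critPoly α β).leadingCoeff * (p0Poly α β).leadingCoeff := by
      rw [coeff_mul_add_eq_of_natDegree_le hX hp.le, coeff_X_mul_derivative, ← hp]
      rfl
    have h2 : (C (1 / 2) * critPoly α β * (X * (p0Poly α β).derivative)).coeff
        (s + (2 * s + 1)) = 1 / 2 * (critPoly α β).leadingCoeff *
          ((2 * s + 1 : ℕ) * (p0Poly α β).leadingCoeff) := by
      rw [coeff_mul_add_eq_of_natDegree_le hS2 (hXp.trans hp.le), coeff_X_mul_derivative, coeff_C_mul,
        ← hp]
      rfl
    have h3 : (lowerPoly α β).coeff (s + (2 * s + 1)) = 0 :=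
      coeff_eq_zero_of_natDegree_lt (by omega)
    have h4 : (curveDen α β).coeff (s + (2 * s + 1)) =
        -(1 / 2) * (critPoly α β).leadingCoeff * (p0Poly α β).leadingCoeff := by
      rw [e, coeff_sub, coeff_sub, h1, h2, h3]
      push_cast; ring
    rw [show 3 * s + 1 = s + (2 * s + 1) by ring, h4]
    refine mul_ne_zero (mul_ne_zero (by norm_num) (leadingCoeff_ne_zero.mpr h.critPoly_ne_zero))
      (leadingCoeff_ne_zero.mpr h.p0Poly_ne_zero)

/-- For `χ` the square is used: its numerator has degree at most `6s + 1` against `6s + 2`. For `η`,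
write `U/V = 1 + 2A/V` with `deg A ≤ 3s < deg V`. -/
theorem tendsto_curve_atTop : Tendsto (curve α β) atTop (𝓝 (0, 1)) := by
  have hV := h.natDegree_curveDen
  have hA := h.natDegree_lowerPoly_le
  have hp := h.p0Poly_natDegree_eq
  have hp1 : (p1Poly α β).natDegree = 2 * (critPoly α β).natDegree := by
    rw [p1Poly, natDegree_divX_eq_natDegree_tsub_one, hp]; omega
  have hk : (k : ℝ) ≠ 0 := by exact_mod_cast (by have := h.one_le; omega : k ≠ 0)
  refine Tendsto.prodMk_nhds ?_ ?_
  · have h1 := div_tendsto_atTop_zero_of_degree_lt (C ((k : ℝ) ^ 2) * p1Poly α β ^ 2 * p0Poly α β)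
      (curveDen α β ^ 2) (by
        refine degree_lt_degree ?_
        rw [natDegree_pow, hV]
        refine lt_of_le_of_lt natDegree_mul_le ?_
        have h2 : (C ((k : ℝ) ^ 2) * p1Poly α β ^ 2).natDegree ≤
          4 * (critPoly α β).natDegree := by
          refine (natDegree_C_mul_le _ _).trans ?_
          rw [natDegree_pow, hp1]; omega
        omega)
    have h2 := (Real.continuous_sqrt.tendsto 0).comp h1
    rw [Real.sqrt_zero] at h2
    rw [tendsto_zero_iff_abs_tendsto_zero]
    refine h2.congr' ?_
    filter_upwards [eventually_gt_atTop 0] with x hx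
    rw [Function.comp_apply, Function.comp_apply, ← Real.sqrt_sq_eq_abs]
    congr 1
    simp only [eval_mul, eval_pow, eval_C]
    rw [div_pow, mul_pow, mul_pow, Real.sq_sqrt (h.p0Poly_eval_pos hx).le]
  · have h1 := (div_tendsto_atTop_zero_of_degree_lt (C 2 * lowerPoly α β) (curveDen α β) (by
        refine degree_lt_degree ?_
        have := natDegree_C_mul_le 2 (lowerPoly α β)
        omega)).const_add 1
    rw [add_zero] at h1
    refine h1.congr' ?_
    filter_upwards [eventually_gt_atTop 0] with x hx
    have h2 := h.curveDen_ne_zero (h.p0Poly_eval_pos hx)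
    rw [eval_mul, eval_C, eq_div_iff h2, add_mul, div_mul_cancel₀ _ h2, curveDen_eval,
      curveNum_eval]
    ring

theorem curveDen_ne_zero' {x : ℝ} (hz : 0 ≤ (p0Poly α β).eval x) : (curveDen α β).eval x ≠ 0 := by
  rcases hz.lt_or_eq with hz | hz
  · exact h.curveDen_ne_zero hz
  · by_cases hx : x = 0
    · subst hx; exact h.curve_zero.1
    · exact (h.curve_at_branch hz.symm hx).1

theorem continuousAt_curve {x : ℝ} (hz : 0 ≤ (p0Poly α β).eval x) :
    ContinuousAt (curve α β) x := by
  have hV := h.curveDen_ne_zero' hz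
  refine ContinuousAt.prodMk (ContinuousAt.div ?_ ?_ hV) (ContinuousAt.div ?_ ?_ hV)
  · exact (continuousAt_const.mul (p1Poly α β).continuous.continuousAt).mul
      (p0Poly α β).continuous.sqrt.continuousAt
  all_goals exact Polynomial.continuousAt _

/-! ### The rough-smooth boundaries -/

section Gap

variable {l : ℕ} (hl1 : 1 ≤ l) (hl : l < kPrime α β)
include hl1 hl

theorem p0Poly_nonneg_of_mem_Icc {x : ℝ}
    (hx : x ∈ Icc (branchPt α β (2 * l)) (branchPt α β (2 * l - 1))) :
    0 ≤ (p0Poly α β).eval x := by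
  have hi := h.gap_index hl1 hl
  rcases hx.1.eq_or_lt with h1 | h1
  · rw [← h1, h.p0Poly_eval_branchPt hi.1]
  rcases hx.2.eq_or_lt with h2 | h2
  · rw [h2, h.p0Poly_eval_branchPt hi.2]
  exact (h.p0Poly_eval_pos_of_gap hl1 hl ⟨h1, h2⟩).le

theorem curve_branchPt {j : ℕ} (hj : j = 2 * l ∨ j = 2 * l - 1) :
    curve α β (branchPt α β j) = (0, (branchPt α β j + 1) / (branchPt α β j - 1)) := by
  have hi := h.gap_index hl1 hl
  have hj2 : j < (p0Poly α β).natDegree := by omega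
  exact (h.curve_at_branch (h.p0Poly_eval_branchPt hj2) (h.branchPt_neg (by omega) hj2).ne).2

theorem mem_gap_or {x : ℝ} (hx : x ∈ Icc (branchPt α β (2 * l)) (branchPt α β (2 * l - 1))) :
    (x ∈ gap α β l ∧ (curve α β x).1 ≠ 0) ∨
      ∃ j, (j = 2 * l ∨ j = 2 * l - 1) ∧ x = branchPt α β j ∧
        curve α β x = (0, (x + 1) / (x - 1)) := by
  rcases hx.1.eq_or_lt with h1 | h1
  · exact Or.inr ⟨2 * l, Or.inl rfl, h1.symm, h1 ▸ h.curve_branchPt hl1 hl (Or.inl rfl)⟩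
  rcases hx.2.eq_or_lt with h2 | h2
  · exact Or.inr ⟨2 * l - 1, Or.inr rfl, h2, h2 ▸ h.curve_branchPt hl1 hl (Or.inr rfl)⟩
  exact Or.inl ⟨⟨h1, h2⟩, h.curve_fst_ne_zero (h.p0Poly_eval_pos_of_gap hl1 hl ⟨h1, h2⟩)⟩

omit h hl1 hl in
theorem eq_of_height_eq {x y : ℝ} (hx : x < 1) (hy : y < 1)
    (hxy : (x + 1) / (x - 1) = (y + 1) / (y - 1)) : x = y := by
  rw [div_eq_div_iff (by linarith) (by linarith)] at hxy
  linarith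

/-- Interior points are separated by the zero count, and from the ends by `χ ≠ 0`; the two ends have
different heights because `x ↦ (x+1)/(x-1)` is injective. -/
theorem curve_injOn_gap : InjOn (curve α β)
    (Icc (branchPt α β (2 * l)) (branchPt α β (2 * l - 1))) := by
  intro x hx y hy hxy
  have hneg := h.gap_neg hl1 hl
  rcases h.mem_gap_or hl1 hl hx with ⟨hx1, hx2⟩ | ⟨i, -, -, hx2⟩ <;>
    rcases h.mem_gap_or hl1 hl hy with ⟨hy1, hy2⟩ | ⟨j, -, -, hy2⟩
  · refine h.eq_of_curve_gap (c := curve α β x) hx2 ?_ hl1 hl hx1 hy1 (Or.inl rfl) (Or.inl hxy)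
    exact h.curve_fst_sq_lt (h.p0Poly_eval_pos_of_gap hl1 hl hx1) (by linarith [hx.2])
  · rw [hxy, hy2] at hx2; exact absurd rfl hx2
  · rw [← hxy, hx2] at hy2; exact absurd rfl hy2
  · rw [hx2, hy2, Prod.mk.injEq] at hxy
    exact eq_of_height_eq (by linarith [hx.2]) (by linarith [hy.2]) hxy.2

theorem roughSmooth_facts :
    IsSimpleClosedCurve (roughSmooth α β l) ∧
      (0, (branchPt α β (2 * l) + 1) / (branchPt α β (2 * l) - 1)) ∈ roughSmooth α β l ∧
      (0, (branchPt α β (2 * l - 1) + 1) / (branchPt α β (2 * l - 1) - 1)) ∈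
        roughSmooth α β l ∧
      (∀ c : ℝ × ℝ, c ∈ roughSmooth α β l ↔ flipChi c ∈ roughSmooth α β l) ∧
      ∃ γ : ℝ → ℝ × ℝ,
        ContinuousOn γ (Icc (branchPt α β (2 * l)) (branchPt α β (2 * l - 1))) ∧
        InjOn γ (Icc (branchPt α β (2 * l)) (branchPt α β (2 * l - 1))) ∧
        (∀ z ∈ Ioo (branchPt α β (2 * l)) (branchPt α β (2 * l - 1)),
          ((γ z).1 : ℂ) = chiFun α β z ∧ ((γ z).2 : ℂ) = etaFun α β z ∧ (γ z).1 ≠ 0) ∧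
        (∀ j ∈ ({2 * l, 2 * l - 1} : Set ℕ), γ (branchPt α β j) =
          (0, (branchPt α β j + 1) / (branchPt α β j - 1))) ∧
        roughSmooth α β l =
          γ '' Icc (branchPt α β (2 * l)) (branchPt α β (2 * l - 1)) ∪
            (fun z => flipChi (γ z)) '' Icc (branchPt α β (2 * l)) (branchPt α β (2 * l - 1)) := by
  have hlt := h.gap_lt hl1 hl
  have hneg := h.gap_neg hl1 hl
  have hRS := h.roughSmooth_eq hl1 hl
  have hi := h.gap_index hl1 hl
  have hcont : ContinuousOn (curve α β)
      (Icc (branchPt α β (2 * l)) (branchPt α β (2 * l - 1))) := fun x hx =>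
    (h.continuousAt_curve (h.p0Poly_nonneg_of_mem_Icc hl1 hl hx)).continuousWithinAt
  have hinj := h.curve_injOn_gap hl1 hl
  -- To agree with `χ(z)` the arc must carry the sign `(-1)^l`, so it is `curve` or its reflection
  -- according to the parity of `l`; the union with its mirror image is the same.
  obtain ⟨γ, hγc, hγi, hγε, hγ, hγ0⟩ : ∃ γ : ℝ → ℝ × ℝ,
      ContinuousOn γ (Icc (branchPt α β (2 * l)) (branchPt α β (2 * l - 1))) ∧
      InjOn γ (Icc (branchPt α β (2 * l)) (branchPt α β (2 * l - 1))) ∧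
      (∀ x, γ x = ((-1) ^ l * (curve α β x).1, (curve α β x).2)) ∧
      (∀ x c, (c = γ x ∨ c = flipChi (γ x)) ↔ (c = curve α β x ∨ c = flipChi (curve α β x))) ∧
      ∀ x, (γ x).1 = 0 ↔ (curve α β x).1 = 0 := by
    rcases neg_one_pow_eq_or ℝ l with hs | hs
    · exact ⟨curve α β, hcont, hinj, fun x => by rw [hs, one_mul], fun _ _ => Iff.rfl,
        fun _ => Iff.rfl⟩
    · refine ⟨fun x => flipChi (curve α β x), continuous_flipChi.comp_continuousOn hcont,
        fun x hx y hy hxy => hinj hx hy (injective_flipChi hxy), fun x => ?_, fun x c => ?_,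
        fun x => ?_⟩
      · simp only [hs, flipChi, neg_one_mul]
      · rw [flipChi_flipChi]; exact or_comm
      · simp [flipChi]
  have hset : roughSmooth α β l =
      γ '' Icc (branchPt α β (2 * l)) (branchPt α β (2 * l - 1)) ∪
        (fun z => flipChi (γ z)) '' Icc (branchPt α β (2 * l)) (branchPt α β (2 * l - 1)) := by
    rw [hRS]
    ext c
    simp only [mem_ofPred_eq, ← hγ, mem_union, mem_image, eq_comm (b := c)]
    constructor
    · rintro ⟨x, hx, h1 | h1⟩
      · exact Or.inl ⟨x, hx, h1⟩
      · exact Or.inr ⟨x, hx, h1⟩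
    · rintro (⟨x, hx, h1⟩ | ⟨x, hx, h1⟩)
      · exact ⟨x, hx, Or.inl h1⟩
      · exact ⟨x, hx, Or.inr h1⟩
  have hγb : ∀ j ∈ ({2 * l, 2 * l - 1} : Set ℕ), γ (branchPt α β j) =
      (0, (branchPt α β j + 1) / (branchPt α β j - 1)) := by
    intro j hj
    rw [hγε, h.curve_branchPt hl1 hl hj, mul_zero]
  have hne : ∀ z ∈ Ioo (branchPt α β (2 * l)) (branchPt α β (2 * l - 1)), (γ z).1 ≠ 0 :=
    fun z hz => (hγ0 z).not.mpr (h.curve_fst_ne_zero (h.p0Poly_eval_pos_of_gap hl1 hl hz))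
  refine ⟨?_, ?_, ?_, ?_, γ, hγc, hγi, ?_, hγb, hset⟩
  · rw [hset]
    exact isSimpleClosedCurve_Icc hlt hγc hγi (by rw [hγb _ (Or.inl rfl)])
      (by rw [hγb _ (Or.inr rfl)]) hne
  · rw [hRS]
    exact ⟨_, left_mem_Icc.mpr hlt.le, Or.inl (h.curve_branchPt hl1 hl (Or.inl rfl)).symm⟩
  · rw [hRS]
    exact ⟨_, right_mem_Icc.mpr hlt.le, Or.inl (h.curve_branchPt hl1 hl (Or.inr rfl)).symm⟩
  · intro c
    rw [hRS]
    simp only [mem_ofPred_eq]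
    refine exists_congr fun x => and_congr_right fun _ => ?_
    rw [or_comm]
    refine or_congr ?_ injective_flipChi.eq_iff.symm
    constructor
    · rintro rfl; simp
    · intro h1; rw [← h1, flipChi_flipChi]
  · intro z hz
    obtain ⟨h1, h2⟩ := h.chiFun_etaFun_eq hi.1.le (fun j hj => h.gap_sub_sign hl1 hl hz hj)
      (h.p0Poly_eval_pos_of_gap hl1 hl hz) (by linarith [hz.2])
    rw [h1, h2, hγε]
    refine ⟨rfl, rfl, ?_⟩
    rw [← hγε]
    exact hne z hz

end Gap

/-! ### The frozen-rough boundary -/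

/-- The parametrization of the frozen-rough boundary by `[0, ∞]`. -/
def _root_.PeriodicAztec.outerCurve (α β : Fin k → ℝ) (z : ENNReal) : ℝ × ℝ :=
  if z = ⊤ then (0, 1) else curve α β z.toReal

omit h in
theorem outerCurve_ofReal {x : ℝ} (hx : 0 ≤ x) :
    outerCurve α β (ENNReal.ofReal x) = curve α β x := by
  rw [outerCurve, if_neg ENNReal.ofReal_ne_top, ENNReal.toReal_ofReal hx]

omit h in
theorem outerCurve_top : outerCurve α β ⊤ = (0, 1) := if_pos rfl

theorem outerCurve_zero : outerCurve α β 0 = (0, -1) := by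
  rw [← ENNReal.ofReal_zero, outerCurve_ofReal le_rfl, h.curve_zero.2]

theorem outerCurve_one : outerCurve α β 1 = (1, touchHeight α β) := by
  rw [← ENNReal.ofReal_one, outerCurve_ofReal zero_le_one, h.curve_one]

theorem p0Poly_eval_nonneg {x : ℝ} (hx : 0 ≤ x) : 0 ≤ (p0Poly α β).eval x := by
  rcases hx.lt_or_eq with hx | rfl
  · exact (h.p0Poly_eval_pos hx).le
  · exact (h.p0Poly_eval_eq_zero_iff.mpr h.zero_mem_simple).ge

theorem continuous_outerCurve : Continuous (outerCurve α β) := by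
  rw [continuous_iff_continuousAt]
  intro z
  by_cases hz : z = ⊤
  · subst hz
    rw [ContinuousAt, outerCurve_top, tendsto_def]
    intro U hU
    obtain ⟨R, hR⟩ := mem_atTop_sets.mp (h.tendsto_curve_atTop hU)
    filter_upwards [Ioi_mem_nhds (ENNReal.ofReal_lt_top (r := R))] with w hw
    rw [mem_preimage, outerCurve]
    split_ifs with hw1
    · exact mem_of_mem_nhds hU
    · exact hR _ ((ENNReal.ofReal_le_iff_le_toReal hw1).mp (le_of_lt hw))
  · have h1 : outerCurve α β =ᶠ[𝓝 z] fun w => curve α β w.toReal := by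
      filter_upwards [eventually_ne_nhds hz] with w hw
      rw [outerCurve, if_neg hw]
    refine ContinuousAt.congr ?_ h1.symm
    exact (h.continuousAt_curve (h.p0Poly_eval_nonneg ENNReal.toReal_nonneg)).comp
      (ENNReal.tendsto_toReal hz)

/-- The point `0` is singled out by `χ = 0` and the point `1` by `χ = 1`; the zero count, which
needs `0 < |χ| < 1`, handles all others. -/
theorem curve_injOn_Ici : InjOn (curve α β) (Ici 0) := by
  intro x hx y hy hxy
  have hne : ∀ z : ℝ, 0 < z → (curve α β z).1 ≠ 0 := fun z hz =>
    h.curve_fst_ne_zero (h.p0Poly_eval_pos hz)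
  have h0 : (curve α β 0).1 = 0 := by rw [h.curve_zero.2]
  have hsq : ∀ z : ℝ, 0 < z → z ≠ 1 → (curve α β z).1 ^ 2 < 1 := fun z hz =>
    h.curve_fst_sq_lt (h.p0Poly_eval_pos hz)
  have h1 : (curve α β 1).1 = 1 := by rw [h.curve_one]
  rcases (show (0 : ℝ) ≤ x from hx).eq_or_lt with rfl | hx
  · rcases (show (0 : ℝ) ≤ y from hy).eq_or_lt with rfl | hy
    · rfl
    · exact absurd (hxy ▸ h0) (hne y hy)
  rcases (show (0 : ℝ) ≤ y from hy).eq_or_lt with rfl | hy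
  · exact absurd (hxy ▸ h0) (hne x hx)
  by_cases hx1 : x = 1
  · subst hx1
    by_contra hy1
    have := hsq y hy (Ne.symm hy1)
    rw [← hxy, h1] at this
    norm_num at this
  by_cases hy1 : y = 1
  · subst hy1
    have := hsq x hx hx1
    rw [hxy, h1] at this
    norm_num at this
  exact h.eq_of_curve_pos (hne x hx) (hsq x hx hx1) hx hx1 hy hy1 (Or.inl rfl) (Or.inl hxy)

theorem curve_ne_top {x : ℝ} (hx : 0 ≤ x) : curve α β x ≠ (0, 1) := by
  intro h1
  rcases hx.eq_or_lt with rfl | hx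
  · rw [h.curve_zero.2] at h1
    norm_num at h1
  · exact h.curve_fst_ne_zero (h.p0Poly_eval_pos hx) (by rw [h1])

theorem injective_outerCurve : Function.Injective (outerCurve α β) := by
  intro z w hzw
  unfold outerCurve at hzw
  split_ifs at hzw with h1 h2 h2
  · rw [h1, h2]
  · exact absurd hzw.symm (h.curve_ne_top ENNReal.toReal_nonneg)
  · exact absurd hzw (h.curve_ne_top ENNReal.toReal_nonneg)
  · exact (ENNReal.toReal_eq_toReal_iff' h1 h2).mp
      (h.curve_injOn_Ici ENNReal.toReal_nonneg ENNReal.toReal_nonneg hzw)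

theorem frozenRoughExt_eq : frozenRoughExt α β =
    range (outerCurve α β) ∪ range fun z => flipChi (outerCurve α β z) := by
  rw [frozenRoughExt, h.frozenRough_eq]
  apply Subset.antisymm
  · rintro c (⟨x, hx, -, rfl | rfl⟩ | rfl | rfl | rfl | rfl)
    · exact Or.inl ⟨_, outerCurve_ofReal hx.le⟩
    · exact Or.inr ⟨ENNReal.ofReal x, by simp only [outerCurve_ofReal hx.le]⟩
    · exact Or.inl ⟨_, outerCurve_top⟩
    · exact Or.inl ⟨_, h.outerCurve_zero⟩
    · exact Or.inl ⟨_, h.outerCurve_one⟩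
    · exact Or.inr ⟨1, by simp only [h.outerCurve_one]; rfl⟩
  · have key : ∀ z, outerCurve α β z = (0, 1) ∨ outerCurve α β z = (0, -1) ∨
        outerCurve α β z = (1, touchHeight α β) ∨
        ∃ x, 0 < x ∧ x ≠ 1 ∧ outerCurve α β z = curve α β x := by
      intro z
      by_cases h1 : z = ⊤
      · exact Or.inl (h1 ▸ outerCurve_top)
      by_cases h2 : z = 0
      · exact Or.inr (Or.inl (h2 ▸ h.outerCurve_zero))
      by_cases h3 : z = 1
      · exact Or.inr (Or.inr (Or.inl (h3 ▸ h.outerCurve_one)))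
      refine Or.inr (Or.inr (Or.inr ⟨z.toReal, ENNReal.toReal_pos h2 h1, ?_, if_neg h1⟩))
      rwa [Ne, ENNReal.toReal_eq_one_iff]
    rintro c (⟨z, rfl⟩ | ⟨z, rfl⟩)
    · rcases key z with h1 | h1 | h1 | ⟨x, hx, hx1, h1⟩
      · rw [h1]; right; simp
      · rw [h1]; right; simp
      · rw [h1]; right; simp
      · exact Or.inl ⟨x, hx, hx1, Or.inl h1⟩
    · rcases key z with h1 | h1 | h1 | ⟨x, hx, hx1, h1⟩ <;> simp only [h1]
      · right; simp [flipChi]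
      · right; simp [flipChi]
      · right; simp [flipChi]
      · exact Or.inl ⟨x, hx, hx1, Or.inr rfl⟩

theorem frozenRoughExt_facts :
    IsSimpleClosedCurve (frozenRoughExt α β) ∧
      (∀ c : ℝ × ℝ, c ∈ frozenRoughExt α β ↔ flipChi c ∈ frozenRoughExt α β) ∧
      ∃ γ : ENNReal → ℝ × ℝ,
        Continuous γ ∧ Function.Injective γ ∧
        (∀ z : ℝ, 0 < z → z ≠ 1 →
          ((γ (ENNReal.ofReal z)).1 : ℂ) = chiFun α β z ∧
          ((γ (ENNReal.ofReal z)).2 : ℂ) = etaFun α β z ∧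
          (γ (ENNReal.ofReal z)).1 ≠ 0) ∧
        γ 0 = (0, -1) ∧ γ 1 = (1, touchHeight α β) ∧ γ ⊤ = (0, 1) ∧
        frozenRoughExt α β = range γ ∪ range (fun z => flipChi (γ z)) := by
  have hne : ∀ z : ℝ, 0 < z → (curve α β z).1 ≠ 0 := fun z hz =>
    h.curve_fst_ne_zero (h.p0Poly_eval_pos hz)
  refine ⟨?_, fun c => ?_, outerCurve α β, h.continuous_outerCurve, h.injective_outerCurve,
    fun z hz hz1 => ?_, h.outerCurve_zero, h.outerCurve_one, outerCurve_top, h.frozenRoughExt_eq⟩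
  · rw [h.frozenRoughExt_eq]
    refine isSimpleClosedCurve_ennreal h.continuous_outerCurve h.injective_outerCurve
      (by rw [h.outerCurve_zero]) (by rw [outerCurve_top]) fun t ht0 ht1 => ?_
    rw [outerCurve, if_neg ht1]
    exact hne _ (ENNReal.toReal_pos ht0 ht1)
  · rw [h.frozenRoughExt_eq]
    constructor
    · rintro (⟨z, rfl⟩ | ⟨z, rfl⟩)
      · exact Or.inr ⟨z, rfl⟩
      · exact Or.inl ⟨z, by simp⟩
    · rintro (⟨z, hz⟩ | ⟨z, hz⟩)
      · exact Or.inr ⟨z, by simp [hz]⟩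
      · exact Or.inl ⟨z, injective_flipChi hz⟩
  -- On `(0, ∞)` no branch point lies to the right, so `l = 0` and there is no sign.
  · have h1 := h.chiFun_etaFun_eq (l := 0) (x := z) (Nat.zero_le _) (fun j hj =>
      ⟨fun h2 => absurd h2 (by omega), fun _ => by
        have := h.branchPt_le (Nat.zero_le j) hj
        rw [h.branchPt_zero] at this
        linarith⟩) (h.p0Poly_eval_pos hz) hz1
    rw [pow_zero, one_mul] at h1
    rw [outerCurve_ofReal hz.le, h1.1, h1.2]
    exact ⟨rfl, rfl, hne z hz⟩

/-! ### Disjointness -/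

/-- A common point with `χ ≠ 0` would need four zeros of `N` in the gap and two on `(0, ∞)`, where
only four are available in all. The four added points lie outside the open square. -/
theorem disjoint_roughSmooth_frozenRoughExt {l : ℕ} (hl1 : 1 ≤ l) (hl : l < kPrime α β) :
    Disjoint (roughSmooth α β l) (frozenRoughExt α β) := by
  rw [Set.disjoint_left]
  rintro c hc1 hc2
  have hsq := hc1.1
  have hsq2 := hc1.2.1
  have hlt1 : c.1 ^ 2 < 1 := by rw [sq_lt_one_iff_abs_lt_one, abs_lt]; exact hsq
  rw [h.roughSmooth_eq hl1 hl] at hc1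
  obtain ⟨x, hx, hcx⟩ := hc1
  rcases hc2 with hc2 | rfl | rfl | rfl | rfl
  · rw [h.frozenRough_eq] at hc2
    obtain ⟨y, hy, hy1, hcy⟩ := hc2
    have hc0 : c.1 ≠ 0 := by
      have := h.curve_fst_ne_zero (h.p0Poly_eval_pos hy)
      rcases hcy with rfl | rfl
      · exact this
      · simpa [flipChi] using this
    rcases h.mem_gap_or hl1 hl hx with ⟨hx1, -⟩ | ⟨j, -, -, hx2⟩
    · have h1 := h.four_le_numRoots_gap hc0 hlt1 hl1 hl hx1 hcx
      have h2 := h.two_le_numRoots_pos hy hy1 hcy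
      have h3 := h.numRoots_gap_add_pos_le hc0 hlt1 hl1 hl
      omega
    · apply hc0
      rcases hcx with rfl | rfl <;> simp [hx2, flipChi]
  · exact lt_irrefl _ hsq2.2
  · exact lt_irrefl _ hsq2.1
  · exact lt_irrefl _ hsq.2
  · exact lt_irrefl _ hsq.1

/-- Off `χ = 0` a common point would need four zeros in each gap, eight against a budget of six. On
`χ = 0` the heights identify branch points, and distinct gaps share none. -/
theorem disjoint_roughSmooth {l l' : ℕ} (hl1 : 1 ≤ l) (hl : l < kPrime α β) (hl1' : 1 ≤ l')
    (hl' : l' < kPrime α β) (hne : l ≠ l') :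
    Disjoint (roughSmooth α β l) (roughSmooth α β l') := by
  rw [Set.disjoint_left]
  rintro c hc1 hc2
  have hlt1 : c.1 ^ 2 < 1 := by rw [sq_lt_one_iff_abs_lt_one, abs_lt]; exact hc1.1
  rw [h.roughSmooth_eq hl1 hl] at hc1
  rw [h.roughSmooth_eq hl1' hl'] at hc2
  obtain ⟨x, hx, hcx⟩ := hc1
  obtain ⟨y, hy, hcy⟩ := hc2
  have hfst : ∀ z, c = curve α β z ∨ c = flipChi (curve α β z) →
      (c.1 = 0 ↔ (curve α β z).1 = 0) ∧ c.2 = (curve α β z).2 := by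
    rintro z (rfl | rfl) <;> simp [flipChi]
  obtain ⟨hx1, hx2⟩ := hfst x hcx
  obtain ⟨hy1, hy2⟩ := hfst y hcy
  rcases h.mem_gap_or hl1 hl hx with ⟨hxg, hx3⟩ | ⟨i, hi, hxi, hx3⟩ <;>
    rcases h.mem_gap_or hl1' hl' hy with ⟨hyg, hy3⟩ | ⟨j, hj, hyj, hy3⟩
  · have hc0 := hx1.not.mpr hx3
    have h1 := h.four_le_numRoots_gap hc0 hlt1 hl1 hl hxg hcx
    have h2 := h.four_le_numRoots_gap hc0 hlt1 hl1' hl' hyg hcy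
    have h3 := h.numRoots_gap_add_gap_le hc0 hlt1 hl1 hl hl1' hl' hne
    omega
  · exact hx3 (hx1.mp (hy1.mpr (by rw [hy3])))
  · exact hy3 (hy1.mp (hx1.mpr (by rw [hx3])))
  · have hn := h.gap_neg hl1 hl
    have hn' := h.gap_neg hl1' hl'
    rw [hx2, hx3, hy3] at hy2
    have hxy := eq_of_height_eq (by linarith [hx.2]) (by linarith [hy.2]) hy2
    rw [hxi, hyj] at hxy
    have hi1 := h.gap_index hl1 hl
    have hj1 := h.gap_index hl1' hl'
    rcases lt_trichotomy i j with h1 | h1 | h1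
    · exact (h.branchPt_lt h1 (by omega)).ne' hxy
    · omega
    · exact (h.branchPt_lt h1 (by omega)).ne hxy

theorem spectral_data :
    discPoly α β = qPoly α β ^ 2 * p0Poly α β ∧
      (qPoly α β).Monic ∧ Squarefree (qPoly α β) ∧ Squarefree (p0Poly α β) ∧
      1 ≤ kPrime α β ∧ (qPoly α β).natDegree + kPrime α β = k ∧
      (p0Poly α β).natDegree + 1 = 2 * kPrime α β ∧ branchPt α β 0 = 0 ∧
      StrictAntiOn (branchPt α β) (Iic (2 * (kPrime α β - 1))) ∧
      ∀ z : ℂ, aeval z (p0Poly α β) = 0 ↔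
        ∃ j ≤ 2 * (kPrime α β - 1), z = (branchPt α β j : ℂ) := by
  have hk := h.one_le_kPrime
  refine ⟨h.discPoly_eq_sq_mul, qPoly_monic, h.qPoly_squarefree, h.p0Poly_squarefree, hk.1, hk.2.1,
    hk.2.2, h.branchPt_zero, ?_, fun z => ?_⟩
  · intro i hi j hj hij
    rw [mem_Iic] at hj
    exact h.branchPt_lt hij (by omega)
  · rw [h.p0Poly_aeval_eq_zero_iff]
    refine exists_congr fun j => and_congr_left fun _ => ?_
    omega

end Admissible

end PeriodicAztec

end

theorem mainTheorem9 (k : ℕ) (hk : 1 ≤ k) (α β : Fin k → ℝ)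
    (hα : ∀ m, 0 < α m) (hβ : ∀ m, 0 < β m) (hαβ : ∏ m, α m = ∏ m, β m) :
    -- the data are as they should be: `p = q² p₀`, simple zeros, `0 = x₀ > x₁ > ⋯ > x_{2(k'-1)}`
    (PeriodicAztec.discPoly α β = PeriodicAztec.qPoly α β ^ 2 * PeriodicAztec.p0Poly α β ∧
      (PeriodicAztec.qPoly α β).Monic ∧ Squarefree (PeriodicAztec.qPoly α β) ∧
      Squarefree (PeriodicAztec.p0Poly α β) ∧
      1 ≤ PeriodicAztec.kPrime α β ∧
      (PeriodicAztec.qPoly α β).natDegree + PeriodicAztec.kPrime α β = k ∧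
      (PeriodicAztec.p0Poly α β).natDegree + 1 = 2 * PeriodicAztec.kPrime α β ∧
      PeriodicAztec.branchPt α β 0 = 0 ∧
      StrictAntiOn (PeriodicAztec.branchPt α β) (Set.Iic (2 * (PeriodicAztec.kPrime α β - 1))) ∧
      ∀ z : ℂ, Polynomial.aeval z (PeriodicAztec.p0Poly α β) = 0 ↔
        ∃ j ≤ 2 * (PeriodicAztec.kPrime α β - 1), z = (PeriodicAztec.branchPt α β j : ℂ)) ∧
    -- the rough-smooth boundaries
    (∀ l : ℕ, 1 ≤ l → l < PeriodicAztec.kPrime α β →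
      PeriodicAztec.IsSimpleClosedCurve (PeriodicAztec.roughSmooth α β l) ∧
      (0, (PeriodicAztec.branchPt α β (2 * l) + 1) / (PeriodicAztec.branchPt α β (2 * l) - 1))
        ∈ PeriodicAztec.roughSmooth α β l ∧
      (0, (PeriodicAztec.branchPt α β (2 * l - 1) + 1) /
          (PeriodicAztec.branchPt α β (2 * l - 1) - 1))
        ∈ PeriodicAztec.roughSmooth α β l ∧
      (∀ c : ℝ × ℝ, c ∈ PeriodicAztec.roughSmooth α β l ↔
        PeriodicAztec.flipChi c ∈ PeriodicAztec.roughSmooth α β l) ∧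
      ∃ γ : ℝ → ℝ × ℝ,
        ContinuousOn γ (Set.Icc (PeriodicAztec.branchPt α β (2 * l))
          (PeriodicAztec.branchPt α β (2 * l - 1))) ∧
        Set.InjOn γ (Set.Icc (PeriodicAztec.branchPt α β (2 * l))
          (PeriodicAztec.branchPt α β (2 * l - 1))) ∧
        (∀ z ∈ Set.Ioo (PeriodicAztec.branchPt α β (2 * l))
            (PeriodicAztec.branchPt α β (2 * l - 1)),
          ((γ z).1 : ℂ) = PeriodicAztec.chiFun α β z ∧
          ((γ z).2 : ℂ) = PeriodicAztec.etaFun α β z ∧ (γ z).1 ≠ 0) ∧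
        (∀ j ∈ ({2 * l, 2 * l - 1} : Set ℕ), γ (PeriodicAztec.branchPt α β j) =
          (0, (PeriodicAztec.branchPt α β j + 1) / (PeriodicAztec.branchPt α β j - 1))) ∧
        PeriodicAztec.roughSmooth α β l =
          γ '' Set.Icc (PeriodicAztec.branchPt α β (2 * l))
              (PeriodicAztec.branchPt α β (2 * l - 1)) ∪
            (fun z => PeriodicAztec.flipChi (γ z)) ''
              Set.Icc (PeriodicAztec.branchPt α β (2 * l))
                (PeriodicAztec.branchPt α β (2 * l - 1))) ∧
    -- the frozen-rough boundary
    (PeriodicAztec.IsSimpleClosedCurve (PeriodicAztec.frozenRoughExt α β) ∧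
      (∀ c : ℝ × ℝ, c ∈ PeriodicAztec.frozenRoughExt α β ↔
        PeriodicAztec.flipChi c ∈ PeriodicAztec.frozenRoughExt α β) ∧
      ∃ γ : ENNReal → ℝ × ℝ,
        Continuous γ ∧ Function.Injective γ ∧
        (∀ z : ℝ, 0 < z → z ≠ 1 →
          ((γ (ENNReal.ofReal z)).1 : ℂ) = PeriodicAztec.chiFun α β z ∧
          ((γ (ENNReal.ofReal z)).2 : ℂ) = PeriodicAztec.etaFun α β z ∧
          (γ (ENNReal.ofReal z)).1 ≠ 0) ∧
        γ 0 = (0, -1) ∧ γ 1 = (1, PeriodicAztec.touchHeight α β) ∧ γ ⊤ = (0, 1) ∧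
        PeriodicAztec.frozenRoughExt α β =
          Set.range γ ∪ Set.range (fun z => PeriodicAztec.flipChi (γ z))) ∧
    -- the curves are pairwise disjoint
    (∀ l : ℕ, 1 ≤ l → l < PeriodicAztec.kPrime α β →
      Disjoint (PeriodicAztec.roughSmooth α β l) (PeriodicAztec.frozenRoughExt α β) ∧
      ∀ l' : ℕ, 1 ≤ l' → l' < PeriodicAztec.kPrime α β → l ≠ l' →
        Disjoint (PeriodicAztec.roughSmooth α β l) (PeriodicAztec.roughSmooth α β l')) := by
  have h : PeriodicAztec.Admissible α β := ⟨hk, hα, hβ, hαβ⟩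
  exact ⟨h.spectral_data, fun l hl1 hl => h.roughSmooth_facts hl1 hl, h.frozenRoughExt_facts,
    fun l hl1 hl => ⟨h.disjoint_roughSmooth_frozenRoughExt hl1 hl,
      fun l' hl1' hl' hne => h.disjoint_roughSmooth hl1 hl hl1' hl' hne⟩⟩
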